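/- Let $\mathbb{K}\subset\mathbb{C}$ be a number field, $n\ge 0$, $x=(x_1,\dots,x_n)$. A *hyperexponential function* over $\mathbb{K}$ on a nonempty connected open set $U\subset\mathbb{C}^n$ is an analytic function $H\not\equiv 0$ on $U$ such that $dH/H=\omega$ for a rational $1$-form $\omega=\sum_k\omega_k dx_k$ with coefficients in $\mathbb{K}(x)$. An algebraic number is *traceless* if the second leading coefficient of its monic minimal polynomial over $\mathbb{Q}$ is $0$. A *representation* for $\omega$ consists of $q\in\mathbb{N}^*$, $F_0,A\in\mathbb{K}(x)$ with $A\ne0$, traceless algebraic numbers $\lambda_1,\dots,\lambda_p$ ($p\ge0$) linearly independent over $\mathbb{Q}$, and nonzero $F_1,\dots,F_p\in\mathbb{L}(x)$, where $\mathbb{L}=\mathbb{K}(\lambda_1,\dots,\lambda_p)$ is a finite extension of $\mathbb{K}$, such that $$e^{F_0}A^{1/q}\prod_{i=1}^pF_i^{\lambda_i}$$ is a solution of $dH/H=\omega$, that is, $\omega=dF_0+\frac1q\frac{dA}{A}+\sum_i\lambda_i\frac{dF_i}{F_i}$ and every analytic branch of the expression on a nonempty connected open set satisfies $dH/H=\omega$.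 1. For every hyperexponential function $H$ over $\mathbb{K}$ on $U$ there is a representation for $dH/H$ such that $H$ equals $e^{F_0}A^{1/q}\prod F_i^{\lambda_i}$ up to a nonzero constant: near each point of $U$ at which $F_0$ is defined and $A,F_1,\dots,F_p$ have neither zeros nor poles the expression has an analytic branch, and on any nonempty connected open subset of $U$ consisting of such points, $H$ is a nonzero constant times any branch. 2. On input a closed $1$-form $\omega$ with coefficients in $\mathbb{K}(x)$, every run of the following algorithm RationalIntegration terminates without getting stuck, and whatever the choices made in the run, its output is a representation for $\omega$, which expresses in the sense of 1 every $H$ (on every $U$) with $dH/H=\omega$. Start with $F_0=0$, $A=1$ (a formal product of rational powers), $Res=[\,]$. For $i=n,\dots,1$: (a) choose a Hermite reduction $\omega_i=\frac PQ+\partial_iR$ with $P,Q\in\mathbb{K}(x_1,\dots,x_{i-1})[x_i]$, $Q$ monic squarefree, $\deg P<\deg Q$, $R\in\mathbb{K}(x_1,\dots,x_i)$; add $R$ to $F_0$ and subtract $dR$ from $\omega$; (b) factor $Q=Q_1\cdots Q_l$ into monic irreducibles and for each $j$: let $S_j\in\mathbb{K}[\lambda]$ be the largest monic divisor with coefficients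 in $\mathbb{K}$ of the resultant in $x_i$ of $Q_j$ and $P-\lambda\partial_iQ$; let $\tilde S_j=\prod_{\sigma:\mathbb{K}\to\mathbb{C}}\sigma(S_j)$, let $-s_j$ be the quotient of its second leading coefficient by its leading coefficient, and $r_j=s_j/\deg\tilde S_j\in\mathbb{Q}$; multiply $A$ by $Q_j^{r_j}$; for each root $\lambda\in\mathbb{C}$ of $S_j$, let $G_\lambda$ be the monic gcd of $Q_j$ and $P-\lambda\partial_iQ$ and append $[\lambda-r_j,G_\lambda]$ to $Res$; subtract $\sum_\lambda\lambda\,dG_\lambda/G_\lambda$ from $\omega$. Finally take the least $q\in\mathbb{N}^*$ for which all exponents of $A^q$ are integers and replace $A$ by $A^q$; choose a basis $(\lambda_1,\dots,\lambda_p)$ of the $\mathbb{Z}$-module generated by the first entries of $Res$ and an integer matrix $M$ with $Res_{k,1}=\sum_jM_{k,j}\lambda_j$; return $F_0,A,q,(\lambda_j)_j$ and $F_j=\prod_kRes_{k,2}^{M_{k,j}}$. 3. A representation is effectively computable from $\omega$. Suppose that the algebraic numbers are named by natural numbers in such a way that equality is decidable and addition and multiplication are computable on names, that a polynomial is given by the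 list of its terms, and that a rational function is given by a numerator and a denominator. Then there is one partial recursive function which, given $n$, a name of a generator $\alpha$ of $\mathbb{K}=\mathbb{Q}(\alpha)$, and a closed $1$-form $\omega$ over $\mathbb{K}(x)$, returns a representation for $\omega$. -/

import Mathlib

open scoped BigOperators

noncomputable section

/-! ### Rational functions in `n` variables and rational 1-forms -/

/-- The field `ℂ(x₁, …, xₙ)`. -/
abbrev RatFun (n : ℕ) : Type := FractionRing (MvPolynomial (Fin n) ℂ)

namespace RatFun

variable {n : ℕ}

/-- The constant function `c`. -/
def const (n : ℕ) : ℂ →+* RatFun n :=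
  (algebraMap (MvPolynomial (Fin n) ℂ) (RatFun n)).comp MvPolynomial.C

/-- The coordinate function `x_i`. -/
def var (i : Fin n) : RatFun n :=
  algebraMap (MvPolynomial (Fin n) ℂ) (RatFun n) (MvPolynomial.X i)

/-- The subfield `k(x_j : j ∈ s)` of `ℂ(x₁, …, xₙ)`, for a field of constants `k ⊆ ℂ`. -/
def ratField (k : Subfield ℂ) (s : Set (Fin n)) : Subfield (RatFun n) :=
  Subfield.closure (const n '' (k : Set ℂ) ∪ var '' s)

/-- The inclusion `k → k(x_j : j ∈ s)`. -/
def constHom (k : Subfield ℂ) (s : Set (Fin n)) : k →+* ratField k s :=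
  ((const n).comp k.subtype).codRestrict (ratField k s)
    (fun c => Subfield.subset_closure (Or.inl ⟨c, c.2, rfl⟩))

/-- Numerator of the reduced fraction. -/
def num (f : RatFun n) : MvPolynomial (Fin n) ℂ :=
  IsFractionRing.num (MvPolynomial (Fin n) ℂ) f

/-- Denominator of the reduced fraction. -/
def den (f : RatFun n) : MvPolynomial (Fin n) ℂ :=
  (IsFractionRing.den (MvPolynomial (Fin n) ℂ) f : MvPolynomial (Fin n) ℂ)

/-- The partial derivative `∂f/∂x_i` (quotient rule). -/
def pd (i : Fin n) (f : RatFun n) : RatFun n :=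
  algebraMap (MvPolynomial (Fin n) ℂ) (RatFun n)
      (MvPolynomial.pderiv i f.num * f.den - f.num * MvPolynomial.pderiv i f.den) /
    algebraMap (MvPolynomial (Fin n) ℂ) (RatFun n) (f.den ^ 2)

/-- The value of `f` at a point where its denominator does not vanish. -/
def eval (f : RatFun n) (x : Fin n → ℂ) : ℂ :=
  MvPolynomial.eval x f.num / MvPolynomial.eval x f.den

/-- `f` has no pole at `x`. -/
def DefinedAt (f : RatFun n) (x : Fin n → ℂ) : Prop :=
  MvPolynomial.eval x f.den ≠ 0

/-- `f` has neither a zero nor a pole at `x`. -/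
def UnitAt (f : RatFun n) (x : Fin n → ℂ) : Prop :=
  MvPolynomial.eval x f.num ≠ 0 ∧ MvPolynomial.eval x f.den ≠ 0

end RatFun

/-- A rational 1-form `∑ ω_k dx_k`, given by its coefficients. -/
abbrev RatForm (n : ℕ) : Type := Fin n → RatFun n

namespace RatForm

variable {n : ℕ}

/-- The form has coefficients in `k(x₁, …, xₙ)`. -/
def IsOver (k : Subfield ℂ) (ω : RatForm n) : Prop :=
  ∀ i, ω i ∈ RatFun.ratField k Set.univ

/-- The form is closed. -/
def Closed (ω : RatForm n) : Prop :=
  ∀ i j, RatFun.pd i (ω j) = RatFun.pd j (ω i)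

/-- The exact form `df`. -/
def d (f : RatFun n) : RatForm n := fun i => RatFun.pd i f

/-- The logarithmic differential `df/f`. -/
def dlog (f : RatFun n) : RatForm n := fun i => RatFun.pd i f / f

end RatForm

/-! ### Hyperexponential functions -/

/-- `H` is an analytic function on the nonempty connected open set `U`, not identically zero, and
`dH/H = ω` (the denominators of `ω` are cleared, so that `U` may meet the poles of `ω`). -/
structure HasLogDifferential {n : ℕ} (U : Set (Fin n → ℂ)) (H : (Fin n → ℂ) → ℂ)
    (ω : RatForm n) : Prop where
  isOpen : IsOpen U
  isConnected : IsConnected U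
  analytic : AnalyticOnNhd ℂ H U
  ne_zero : ∃ x ∈ U, H x ≠ 0
  eq : ∀ x ∈ U, ∀ k : Fin n,
    MvPolynomial.eval x (ω k).den * fderiv ℂ H x (Pi.single k 1) =
      MvPolynomial.eval x (ω k).num * H x

/-- `H` is hyperexponential on `U`: its logarithmic differential is a rational 1-form with
coefficients in `K(x₁, …, xₙ)`. -/
def IsHyperexponential {n : ℕ} (K : Subfield ℂ) (U : Set (Fin n → ℂ))
    (H : (Fin n → ℂ) → ℂ) : Prop :=
  ∃ ω : RatForm n, ω.IsOver K ∧ HasLogDifferential U H ω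

/-- A complex number is traceless if the second leading coefficient of its monic minimal
polynomial over `ℚ` vanishes (used for algebraic numbers only). -/
def IsTraceless (z : ℂ) : Prop := (minpoly ℚ z).nextCoeff = 0

/-- The data `F₀, A, q, λ₁, …, λ_p, F₁, …, F_p` of an expression
`e^{F₀} A^{1/q} ∏ F_j^{λ_j}`. -/
structure HyperexpData (n : ℕ) where
  F0 : RatFun n
  A : RatFun n
  q : ℕ
  p : ℕ
  lam : Fin p → ℂ
  F : Fin p → RatFun n

namespace HyperexpData

variable {n : ℕ}

/-- The points at which `F₀` has no pole and `A, F₁, …, F_p` have neither a zero nor a pole. -/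
def regular (r : HyperexpData n) : Set (Fin n → ℂ) :=
  {x | r.F0.DefinedAt x ∧ r.A.UnitAt x ∧ ∀ j, (r.F j).UnitAt x}

/-- `g` is an analytic branch on the connected open set `V` of the multivalued function
`e^{F₀} A^{1/q} ∏ F_j^{λ_j}`: here `a` is a branch of `A^{1/q}` and `l j` a branch of `log F_j`. -/
def IsBranch (r : HyperexpData n) (V : Set (Fin n → ℂ)) (g : (Fin n → ℂ) → ℂ) : Prop :=
  IsOpen V ∧ IsConnected V ∧ V ⊆ r.regular ∧
    ∃ (a : (Fin n → ℂ) → ℂ) (l : Fin r.p → (Fin n → ℂ) → ℂ),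
      AnalyticOnNhd ℂ a V ∧ (∀ x ∈ V, a x ^ r.q = r.A.eval x) ∧
      (∀ j, AnalyticOnNhd ℂ (l j) V) ∧ (∀ j, ∀ x ∈ V, Complex.exp (l j x) = (r.F j).eval x) ∧
      ∀ x ∈ V, g x = Complex.exp (r.F0.eval x) * a x * ∏ j, Complex.exp (r.lam j * l j x)

/-- On `U`, the function `H` is `e^{F₀} A^{1/q} ∏ F_j^{λ_j}` up to a nonzero constant factor:
branches exist near every regular point of `U`, and every branch on a connected open part of `U`
is a constant multiple of `H`. -/
def Expresses (r : HyperexpData n) (U : Set (Fin n → ℂ)) (H : (Fin n → ℂ) → ℂ) : Prop :=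
  (∀ x ∈ U ∩ r.regular, ∃ V g, x ∈ V ∧ V ⊆ U ∧ r.IsBranch V g) ∧
    ∀ V g, V ⊆ U → r.IsBranch V g → ∃ c : ℂ, c ≠ 0 ∧ ∀ x ∈ V, H x = c * g x

/-- The field `L = K(λ₁, …, λ_p)`. -/
def constField (K : Subfield ℂ) (r : HyperexpData n) : IntermediateField K ℂ :=
  IntermediateField.adjoin K (Set.range r.lam)

/-- `e^{F₀} A^{1/q} ∏ F_j^{λ_j}` is a representation, of the required shape over `K`, of a solution
of `dH/H = ω`. -/
structure IsRepresentation (K : Subfield ℂ) (ω : RatForm n) (r : HyperexpData n) : Prop where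
  F0_mem : r.F0 ∈ RatFun.ratField K Set.univ
  A_mem : r.A ∈ RatFun.ratField K Set.univ
  A_ne_zero : r.A ≠ 0
  q_pos : 0 < r.q
  finite : FiniteDimensional K (r.constField K)
  F_mem : ∀ j, r.F j ∈ RatFun.ratField (r.constField K).toSubfield Set.univ
  F_ne_zero : ∀ j, r.F j ≠ 0
  traceless : ∀ j, IsTraceless (r.lam j)
  independent : LinearIndependent ℚ r.lam
  form_eq : ω = RatForm.d r.F0 + (RatFun.const n (1 / (r.q : ℂ))) • RatForm.dlog r.A +
    ∑ j, RatFun.const n (r.lam j) • RatForm.dlog (r.F j)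
  solution : ∀ V g, r.IsBranch V g → HasLogDifferential V g ω

end HyperexpData

/-! ### The algorithm `RationalIntegration` -/

namespace RationalIntegration

open Polynomial

variable {n : ℕ}

/-- The field `K(x_j : j < i)`, over which the `i`-th variable is treated as the main one. -/
abbrev BaseField (K : Subfield ℂ) (i : Fin n) : Subfield (RatFun n) :=
  RatFun.ratField K {j | j < i}

/-- A univariate polynomial over `K(x_j : j < i)`, read as a function of the main variable. -/
def atVar (K : Subfield ℂ) (i : Fin n) (P : (BaseField K i)[X]) : RatFun n :=
  P.eval₂ (BaseField K i).subtype (RatFun.var i)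

/-- The working variables: the remaining form `ω`, the rational part `F₀`, the factors of
`A = ∏ Q^r` (pairs `(Q, r)` with rational exponents `r`), and the list `Res`. -/
structure State (n : ℕ) where
  ω : RatForm n
  F0 : RatFun n
  A : List (RatFun n × ℚ)
  Res : List (ℂ × RatFun n)

/-- `f = P/Q + ∂_i R` is a Hermite reduction of `f` with respect to `x_i`. -/
def IsHermiteReduction (K : Subfield ℂ) (i : Fin n) (f : RatFun n)
    (P Q : (BaseField K i)[X]) (R : RatFun n) : Prop :=
  Q.Monic ∧ Squarefree Q ∧ P.degree < Q.degree ∧ R ∈ RatFun.ratField K {j | j ≤ i} ∧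
    f = atVar K i P / atVar K i Q + RatFun.pd i R

/-- `Qs` is the list of the monic irreducible factors of the monic polynomial `Q`. -/
def IsFactorization (K : Subfield ℂ) (i : Fin n) (Q : (BaseField K i)[X])
    (Qs : List (BaseField K i)[X]) : Prop :=
  (∀ q ∈ Qs, q.Monic ∧ Irreducible q) ∧ Qs.prod = Q

/-- The resultant with respect to `x_i` of `Q_j` and `P - λ ∂_i Q`, a polynomial in `λ`. -/
def residueResultant (K : Subfield ℂ) (i : Fin n) (P Q Qj : (BaseField K i)[X]) :
    (BaseField K i)[X] :=
  Polynomial.resultant (Qj.map (C : BaseField K i →+* (BaseField K i)[X]))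
    (P.map (C : BaseField K i →+* (BaseField K i)[X]) -
      C (X : (BaseField K i)[X]) * (derivative Q).map C)

/-- `S` is the product of the factors of `ρ` that depend on `λ` only: the largest monic divisor of
`ρ` with coefficients in `K`. -/
def IsConstantPart (K : Subfield ℂ) (i : Fin n) (ρ : (BaseField K i)[X]) (S : K[X]) : Prop :=
  S.Monic ∧ S.map (RatFun.constHom K {j | j < i}) ∣ ρ ∧
    ∀ T : K[X], T.map (RatFun.constHom K {j | j < i}) ∣ ρ → T ∣ S

/-- The product of the conjugates of `S`, over the embeddings of `K`. -/
def conjProd (K : Subfield ℂ) [NumberField K] (S : K[X]) : ℂ[X] :=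
  ∏ σ : K →+* ℂ, S.map σ

/-- `r = s / deg S̃`, where `S̃` is the product of the conjugates of `S` and `-s` is the quotient of
its second leading coefficient by its leading coefficient. -/
def IsShift (K : Subfield ℂ) [NumberField K] (S : K[X]) (r : ℚ) : Prop :=
  (r : ℂ) = -((conjProd K S).nextCoeff / (conjProd K S).leadingCoeff) / (conjProd K S).natDegree

/-- `G` is the value at `x_i` of the monic gcd of `Q_j` and `P - λ ∂_i Q`. -/
def IsResidueGcd (K : Subfield ℂ) (i : Fin n) (P Q Qj : (BaseField K i)[X]) (μ : ℂ)
    (G : RatFun n) : Prop :=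
  ∃ g : (RatFun n)[X], g.Monic ∧
    (∀ h : (RatFun n)[X], h ∣ g ↔
      h ∣ Qj.map (BaseField K i).subtype ∧
      h ∣ P.map (BaseField K i).subtype -
        C (RatFun.const n μ) * (derivative Q).map (BaseField K i).subtype) ∧
    G = g.eval (RatFun.var i)

/-- `Λ` lists, for each root `μ` of `S` once, the pair of `μ` and of the corresponding gcd. -/
def IsResidueList (K : Subfield ℂ) (i : Fin n) (P Q Qj : (BaseField K i)[X]) (S : K[X])
    (Λ : List (ℂ × RatFun n)) : Prop :=
  (Λ.map Prod.fst).Nodup ∧ (∀ μ : ℂ, μ ∈ Λ.map Prod.fst ↔ (S.map K.subtype).IsRoot μ) ∧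
    ∀ z ∈ Λ, IsResidueGcd K i P Q Qj z.1 z.2

/-- A configuration of the algorithm. -/
inductive Config (K : Subfield ℂ) (n : ℕ) : Type
  /-- Start of a round of the loop on the variables; `k` variables remain. -/
  | outer (k : ℕ) (s : State n) : Config K n
  /-- Inside the loop on the factors of `Q` for the variable `x_i`; `todo` lists those left. -/
  | inner (i : Fin n) (P Q : (BaseField K i)[X]) (todo : List (BaseField K i)[X])
      (s : State n) : Config K n
  /-- The output has been returned. -/
  | done (r : HyperexpData n) : Config K n

/-- The final steps. `q` is the least positive integer for which `A^q` is rational (all its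
exponents are integers); `λ` is a basis of the `ℤ`-module generated by the first entries of `Res`,
and `M` is the integer passage matrix. -/
structure IsOutput (s : State n) (r : HyperexpData n) : Prop where
  F0_eq : r.F0 = s.F0
  q_least : IsLeast {q : ℕ | 0 < q ∧ ∀ a ∈ s.A, ∃ m : ℤ, (m : ℚ) = q * a.2} r.q
  A_eq : r.A = (s.A.map fun a => a.1 ^ (((r.q : ℚ) * a.2).num)).prod
  basis_indep : LinearIndependent ℤ r.lam
  basis_span : Submodule.span ℤ (Set.range r.lam) =
    Submodule.span ℤ {z : ℂ | z ∈ s.Res.map Prod.fst}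
  factors : ∃ M : Fin s.Res.length → Fin r.p → ℤ,
    (∀ k, (s.Res.get k).1 = ∑ j, (M k j : ℂ) * r.lam j) ∧
    ∀ j, r.F j = ∏ k, (s.Res.get k).2 ^ (M k j)

/-- One step of the algorithm. -/
inductive Step (K : Subfield ℂ) [NumberField K] : Config K n → Config K n → Prop
  /-- Hermite reduction of the coefficient of `dx_i`, and factorization of the denominator. -/
  | hermite (i : Fin n) (s : State n) (P Q : (BaseField K i)[X]) (R : RatFun n)
      (Qs : List (BaseField K i)[X]) :
      IsHermiteReduction K i (s.ω i) P Q R → IsFactorization K i Q Qs →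
      Step K (.outer (i + 1) s)
        (.inner i P Q Qs { s with ω := s.ω - RatForm.d R, F0 := s.F0 + R })
  /-- Treatment of one irreducible factor `Q_j`. -/
  | factor (i : Fin n) (s : State n) (P Q Qj : (BaseField K i)[X])
      (todo : List (BaseField K i)[X]) (S : K[X]) (r : ℚ) (Λ : List (ℂ × RatFun n)) :
      IsConstantPart K i (residueResultant K i P Q Qj) S → IsShift K S r →
      IsResidueList K i P Q Qj S Λ →
      Step K (.inner i P Q (Qj :: todo) s)
        (.inner i P Q todo
          { s with
            ω := s.ω - (Λ.map fun z => RatFun.const n z.1 • RatForm.dlog z.2).sum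
            A := s.A ++ [(atVar K i Qj, r)]
            Res := s.Res ++ Λ.map fun z => (z.1 - (r : ℂ), z.2) })
  /-- All factors have been treated: pass to the preceding variable. -/
  | next (i : Fin n) (s : State n) (P Q : (BaseField K i)[X]) :
      Step K (.inner i P Q [] s) (.outer i s)
  /-- All variables have been treated: return the result. -/
  | finish (s : State n) (r : HyperexpData n) :
      IsOutput s r → Step K (.outer 0 s) (.done r)

/-- The initial configuration on the input `ω`: `F₀ = 0`, `A = 1`, `Res = []`. -/
def start (K : Subfield ℂ) (ω : RatForm n) : Config K n :=
  .outer n { ω := ω, F0 := 0, A := [], Res := [] }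

/-- `c` is reached in some run of the algorithm on the input `ω`. -/
def Reaches (K : Subfield ℂ) [NumberField K] (ω : RatForm n) (c : Config K n) : Prop :=
  Relation.ReflTransGen (Step K) (start K ω) c

end RationalIntegration

/-! ### Effectivity -/

/-- A computable presentation of the field of algebraic numbers: each algebraic number is named by
natural numbers, and equality, addition and multiplication are computable on names. -/
structure AlgebraicNumberCoding where
  val : ℕ → ℂ
  range_val : Set.range val = {z : ℂ | IsAlgebraic ℚ z}
  eq_computable : ComputablePred fun p : ℕ × ℕ => val p.1 = val p.2
  add_computable : ∃ f : ℕ → ℕ → ℕ, Computable₂ f ∧ ∀ a b, val (f a b) = val a + val b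
  mul_computable : ∃ f : ℕ → ℕ → ℕ, Computable₂ f ∧ ∀ a b, val (f a b) = val a * val b

/-- A polynomial as a list of terms (list of exponents, name of the coefficient). -/
abbrev PolyCode : Type := List (List ℕ × ℕ)

/-- A rational function as numerator and denominator. -/
abbrev RatCode : Type := PolyCode × PolyCode

/-- A rational 1-form as the list of its coefficients. -/
abbrev FormCode : Type := List RatCode

/-- The code `(F₀, A, q, [(λ₁, F₁), …, (λ_p, F_p)])` of an expression. -/
abbrev HyperexpCode : Type := RatCode × RatCode × ℕ × List (ℕ × RatCode)

namespace AlgebraicNumberCoding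

variable (ν : AlgebraicNumberCoding) (n : ℕ)

/-- The polynomial with code `c`. -/
def poly (c : PolyCode) : MvPolynomial (Fin n) ℂ :=
  (c.map fun t =>
    MvPolynomial.C (ν.val t.2) * ∏ i : Fin n, MvPolynomial.X i ^ (t.1.getD i 0)).sum

/-- The rational function with code `c`. -/
def ratFun (c : RatCode) : RatFun n :=
  algebraMap (MvPolynomial (Fin n) ℂ) (RatFun n) (ν.poly n c.1) /
    algebraMap (MvPolynomial (Fin n) ℂ) (RatFun n) (ν.poly n c.2)

/-- The 1-form with code `c`. -/
def form (c : FormCode) : RatForm n :=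
  fun i => ν.ratFun n (c.getD i ([], []))

/-- The expression with code `c`. -/
def hyperexp (c : HyperexpCode) : HyperexpData n where
  F0 := ν.ratFun n c.1
  A := ν.ratFun n c.2.1
  q := c.2.2.1
  p := c.2.2.2.length
  lam := fun j => ν.val (c.2.2.2.get j).1
  F := fun j => ν.ratFun n (c.2.2.2.get j).2

end AlgebraicNumberCoding

end

/-! The variables are removed from the last to the first. Suppose that a closed form over `K`
involves only `x_1, …, x_i` and that Hermite reduction has brought its `dx_i`-coefficient to `P / Q`
with `Q` squarefree. Closedness makes `∂_j (P / Q)`, for `j < i`, a derivative with respect to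
`x_i`, and such a derivative has no residues. So the residues at the roots of an irreducible factor
`q` of `Q` are killed by every `∂_j` (`deriv_residue_eq_zero`), and they are the roots of one
irreducible `m` with coefficients in `K` (`exists_isResiduePolynomial`). Hence the resultant is a
constant in `λ` times a power of `m` (`resultant_eq_C_mul_pow`), the gcds `G_λ` multiply to `q`
(`prod_gcd_eq`), and `P / Q = ∑ λ ∂_i G_λ / G_λ` (`partial_fractions`). Subtracting `∑ λ dG_λ / G_λ`
kills the `dx_i`-coefficient; by closedness the other coefficients then do not involve `x_i`, and
they stay over `K` because each `∂_j G_λ / G_λ` vanishes at `x_i = ∞` (`sub_residueFactors_mem`).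
This is the invariant of the loop; a lexicographic measure gives termination.

The roots of `m` are conjugate over `K`, so they share the mean `r` of their conjugates over `ℚ`,
which is the shift of the algorithm (`isShift_pow_iff`). Since `∏ G_λ = q`, splitting `λ = (λ - r) +
r` moves exactly `r dq / q` into `A`. Traceless numbers are the kernel of the normalized trace, a
`ℚ`-linear map, so a `ℤ`-basis of the module generated by the `λ - r` is again traceless.

Analytically, the symmetry of second derivatives shows that `dH / H` is closed
(`HasLogDifferential.closed`), and two functions with the same logarithmic differential have a
locally constant quotient (`HyperexpData.expresses`).

For effectivity the algorithm is not programmed. Representations exist by the first two parts, so an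
unbounded search is enough once a correct answer can be recognized. Identities between rational
functions are checked by a zero test on formal sums of products of names; writing coefficients as
words in prescribed names makes membership in a field visible. To certify tracelessness and linear
independence, a representation is rewritten on traceless affine functions of the powers of a single
algebraic integer `θ` (`IsRepresentation.exists_powers`): independence follows from the degree of
`θ`, and minimal polynomials are recognized through a coefficient bound (`minpoly_eq_intPoly`). -/

noncomputable section

/-! ### Partial derivatives of rational functions. -/

namespace RatFun

variable {n : ℕ}

theorem den_ne_zero (f : RatFun n) : f.den ≠ 0 :=
  nonZeroDivisors.ne_zero (IsFractionRing.den (MvPolynomial (Fin n) ℂ) f).2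

theorem algebraMap_ne_zero {a : MvPolynomial (Fin n) ℂ} (h : a ≠ 0) :
    algebraMap (MvPolynomial (Fin n) ℂ) (RatFun n) a ≠ 0 :=
  (map_ne_zero_iff _ (IsFractionRing.injective _ _)).2 h

theorem num_div_den (f : RatFun n) :
    algebraMap (MvPolynomial (Fin n) ℂ) (RatFun n) f.num /
      algebraMap (MvPolynomial (Fin n) ℂ) (RatFun n) f.den = f := by
  simp [num, den]

theorem num_mul_eq (a b : MvPolynomial (Fin n) ℂ) (hb : b ≠ 0) (f : RatFun n)
    (hf : f = algebraMap _ (RatFun n) a / algebraMap _ (RatFun n) b) :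
    f.num * b = a * f.den := by
  have h := num_div_den f
  rw [hf, div_eq_div_iff (algebraMap_ne_zero (den_ne_zero _)) (algebraMap_ne_zero hb)] at h
  rw [← hf] at h
  exact IsFractionRing.injective (MvPolynomial (Fin n) ℂ) (RatFun n) (by simpa using h)

theorem exists_div (f : RatFun n) : ∃ a b : MvPolynomial (Fin n) ℂ, b ≠ 0 ∧
    f = algebraMap _ (RatFun n) a / algebraMap _ (RatFun n) b :=
  ⟨f.num, f.den, den_ne_zero f, (num_div_den f).symm⟩

/-- Well-definedness of the quotient rule: `h` says `N / d = a / b` and `h'` is its derivative. Thus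
the formula that `pd` applies to the reduced fraction is valid for every fraction. -/
theorem quotient_rule_aux {R : Type*} [CommRing R] {N d a b N' d' a' b' : R} (h : N * b = a * d)
    (h' : N * b' + b * N' = a * d' + d * a') :
    (N' * d - N * d') * b ^ 2 = (a' * b - a * b') * d ^ 2 := by
  linear_combination (d * b) * h' - (d' * b + d * b') * h

theorem pd_div (i : Fin n) (a b : MvPolynomial (Fin n) ℂ) (hb : b ≠ 0) :
    pd i (algebraMap _ (RatFun n) a / algebraMap _ (RatFun n) b) =
      algebraMap _ (RatFun n) (MvPolynomial.pderiv i a * b - a * MvPolynomial.pderiv i b) /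
        algebraMap _ (RatFun n) (b ^ 2) := by
  have h := num_mul_eq a b hb _ rfl
  have h' := congrArg (MvPolynomial.pderiv i) h
  rw [Derivation.leibniz, Derivation.leibniz] at h'
  rw [pd, div_eq_div_iff (algebraMap_ne_zero (pow_ne_zero _ (den_ne_zero _)))
    (algebraMap_ne_zero (pow_ne_zero _ hb)), ← map_mul, ← map_mul]
  exact congrArg _ (quotient_rule_aux h h')

theorem const_eq_algebraMap (c : ℂ) : const n c = algebraMap ℂ (RatFun n) c := by
  simp [const, IsScalarTower.algebraMap_apply ℂ (MvPolynomial (Fin n) ℂ) (RatFun n)]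

theorem pd_algebraMap (i : Fin n) (a : MvPolynomial (Fin n) ℂ) :
    pd i (algebraMap _ (RatFun n) a) = algebraMap _ (RatFun n) (MvPolynomial.pderiv i a) := by
  have := pd_div i a 1 one_ne_zero
  simpa using this

@[simp] theorem pd_const (i : Fin n) (c : ℂ) : pd i (const n c) = 0 := by
  rw [const, RingHom.comp_apply, pd_algebraMap, MvPolynomial.pderiv_C, map_zero]

theorem pd_add (i : Fin n) (f g : RatFun n) : pd i (f + g) = pd i f + pd i g := by
  obtain ⟨a, b, hb, rfl⟩ := exists_div f
  obtain ⟨c, d, hd, rfl⟩ := exists_div g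
  have hb' := algebraMap_ne_zero (n := n) hb
  have hd' := algebraMap_ne_zero (n := n) hd
  rw [div_add_div _ _ hb' hd', ← map_mul, ← map_mul, ← map_mul, ← map_add,
    pd_div i _ _ (mul_ne_zero hb hd), pd_div i _ _ hb, pd_div i _ _ hd]
  simp only [Derivation.leibniz, smul_eq_mul, map_add, map_sub, map_mul, map_pow]
  field_simp
  ring

theorem pd_mul (i : Fin n) (f g : RatFun n) : pd i (f * g) = f * pd i g + g * pd i f := by
  obtain ⟨a, b, hb, rfl⟩ := exists_div f
  obtain ⟨c, d, hd, rfl⟩ := exists_div g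
  have hb' := algebraMap_ne_zero (n := n) hb
  have hd' := algebraMap_ne_zero (n := n) hd
  rw [div_mul_div_comm, ← map_mul, ← map_mul,
    pd_div i _ _ (mul_ne_zero hb hd), pd_div i _ _ hb, pd_div i _ _ hd]
  simp only [Derivation.leibniz, smul_eq_mul, map_add, map_sub, map_mul, map_pow]
  field_simp
  ring

theorem pd_const_mul (i : Fin n) (c : ℂ) (f : RatFun n) :
    pd i (const n c * f) = const n c * pd i f := by
  rw [pd_mul, pd_const, mul_zero, add_zero]

/-- The partial derivative with respect to `x_i` as a derivation. -/
def pdD (i : Fin n) : Derivation ℂ (RatFun n) (RatFun n) :=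
  Derivation.mk'
    { toFun := pd i
      map_add' := pd_add i
      map_smul' := fun r f => by
        rw [RingHom.id_apply, Algebra.smul_def, Algebra.smul_def, ← const_eq_algebraMap,
          pd_const_mul] }
    (pd_mul i)

theorem pdD_apply (i : Fin n) (f : RatFun n) : pdD i f = pd i f := rfl

theorem pd_var (i j : Fin n) : pd i (var j) = if i = j then 1 else 0 := by
  rw [var, pd_algebraMap, MvPolynomial.pderiv_X]
  by_cases h : i = j
  · subst h; simp
  · simp [h, Ne.symm h]

@[simp] theorem pd_var_self (i : Fin n) : pd i (var i) = 1 := by simp [pd_var]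

@[simp] theorem pd_zero (i : Fin n) : pd i (0 : RatFun n) = 0 := map_zero (pdD i)
@[simp] theorem pd_one (i : Fin n) : pd i (1 : RatFun n) = 0 := (pdD i).map_one_eq_zero
theorem pd_sub (i : Fin n) (f g : RatFun n) : pd i (f - g) = pd i f - pd i g := map_sub (pdD i) f g
theorem pd_neg (i : Fin n) (f : RatFun n) : pd i (-f) = -pd i f := map_neg (pdD i) f
theorem pd_div' (i : Fin n) (f g : RatFun n) (hg : g ≠ 0) :
    pd i (f / g) = (g * pd i f - f * pd i g) / g ^ 2 := by
  rw [← pdD_apply, (pdD i).leibniz_div, smul_eq_mul, smul_eq_mul, smul_eq_mul, pdD_apply, pdD_apply]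
  field_simp

theorem pd_inv (i : Fin n) (g : RatFun n) : pd i g⁻¹ = -(g⁻¹) ^ 2 * pd i g := by
  rw [← pdD_apply, (pdD i).leibniz_inv, smul_eq_mul, pdD_apply]

/-- The commutator of two derivations is a derivation; it vanishes on polynomials, hence on their
quotients. -/
theorem pd_comm (i j : Fin n) (f : RatFun n) : pd i (pd j f) = pd j (pd i f) := by
  have hc : ⁅MvPolynomial.pderiv (R := ℂ) i, MvPolynomial.pderiv j⁆ = 0 :=
    MvPolynomial.derivation_ext fun k => by
      rw [Derivation.commutator_apply, MvPolynomial.pderiv_X, MvPolynomial.pderiv_X]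
      simp only [Pi.single_apply]
      split_ifs <;> simp
  have hz (a : MvPolynomial (Fin n) ℂ) : ⁅pdD i, pdD j⁆ (algebraMap _ (RatFun n) a) = 0 := by
    have := Derivation.congr_fun hc a
    rw [Derivation.commutator_apply, Derivation.zero_apply] at this
    rw [Derivation.commutator_apply, pdD_apply, pdD_apply, pdD_apply, pdD_apply, pd_algebraMap,
      pd_algebraMap, pd_algebraMap, pd_algebraMap, ← map_sub, this, map_zero]
  obtain ⟨a, b, hb, rfl⟩ := exists_div f
  have := Derivation.leibniz_div ⁅pdD i, pdD j⁆ (algebraMap _ (RatFun n) a) (algebraMap _ _ b)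
  rw [hz, hz, smul_zero, smul_zero, sub_zero, smul_zero, Derivation.commutator_apply,
    sub_eq_zero] at this
  exact this

theorem const_mem {k : Subfield ℂ} {s : Set (Fin n)} {c : ℂ} (hc : c ∈ k) :
    const n c ∈ ratField k s :=
  Subfield.subset_closure (Or.inl ⟨c, hc, rfl⟩)

theorem var_mem {k : Subfield ℂ} {s : Set (Fin n)} {i : Fin n} (hi : i ∈ s) :
    var i ∈ ratField k s :=
  Subfield.subset_closure (Or.inr ⟨i, hi, rfl⟩)

theorem ratField_mono {k l : Subfield ℂ} {s t : Set (Fin n)} (hk : k ≤ l) (hs : s ⊆ t) :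
    ratField k s ≤ ratField l t :=
  Subfield.closure_mono (Set.union_subset_union (Set.image_mono hk) (Set.image_mono hs))

theorem pd_mem {k : Subfield ℂ} {s : Set (Fin n)} (i : Fin n) {f : RatFun n}
    (hf : f ∈ ratField k s) : pd i f ∈ ratField k s := by
  induction hf using Subfield.closure_induction with
  | mem x hx =>
    rcases hx with ⟨c, _, rfl⟩ | ⟨j, _, rfl⟩
    · rw [pd_const]; exact zero_mem _
    · rw [pd_var]; split_ifs
      · exact one_mem _
      · exact zero_mem _
  | one => rw [pd_one]; exact zero_mem _
  | add x y hx hy h1 h2 => rw [pd_add]; exact add_mem h1 h2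
  | neg x hx h => rw [pd_neg]; exact neg_mem h
  | inv x hx h => rw [pd_inv]; exact mul_mem (neg_mem (pow_mem (inv_mem hx) 2)) h
  | mul x y hx hy h1 h2 =>
    rw [pd_mul]; exact add_mem (mul_mem hx h2) (mul_mem hy h1)

theorem pd_eq_zero_of_notMem {k : Subfield ℂ} {s : Set (Fin n)} {i : Fin n} (hi : i ∉ s)
    {f : RatFun n} (hf : f ∈ ratField k s) : pd i f = 0 := by
  induction hf using Subfield.closure_induction with
  | mem x hx =>
    rcases hx with ⟨c, _, rfl⟩ | ⟨j, hj, rfl⟩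
    · rw [pd_const]
    · rw [pd_var, if_neg]; rintro rfl; exact hi hj
  | one => rw [pd_one]
  | add x y hx hy h1 h2 => rw [pd_add, h1, h2, add_zero]
  | neg x hx h => rw [pd_neg, h, neg_zero]
  | inv x hx h => rw [pd_inv, h, mul_zero]
  | mul x y hx hy h1 h2 => rw [pd_mul, h1, h2, mul_zero, mul_zero, add_zero]

end RatFun

/-! ### Polynomials in `x_i` over `k(x_j : j ∈ s)`. -/

namespace RatFun

open Polynomial

variable {n : ℕ}

/-- Evaluation of univariate polynomials over `k(x_j : j ∈ s)` at `x_i`. -/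
def evalVar (k : Subfield ℂ) (s : Set (Fin n)) (i : Fin n) : (ratField k s)[X] →+* RatFun n :=
  eval₂RingHom (ratField k s).subtype (var i)

/-- The differential field structure of `k(x_j : j ∈ s)` given by `∂/∂x_j`. -/
@[reducible] def baseDifferential (k : Subfield ℂ) (s : Set (Fin n)) (j : Fin n) :
    Differential (ratField k s) :=
  ⟨Derivation.mk'
    { toFun := fun f => ⟨pd j f, pd_mem j f.2⟩
      map_add' := fun f g => Subtype.ext (pd_add j f g)
      map_smul' := fun c f => Subtype.ext (by
        exact map_zsmul (pdD j) c (f : RatFun n)) }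
    (fun f g => Subtype.ext (pd_mul j f g))⟩

variable {k : Subfield ℂ} {s : Set (Fin n)} {i j : Fin n}

@[simp] theorem evalVar_C (a : ratField k s) : evalVar k s i (C a) = a := by
  simp [evalVar]

@[simp] theorem evalVar_X : evalVar k s i X = var i := by
  simp [evalVar]

theorem pd_evalVar (p : (ratField k s)[X]) (hij : j ≠ i) :
    pd j (evalVar k s i p) =
      evalVar k s i (letI := baseDifferential k s j; Differential.mapCoeffs p) := by
  let := baseDifferential k s j
  induction p using Polynomial.induction_on' with
  | add p q hp hq => rw [map_add, pd_add, hp, hq, map_add, map_add]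
  | monomial m a =>
    rw [Differential.mapCoeffs_monomial, ← C_mul_X_pow_eq_monomial, ← C_mul_X_pow_eq_monomial,
      map_mul, map_mul, map_pow, evalVar_C, evalVar_C, evalVar_X, pd_mul]
    have : pd j (var i ^ m) = 0 := by
      rw [← pdD_apply, Derivation.leibniz_pow, pdD_apply, pd_var, if_neg hij]; simp
    rw [this, mul_zero, zero_add, mul_comm]
    rfl

theorem pd_evalVar_self (hi : i ∉ s) (p : (ratField k s)[X]) :
    pd i (evalVar k s i p) = evalVar k s i (derivative p) := by
  induction p using Polynomial.induction_on' with
  | add p q hp hq => rw [map_add, pd_add, hp, hq, map_add, map_add]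
  | monomial m a =>
    rw [derivative_monomial, ← C_mul_X_pow_eq_monomial, ← C_mul_X_pow_eq_monomial,
      map_mul, map_mul, map_pow, map_pow, evalVar_C, evalVar_C, evalVar_X, pd_mul,
      pd_eq_zero_of_notMem hi a.2, ← pdD_apply, Derivation.leibniz_pow, pdD_apply, pd_var_self]
    simp [mul_assoc]

/-- Transcendence of `x_i` by differentiation: a relation `p(x_i) = 0` gives `p'(x_i) = 0`, of
smaller degree, until `p` is constant. -/
theorem evalVar_injective (hi : i ∉ s) : Function.Injective (evalVar k s i) := by
  rw [injective_iff_map_eq_zero]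
  intro p
  induction hd : p.natDegree using Nat.strong_induction_on generalizing p with
  | _ d ih =>
    intro hp
    have h' : evalVar k s i (derivative p) = 0 := by rw [← pd_evalVar_self hi, hp, pd_zero]
    rcases Nat.eq_zero_or_pos p.natDegree with h0 | h0
    · rw [eq_C_of_natDegree_eq_zero h0] at hp ⊢
      rw [evalVar_C] at hp
      rw [C_eq_zero]
      exact Subtype.ext hp
    · have := ih _ (hd ▸ natDegree_derivative_lt h0.ne') _ rfl h'
      exact absurd (derivative_eq_zero.1 this) h0.ne'

theorem evalVar_ne_zero (hi : i ∉ s) {p : (ratField k s)[X]} (hp : p ≠ 0) :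
    evalVar k s i p ≠ 0 :=
  (map_ne_zero_iff _ (evalVar_injective hi)).2 hp

theorem evalVar_mem (p : (ratField k s)[X]) : evalVar k s i p ∈ ratField k (insert i s) := by
  induction p using Polynomial.induction_on' with
  | add p q hp hq => rw [map_add]; exact add_mem hp hq
  | monomial m a =>
    rw [← C_mul_X_pow_eq_monomial, map_mul, map_pow, evalVar_C, evalVar_X]
    exact mul_mem (ratField_mono le_rfl (Set.subset_insert i s) a.2)
      (pow_mem (var_mem (Set.mem_insert _ _)) _)

theorem exists_evalVar_div (hi : i ∉ s) {f : RatFun n} (hf : f ∈ ratField k (insert i s)) :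
    ∃ a b : (ratField k s)[X], b ≠ 0 ∧ f = evalVar k s i a / evalVar k s i b := by
  induction hf using Subfield.closure_induction with
  | mem x hx =>
    rcases hx with ⟨c, hc, rfl⟩ | ⟨j, hj, rfl⟩
    · exact ⟨C ⟨_, const_mem hc⟩, 1, one_ne_zero, by simp⟩
    · rcases hj with rfl | hj
      · exact ⟨X, 1, one_ne_zero, by simp⟩
      · exact ⟨C ⟨_, var_mem hj⟩, 1, one_ne_zero, by simp⟩
  | one => exact ⟨1, 1, one_ne_zero, by simp⟩
  | add x y hx hy h1 h2 =>
    obtain ⟨a, b, hb, rfl⟩ := h1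
    obtain ⟨c, d, hd, rfl⟩ := h2
    refine ⟨a * d + b * c, b * d, mul_ne_zero hb hd, ?_⟩
    rw [div_add_div _ _ (evalVar_ne_zero hi hb) (evalVar_ne_zero hi hd)]
    simp
  | neg x hx h =>
    obtain ⟨a, b, hb, rfl⟩ := h
    exact ⟨-a, b, hb, by rw [map_neg, ← neg_div]⟩
  | inv x hx h =>
    obtain ⟨a, b, hb, rfl⟩ := h
    by_cases ha : a = 0
    · exact ⟨0, 1, one_ne_zero, by simp [ha]⟩
    · exact ⟨b, a, ha, by rw [inv_div]⟩
  | mul x y hx hy h1 h2 =>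
    obtain ⟨a, b, hb, rfl⟩ := h1
    obtain ⟨c, d, hd, rfl⟩ := h2
    exact ⟨a * c, b * d, mul_ne_zero hb hd, by rw [div_mul_div_comm, map_mul, map_mul]⟩

theorem exists_evalVar_div_monic (hi : i ∉ s) {f : RatFun n}
    (hf : f ∈ ratField k (insert i s)) : ∃ a b : (ratField k s)[X], b.Monic ∧ IsCoprime a b ∧
      f = evalVar k s i a / evalVar k s i b := by
  obtain ⟨a, b, hb, rfl⟩ := exists_evalVar_div hi hf
  obtain ⟨a', ha⟩ := EuclideanDomain.gcd_dvd_left a b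
  obtain ⟨b', hb'⟩ := EuclideanDomain.gcd_dvd_right a b
  have hgcd := EuclideanDomain.gcd_eq_gcd_ab a b
  set g := EuclideanDomain.gcd a b
  have hg : g ≠ 0 := fun h => hb (by rw [hb', h, zero_mul])
  have hb0 : b' ≠ 0 := fun h => hb (by rw [hb', h, mul_zero])
  have hcop : IsCoprime a' b' := by
    refine ⟨EuclideanDomain.gcdA a b, EuclideanDomain.gcdB a b, mul_left_cancel₀ hg ?_⟩
    linear_combination -hgcd - EuclideanDomain.gcdA a b * ha - EuclideanDomain.gcdB a b * hb'
  have hu : IsUnit (C b'.leadingCoeff⁻¹) :=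
    isUnit_C.2 (isUnit_iff_ne_zero.2 (inv_ne_zero (leadingCoeff_ne_zero.2 hb0)))
  refine ⟨C b'.leadingCoeff⁻¹ * a', C b'.leadingCoeff⁻¹ * b', ?_, ?_, ?_⟩
  · rw [mul_comm]; exact monic_mul_leadingCoeff_inv hb0
  · exact (isCoprime_mul_unit_left hu _ _).2 hcop
  · nth_rw 1 [ha, hb']
    rw [map_mul, map_mul, map_mul, map_mul, mul_div_mul_left _ _ (evalVar_ne_zero hi hg),
      mul_div_mul_left _ _ (evalVar_ne_zero hi hu.ne_zero)]

/-- A function of `x_i` and `x_j`, `j ∈ s`, with vanishing derivative with respect to `x_i`, does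
not depend on `x_i`. -/
theorem mem_of_pd_eq_zero (hi : i ∉ s) {f : RatFun n} (hf : f ∈ ratField k (insert i s))
    (h : pd i f = 0) : f ∈ ratField k s := by
  obtain ⟨a, b, hb, hab, rfl⟩ := exists_evalVar_div_monic hi hf
  rw [pd_div' _ _ _ (evalVar_ne_zero hi hb.ne_zero),
    div_eq_zero_iff, or_iff_left (pow_ne_zero _ (evalVar_ne_zero hi hb.ne_zero)),
    pd_evalVar_self hi, pd_evalVar_self hi, ← map_mul, ← map_mul, ← map_sub,
    map_eq_zero_iff _ (evalVar_injective hi), sub_eq_zero] at h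
  -- In lowest terms `b a' = a b'` forces `b ∣ b'`, which by degree is possible only for constant
  -- `b`.
  have hbd : b ∣ derivative b := hab.symm.dvd_of_dvd_mul_left ⟨_, h.symm⟩
  have hb' : derivative b = 0 := by
    by_contra hne
    have h1 : b.natDegree ≠ 0 := fun h0 => hne (by
      rw [eq_C_of_natDegree_eq_zero h0, derivative_C])
    exact (natDegree_le_of_dvd hbd hne).not_gt (natDegree_derivative_lt h1)
  have hb1 : b = 1 := hb.natDegree_eq_zero.1 (derivative_eq_zero.1 hb')
  subst hb1
  rw [one_mul, derivative_one, mul_zero] at h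
  rw [eq_C_of_natDegree_eq_zero (derivative_eq_zero.1 h)]
  simp

theorem mem_const_of_pd_eq_zero (s : Finset (Fin n)) {f : RatFun n}
    (hf : f ∈ ratField k (s : Set (Fin n))) (h : ∀ i ∈ s, pd i f = 0) :
    ∃ c ∈ k, f = const n c := by
  induction s using Finset.induction_on with
  | empty =>
    rw [ratField, Finset.coe_empty, Set.image_empty, Set.union_empty, ← Subfield.coe_map] at hf
    rw [Subfield.closure_eq] at hf
    obtain ⟨c, hc, rfl⟩ := hf
    exact ⟨c, hc, rfl⟩
  | insert i s hi ih =>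
    rw [Finset.coe_insert] at hf
    exact ih (mem_of_pd_eq_zero (by simpa using hi) hf (h i (Finset.mem_insert_self _ _)))
      fun j hj => h j (Finset.mem_insert_of_mem hj)

end RatFun

/-! ### Hermite reduction. -/

namespace RationalIntegration

open Polynomial

section Univariate

variable {F : Type*} [Field F] [CharZero F]

theorem not_dvd_derivative_of_irreducible {q : F[X]} (hq : Irreducible q) : ¬ q ∣ derivative q :=
  fun h => hq.coprime_iff_not_dvd.1 (by
    have := hq.separable
    exact this) h

/-- Hermite reduction of a fraction, evaluated in a field `E` with a derivation `D` extending
differentiation of polynomials. -/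
theorem exists_hermite {E : Type*} [Field E] (φ : F[X] →+* E) (hφ : Function.Injective φ)
    (D : Derivation ℤ E E) (hD : ∀ p, D (φ p) = φ (derivative p)) (s t : F[X]) (ht : t ≠ 0) :
    ∃ P Q a b : F[X], Q.Monic ∧ Squarefree Q ∧ P.degree < Q.degree ∧ b ≠ 0 ∧
      φ s / φ t = φ P / φ Q + D (φ a / φ b) := by
  have hφ0 {p : F[X]} (hp : p ≠ 0) : φ p ≠ 0 := (map_ne_zero_iff _ hφ).2 hp
  have hDdiv (a b : F[X]) (hb : b ≠ 0) :
      D (φ a / φ b) = (φ b * φ (derivative a) - φ a * φ (derivative b)) / φ b ^ 2 := by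
    have := hφ0 hb
    rw [D.leibniz_div, hD, hD, smul_eq_mul, smul_eq_mul, smul_eq_mul]
    field_simp
  induction hd : t.natDegree using Nat.strong_induction_on generalizing s t with
  | _ d ih =>
  wlog htm : t.Monic generalizing s t
  · have hc : t.leadingCoeff⁻¹ ≠ 0 := inv_ne_zero (leadingCoeff_ne_zero.2 ht)
    have h1 : t * C t.leadingCoeff⁻¹ ≠ 0 := mul_ne_zero ht (C_ne_zero.2 hc)
    have := this (s * C t.leadingCoeff⁻¹) (t * C t.leadingCoeff⁻¹) h1
      (by rw [natDegree_mul_C hc, hd]) (monic_mul_leadingCoeff_inv ht)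
    rwa [map_mul, map_mul, mul_div_mul_right _ _ (hφ0 (C_ne_zero.2 hc))] at this
  by_cases hsq : Squarefree t
  -- For a squarefree denominator only the polynomial part of `s / t` is left over, and in
  -- characteristic zero it is a derivative.
  · obtain ⟨w, hw⟩ : ∃ w : F[X], derivative w = s /ₘ t := by
      refine ⟨(s /ₘ t).sum fun m c => monomial (m + 1) (c / (m + 1)), ?_⟩
      rw [Polynomial.sum, derivative_sum]
      conv_rhs => rw [(s /ₘ t).as_sum_support]
      refine Finset.sum_congr rfl fun m _ => ?_
      rw [derivative_monomial, Nat.add_sub_cancel]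
      congr 1
      push_cast
      exact div_mul_cancel₀ _ (Nat.cast_add_one_ne_zero m)
    refine ⟨s %ₘ t, t, w, 1, htm, hsq, degree_modByMonic_lt _ htm, one_ne_zero, ?_⟩
    rw [map_one, div_one, hD, hw]
    nth_rw 1 [← modByMonic_add_div s t]
    rw [map_add, map_mul, add_div, mul_div_cancel_left₀ _ (hφ0 ht)]
  · obtain ⟨p, hp, hpt⟩ : ∃ p, Irreducible p ∧ p * p ∣ t := by
      by_contra hcon
      push Not at hcon
      exact hsq ((squarefree_iff_irreducible_sq_not_dvd_of_ne_zero ht).2 hcon)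
    have hfin := FiniteMultiplicity.of_prime_left hp.prime ht
    obtain ⟨c, hc, hpc⟩ := hfin.exists_eq_pow_mul_and_not_dvd
    have hm2 : 2 ≤ multiplicity p t := hfin.le_multiplicity_of_pow_dvd (by rwa [pow_two])
    obtain ⟨m, hm⟩ := Nat.exists_eq_add_of_le' hm2
    rw [hm] at hc
    have hc0 : c ≠ 0 := by rintro rfl; exact hpc (dvd_zero p)
    -- From `1 = x p + y p' c` one gets `s / (p^(m+2) c) = s x / (p^(m+1) c) + s y p' / p^(m+2)`.
    -- The last term differs from `(s y)' / ((m+1) p^(m+1))` by the derivative of `-s y / ((m+1)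
    -- p^(m+1))`, so the power of `p` drops by one.
    obtain ⟨x, y, hxy⟩ : IsCoprime p (derivative p * c) :=
      IsCoprime.mul_right hp.separable (hp.coprime_iff_not_dvd.2 hpc)
    have ht1 : p ^ (m + 1) * c ≠ 0 := mul_ne_zero (pow_ne_zero _ hp.ne_zero) hc0
    have hdeg : (p ^ (m + 1) * c).natDegree < d := by
      rw [← hd, hc, natDegree_mul (pow_ne_zero _ hp.ne_zero) hc0,
        natDegree_mul (pow_ne_zero _ hp.ne_zero) hc0, natDegree_pow, natDegree_pow]
      have := hp.natDegree_pos
      nlinarith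
    have hm0 : ((m : F) + 1) ≠ 0 := Nat.cast_add_one_ne_zero m
    obtain ⟨P, Q, a, b, hQm, hQs, hPQ, hb, h⟩ := ih _ hdeg
      (s * x + C ((m : F) + 1)⁻¹ * derivative (s * y) * c) _ ht1 rfl
    have hpp : p ^ (m + 1) ≠ 0 := pow_ne_zero _ hp.ne_zero
    refine ⟨P, Q, a * p ^ (m + 1) - C ((m : F) + 1)⁻¹ * (s * y) * b, b * p ^ (m + 1),
      hQm, hQs, hPQ, mul_ne_zero hb hpp, ?_⟩
    have hsplit : φ (a * p ^ (m + 1) - C ((m : F) + 1)⁻¹ * (s * y) * b) / φ (b * p ^ (m + 1)) =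
        φ a / φ b - φ (C ((m : F) + 1)⁻¹ * (s * y)) / φ (p ^ (m + 1)) := by
      have h1 := hφ0 hb
      have h2 := hφ0 hpp
      rw [map_sub, map_mul, map_mul, map_mul φ b]
      field_simp
    rw [hsplit, map_sub, add_sub, ← h, hDdiv _ _ hpp, eq_sub_iff_add_eq, hc]
    have h1 := hφ0 hp.ne_zero
    have h2 := hφ0 hc0
    have he : φ (C ((m : F) + 1)⁻¹) * (m + 1) = 1 := by
      have : φ (C ((m : F) + 1)⁻¹ * C ((m : F) + 1)) = 1 := by
        rw [← C_mul, inv_mul_cancel₀ hm0, C_1, map_one]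
      simpa using this
    have hxy' := congrArg φ hxy
    simp only [map_add, map_mul, map_one] at hxy'
    rw [derivative_C_mul, derivative_pow]
    generalize derivative (s * y) = v' at *
    simp only [map_mul, map_pow, map_add, map_one, map_natCast, Nat.add_sub_cancel,
      Nat.cast_add, Nat.cast_one]
    generalize φ (C ((m : F) + 1)⁻¹) = e at *
    field_simp
    linear_combination (-φ s * φ p ^ (2 * m + 2)) * hxy' -
      (φ s * φ y * φ c * φ (derivative p) * φ p ^ (2 * m + 2)) * he

end Univariate

end RationalIntegration

/-! ### Residues of closed forms are constant. -/

namespace RationalIntegration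

open Polynomial

section Residue

open scoped Differential
open Differential

variable {F : Type*} [Field F] [CharZero F]

/-- Here `h` reads `(s / t)' = N / (q c²)`, with at most a simple pole along `q`. But in
characteristic zero a pole of order `k + 1` of `s / t` becomes a pole of order `k + 2 ≥ 2` of its
derivative, so there is no pole at all. -/
theorem dvd_of_derivative_fraction_of_isCoprime {q c s t N : F[X]} (hq : Irreducible q)
    (hc : ¬ q ∣ c) (ht : t ≠ 0) (hst : IsCoprime s t)
    (h : (derivative s * t - s * derivative t) * (q * c ^ 2) = N * t ^ 2) : q ∣ N := by
  have hp := hq.prime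
  by_cases hqt : q ∣ t
  · exfalso
    have hqs : ¬ q ∣ s := fun hqs => hq.not_isUnit (hst.isUnit_of_dvd' hqs hqt)
    have hfin := FiniteMultiplicity.of_prime_left hp ht
    obtain ⟨u, hu, hqu⟩ := hfin.exists_eq_pow_mul_and_not_dvd
    have hk : 1 ≤ multiplicity q t := hfin.le_multiplicity_of_pow_dvd (by rwa [pow_one])
    obtain ⟨k, hk⟩ := Nat.exists_eq_add_of_le' hk
    rw [hk] at hu
    subst hu
    have hq0 : q ^ (k + 1) ≠ 0 := pow_ne_zero _ hq.ne_zero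
    have h2 : c ^ 2 * (q * (derivative s * u - s * derivative u) -
        C ((k : F) + 1) * s * derivative q * u) = N * q ^ (k + 1) * u ^ 2 := by
      apply mul_left_cancel₀ hq0
      rw [derivative_mul, derivative_pow, Nat.add_sub_cancel] at h
      push_cast at h
      linear_combination h
    have h3 : q ∣ c ^ 2 * (C ((k : F) + 1) * s * derivative q * u) := by
      refine (dvd_sub_right (a := q) (b := c ^ 2 * (q * (derivative s * u - s * derivative u)))
        ⟨c ^ 2 * (derivative s * u - s * derivative u), by ring⟩).1 ⟨N * q ^ k * u ^ 2, ?_⟩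
      rw [← mul_sub, h2]; ring
    have hk1 : ¬ q ∣ C ((k : F) + 1) := fun hd =>
      hq.not_isUnit (isUnit_of_dvd_unit hd
        (isUnit_C.2 (isUnit_iff_ne_zero.2 (Nat.cast_add_one_ne_zero k))))
    rcases hp.dvd_or_dvd h3 with h3 | h3
    · exact hc (hp.dvd_of_dvd_pow h3)
    rcases hp.dvd_or_dvd h3 with h3 | h3
    · rcases hp.dvd_or_dvd h3 with h3 | h3
      · rcases hp.dvd_or_dvd h3 with h3 | h3
        · exact hk1 h3
        · exact hqs h3
      · exact not_dvd_derivative_of_irreducible hq h3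
    · exact hqu h3
  · have : q ∣ N * t ^ 2 := ⟨(derivative s * t - s * derivative t) * c ^ 2, by rw [← h]; ring⟩
    exact (hp.dvd_or_dvd this).resolve_right fun h' => hqt (hp.dvd_of_dvd_pow h')

/-- The derivative of a rational function has no simple pole. -/
theorem dvd_of_derivative_fraction {q c s t N : F[X]} (hq : Irreducible q)
    (hc : ¬ q ∣ c) (ht : t ≠ 0)
    (h : (derivative s * t - s * derivative t) * (q * c ^ 2) = N * t ^ 2) : q ∣ N := by
  classical
  obtain ⟨s', hs'⟩ := EuclideanDomain.gcd_dvd_left s t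
  obtain ⟨t', ht'⟩ := EuclideanDomain.gcd_dvd_right s t
  have hgcd := EuclideanDomain.gcd_eq_gcd_ab s t
  generalize EuclideanDomain.gcd s t = g at *
  have hg : g ≠ 0 := fun h => ht (by rw [ht', h, zero_mul])
  have hcop : IsCoprime s' t' := by
    refine ⟨EuclideanDomain.gcdA s t, EuclideanDomain.gcdB s t, mul_left_cancel₀ hg ?_⟩
    linear_combination -hgcd - EuclideanDomain.gcdA s t * hs' - EuclideanDomain.gcdB s t * ht'
  refine dvd_of_derivative_fraction_of_isCoprime hq hc (t := t')
    (fun h => ht (by rw [ht', h, mul_zero])) hcop (mul_left_cancel₀ (pow_ne_zero 2 hg) ?_)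
  rw [hs', ht', derivative_mul, derivative_mul] at h
  linear_combination h

omit [CharZero F] in
theorem derivative_mapCoeffs [Differential F] (p : F[X]) :
    derivative (mapCoeffs p) = mapCoeffs (derivative p) := by
  ext m
  rw [coeff_derivative, coeff_mapCoeffs, coeff_mapCoeffs, coeff_derivative, Derivation.leibniz,
    ← Nat.cast_add_one, Derivation.map_natCast]
  simp [mul_comm]

/-- With `Q = q c`, the hypothesis `h` says that differentiating the coefficients of `P / Q`
produces a derivative `(s / t)'` in the variable. Taking the residue at a root of `q` commutes with
the derivation of the coefficients, and a derivative has no residue, so the residue `P / Q'` has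
derivative zero in `F[x] / (q)`. -/
theorem deriv_residue_eq_zero [Differential F] {P q c s t : F[X]} [hq : Fact (Irreducible q)]
    [hqm : Fact q.Monic] (hc : ¬ q ∣ c) (ht : t ≠ 0)
    (h : (mapCoeffs P * (q * c) - P * mapCoeffs (q * c)) * t ^ 2 =
      (derivative s * t - s * derivative t) * (q * c) ^ 2) :
    (AdjoinRoot.mk q P / AdjoinRoot.mk q (derivative (q * c)))′ = 0 := by
  obtain ⟨v, hv⟩ := AdjoinRoot.mk_surjective (g := q) (AdjoinRoot.root q)′
  have hD (f : F[X]) : AdjoinRoot.mk q (implicitDeriv v f) = (AdjoinRoot.mk q f)′ := by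
    have := deriv_aeval_eq_implicitDeriv (A := F) (AdjoinRoot.root q) v
      (by rw [AdjoinRoot.aeval_eq, hv]) f
    rw [AdjoinRoot.aeval_eq, AdjoinRoot.aeval_eq] at this
    exact this.symm
  have hDdef (f : F[X]) : implicitDeriv v f = mapCoeffs f + v * derivative f := by
    simp [implicitDeriv]
  obtain ⟨e, he⟩ : q ∣ implicitDeriv v q := by
    rw [← AdjoinRoot.mk_eq_zero, hD, AdjoinRoot.mk_self, map_zero]
  have hDc := hDdef c
  have hDP := hDdef P
  have hDq := hDdef q
  -- Since `D = mapCoeffs + v d/dx`, one has `D(P/Q) + v' P/Q = (s/t + v P/Q)'`. As `D q = q e`, the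
  -- left side is `N / (q c²)` with `N` the polynomial divided here, and a derivative has no simple
  -- pole.
  have hN : q ∣ implicitDeriv v P * c - P * (e * c + implicitDeriv v c) + derivative v * P * c := by
    have hQ : q * c ≠ 0 := mul_ne_zero hq.out.ne_zero fun h => hc (h ▸ dvd_zero q)
    refine dvd_of_derivative_fraction (s := s * (q * c) + v * P * t) (t := t * (q * c)) hq.out hc
      (mul_ne_zero ht hQ) ?_
    rw [Derivation.leibniz, smul_eq_mul, smul_eq_mul] at h
    simp only [derivative_add, derivative_mul]
    rw [hDP, hDc]
    rw [hDq] at he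
    linear_combination (-(q * c ^ 2)) * h - (P * t ^ 2 * q * c ^ 3) * he
  -- The commutator of `D` and `d/dx` is `-v' d/dx`; it makes the term in `v'` of `N` cancel in the
  -- derivative of the residue.
  have hDq' : AdjoinRoot.mk q (implicitDeriv v (derivative q)) =
      AdjoinRoot.mk q (derivative q) * (AdjoinRoot.mk q e - AdjoinRoot.mk q (derivative v)) := by
    have h1 : implicitDeriv v (derivative q) =
        derivative (implicitDeriv v q) - derivative v * derivative q := by
      rw [hDdef, hDdef, derivative_add, derivative_mapCoeffs, derivative_mul]
      ring
    rw [h1, he, derivative_mul, map_sub, map_add, map_mul, map_mul, map_mul, AdjoinRoot.mk_self]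
    ring
  have hQ' : AdjoinRoot.mk q (derivative (q * c)) =
      AdjoinRoot.mk q (derivative q) * AdjoinRoot.mk q c := by
    rw [derivative_mul, map_add, map_mul, map_mul, AdjoinRoot.mk_self, zero_mul, add_zero]
  rw [← AdjoinRoot.mk_eq_zero] at hN
  simp only [map_add, map_sub, map_mul] at hN
  rw [hQ', Derivation.leibniz_div, Derivation.leibniz, ← hD, ← hD, ← hD, hDq']
  simp only [smul_eq_mul]
  apply mul_eq_zero_of_right
  linear_combination (AdjoinRoot.mk q (derivative q)) * hN

omit [CharZero F] in
theorem degree_mapCoeffs_lt [Differential F] {p : F[X]} (hp : p.Monic) :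
    (mapCoeffs p).degree < p.degree := by
  rw [degree_eq_natDegree hp.ne_zero, degree_lt_iff_coeff_zero]
  intro m hm
  rw [coeff_mapCoeffs]
  rcases hm.eq_or_lt with rfl | hm
  · rw [hp.coeff_natDegree, Derivation.map_one_eq_zero]
  · rw [coeff_eq_zero_of_natDegree_lt hm, map_zero]

omit [CharZero F] in
-- Differentiating `minpoly(x) = 0` with `x′ = 0` leaves a relation whose coefficients are the
-- derivatives; the leading coefficient `1` is lost, so minimality forces all of them to vanish.
theorem mapCoeffs_minpoly_eq_zero [Differential F] {R : Type*} [Field R] [Differential R]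
    [Algebra F R] [DifferentialAlgebra F R] {x : R} (hx : IsIntegral F x) (h : x′ = 0) :
    mapCoeffs (minpoly F x) = 0 := by
  by_contra hne
  have h1 : aeval x (mapCoeffs (minpoly F x)) = 0 := by
    have := deriv_aeval_eq x (minpoly F x)
    rw [minpoly.aeval, map_zero, h, mul_zero, add_zero] at this
    exact this.symm
  have h2 := minpoly.degree_le_of_ne_zero F x hne h1
  exact absurd h2 (not_le.2 (degree_mapCoeffs_lt (minpoly.monic hx)))

end Residue

end RationalIntegration

/-! ### The resultant whose roots are the residues. -/

namespace RationalIntegration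

open Polynomial

section Resultant

variable {F : Type*} [Field F]

/-- Two irreducible polynomials with a common root are associated. -/
theorem associated_of_common_root {Λ : Type*} [Field Λ] [Algebra F Λ] {p m : F[X]}
    (hp : Irreducible p) (hm : Irreducible m) {x : Λ} (h1 : aeval x p = 0) (h2 : aeval x m = 0) :
    Associated p m := by
  have hx : IsIntegral F x := IsAlgebraic.isIntegral ⟨p, hp.ne_zero, h1⟩
  have e1 := (minpoly.irreducible hx).associated_of_dvd hp (minpoly.dvd F x h1)
  have e2 := (minpoly.irreducible hx).associated_of_dvd hm (minpoly.dvd F x h2)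
  exact e1.symm.trans e2

theorem exists_eq_C_mul_pow {ρ m : F[X]} (hρ : ρ ≠ 0) (hu : ¬ IsUnit ρ) (hm : m.Monic)
    (h : ∀ p, Irreducible p → p ∣ ρ → Associated p m) :
    ∃ u : F, u ≠ 0 ∧ ∃ k : ℕ, 1 ≤ k ∧ ρ = C u * m ^ k := by
  classical
  have h1 : ∀ p ∈ UniqueFactorizationMonoid.normalizedFactors ρ, p = m := fun p hp => by
    have ha := h p (UniqueFactorizationMonoid.irreducible_of_normalized_factor p hp)
      (UniqueFactorizationMonoid.dvd_of_mem_normalizedFactors hp)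
    have hpm : p.Monic := by
      have := UniqueFactorizationMonoid.normalize_normalized_factor p hp
      rw [← this]
      exact monic_normalize (UniqueFactorizationMonoid.irreducible_of_normalized_factor p hp).ne_zero
    exact eq_of_monic_of_associated hpm hm ha
  have h2 := Multiset.eq_replicate_card.2 h1
  have h3 := UniqueFactorizationMonoid.prod_normalizedFactors hρ
  rw [h2, Multiset.prod_replicate] at h3
  obtain ⟨u, hu'⟩ := h3
  obtain ⟨c, hc, hcu⟩ := Polynomial.isUnit_iff.1 u.isUnit
  refine ⟨c, hc.ne_zero, (UniqueFactorizationMonoid.normalizedFactors ρ).card, ?_, ?_⟩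
  rotate_left
  · rw [hcu, mul_comm]; exact hu'.symm
  · rw [Nat.one_le_iff_ne_zero]
    intro h0
    rw [h0, pow_zero, one_mul] at hu'
    exact hu (hu' ▸ u.isUnit)

/-- Over an algebraic closure the resultant is `∏ (P(α) - λ Q'(α))` over the roots `α` of `q`. Its
roots in `λ` are the residues `P(α) / Q'(α)`, all of them roots of the irreducible `m`, so `m` is
its only irreducible factor up to units. -/
theorem resultant_eq_C_mul_pow {q P Q m : F[X]} [hq : Fact (Irreducible q)] (hqm : q.Monic)
    (hQ : IsCoprime q (derivative Q)) (hm : Irreducible m) (hmm : m.Monic)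
    (hroot : aeval (AdjoinRoot.mk q P / AdjoinRoot.mk q (derivative Q)) m = 0) :
    ∃ u : F, u ≠ 0 ∧ ∃ k : ℕ, 1 ≤ k ∧
      Polynomial.resultant (q.map (C : F →+* F[X]))
        (P.map (C : F →+* F[X]) - C (X : F[X]) * (derivative Q).map C) = C u * m ^ k := by
  set Λ := AlgebraicClosure F
  set ρ := Polynomial.resultant (q.map (C : F →+* F[X]))
        (P.map (C : F →+* F[X]) - C (X : F[X]) * (derivative Q).map C) with hρ
  let ι := algebraMap F Λ
  let φ : F[X] →+* Λ[X] := mapRingHom ι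
  have hφC : φ.comp (C : F →+* F[X]) = (C : Λ →+* Λ[X]).comp ι := by
    ext x; simp [φ]
  have hQα (α : Λ) (hα : aeval α q = 0) : aeval α (derivative Q) ≠ 0 := by
    obtain ⟨a, b, hab⟩ := hQ
    intro h0
    have := congrArg (aeval α) hab
    simp [hα, h0] at this
  have hmα (α : Λ) (hα : aeval α q = 0) : aeval (aeval α P / aeval α (derivative Q)) m = 0 := by
    let ψ : AdjoinRoot q →ₐ[F] Λ := AdjoinRoot.liftAlgHom q (Algebra.ofId F Λ) α hα
    have hψ (f : F[X]) : ψ (AdjoinRoot.mk q f) = aeval α f := by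
      exact AdjoinRoot.liftAlgHom_mk ..
    have := congrArg ψ hroot
    rwa [map_zero, ← aeval_algHom_apply, map_div₀, hψ, hψ] at this
  have hprod : φ ρ = ((q.map ι).roots.map fun α =>
      C (aeval α P) - X * C (aeval α (derivative Q))).prod := by
    have hinj : Function.Injective φ := map_injective ι ι.injective
    have hsplit : ((q.map ι).map (C : Λ →+* Λ[X])).Splits := (IsAlgClosed.splits (q.map ι)).map C
    rw [hρ, ← resultant_map_map]
    have e1 : (q.map C).map φ = (q.map ι).map C := by rw [map_map, map_map, hφC]
    have e2 : (P.map C - C X * (derivative Q).map C).map φ =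
        (P.map ι).map C - C X * ((derivative Q).map ι).map C := by
      rw [Polynomial.map_sub, Polynomial.map_mul, map_map, map_map, map_map, map_map, hφC, map_C]
      simp [φ]
    have e3 : (q.map (C : F →+* F[X])).natDegree = ((q.map ι).map C).natDegree := by
      rw [(hqm.map _).natDegree_map, hqm.natDegree_map, hqm.natDegree_map]
    -- The degrees are parameters of `resultant`. The first must be the exact degree, hence `e3`;
    -- for the second an upper bound is enough, the leading coefficient of `q` being `1`.
    rw [e1, e3, resultant_eq_prod_eval _ _ _ (natDegree_map_le) hsplit, e2,
      ((hqm.map ι).map C).leadingCoeff, one_pow, one_mul,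
      (IsAlgClosed.splits (q.map ι)).roots_map, Multiset.map_map]
    refine congrArg _ (Multiset.map_congr rfl fun α _ => ?_)
    simp [eval_map, eval₂_at_apply, aeval_def, ι]
  have hroots (x : Λ) : aeval x ρ = 0 ↔
      ∃ α, aeval α q = 0 ∧ aeval α P = x * aeval α (derivative Q) := by
    have : aeval x ρ = eval x (φ ρ) := by simp [φ, ι, aeval_def, eval_map]
    rw [this, hprod, eval_multiset_prod, Multiset.prod_eq_zero_iff, Multiset.map_map]
    simp only [Multiset.mem_map, Function.comp_apply, eval_sub, eval_C, eval_mul, eval_X,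
      sub_eq_zero]
    refine exists_congr fun α => and_congr_left fun _ => ?_
    rw [mem_roots (hqm.map ι).ne_zero, IsRoot.def, eval_map, aeval_def]
  have hρ0 : ρ ≠ 0 := by
    intro h0
    rw [h0, map_zero] at hprod
    have := hprod.symm
    rw [Multiset.prod_eq_zero_iff] at this
    obtain ⟨α, hα, h⟩ := Multiset.mem_map.1 this
    rw [mem_roots (hqm.map ι).ne_zero, IsRoot.def, eval_map] at hα
    have := congrArg (fun p => coeff p 1) h
    simp at this
    exact hQα α hα this
  refine exists_eq_C_mul_pow hρ0 (fun hu => ?_) hmm fun p hp hpρ => ?_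
  · obtain ⟨α, hα⟩ := IsAlgClosed.exists_aeval_eq_zero Λ q (degree_pos_of_irreducible hq.out).ne'
    have h1 := (hroots (aeval α P / aeval α (derivative Q))).2
      ⟨α, hα, (div_mul_cancel₀ _ (hQα α hα)).symm⟩
    exact (hu.map (aeval (aeval α P / aeval α (derivative Q)))).ne_zero h1
  · obtain ⟨x, hx⟩ := IsAlgClosed.exists_aeval_eq_zero Λ p (degree_pos_of_irreducible hp).ne'
    have h1 : aeval x ρ = 0 := by
      obtain ⟨r, hr⟩ := hpρ
      rw [hr, map_mul, hx, zero_mul]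
    obtain ⟨α, hα, h2⟩ := (hroots x).1 h1
    have h3 := hmα α hα
    rw [h2, mul_div_cancel_right₀ _ (hQα α hα)] at h3
    exact associated_of_common_root hp hm hx h3

end Resultant

/-! ### Gcds with `P - μ Q'` and partial fractions. -/

section Gcds

variable {E : Type*} [Field E]

/-- `g` is the monic greatest common divisor of `q` and `a`. -/
def IsMonicGcd (q a g : E[X]) : Prop := g.Monic ∧ ∀ h, h ∣ g ↔ h ∣ q ∧ h ∣ a

theorem IsMonicGcd.unique {q a g g' : E[X]} (h : IsMonicGcd q a g) (h' : IsMonicGcd q a g') :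
    g = g' :=
  eq_of_monic_of_associated h.1 h'.1
    (associated_of_dvd_dvd ((h'.2 _).2 ((h.2 _).1 dvd_rfl)) ((h.2 _).2 ((h'.2 _).1 dvd_rfl)))

theorem exists_isMonicGcd {q : E[X]} (hq : q ≠ 0) (a : E[X]) : ∃ g, IsMonicGcd q a g := by
  classical
  set d := EuclideanDomain.gcd q a with hd
  have hd0 : d ≠ 0 := fun h => hq (EuclideanDomain.gcd_eq_zero_iff.1 h).1
  have hu : IsUnit (C d.leadingCoeff⁻¹) :=
    isUnit_C.2 (isUnit_iff_ne_zero.2 (inv_ne_zero (leadingCoeff_ne_zero.2 hd0)))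
  refine ⟨d * C d.leadingCoeff⁻¹, monic_mul_leadingCoeff_inv hd0, fun h => ?_⟩
  rw [hu.dvd_mul_right]
  exact ⟨fun hh => ⟨hh.trans (EuclideanDomain.gcd_dvd_left _ _),
    hh.trans (EuclideanDomain.gcd_dvd_right _ _)⟩, fun hh => EuclideanDomain.dvd_gcd hh.1 hh.2⟩

/-- The Euclidean algorithm commutes with field extensions. -/
theorem IsMonicGcd.map {E' : Type*} [Field E'] (f : E →+* E') {q a g : E[X]}
    (h : IsMonicGcd q a g) : IsMonicGcd (q.map f) (a.map f) (g.map f) := by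
  classical
  refine ⟨h.1.map f, fun p => ⟨fun hp => ⟨hp.trans (map_dvd f ((h.2 _).1 dvd_rfl).1),
    hp.trans (map_dvd f ((h.2 _).1 dvd_rfl).2)⟩, fun hp => ?_⟩⟩
  have h1 : EuclideanDomain.gcd q a ∣ g :=
    (h.2 _).2 ⟨EuclideanDomain.gcd_dvd_left _ _, EuclideanDomain.gcd_dvd_right _ _⟩
  have h2 := map_dvd f h1
  rw [← gcd_map] at h2
  exact (EuclideanDomain.dvd_gcd hp.1 hp.2).trans h2

theorem monic_list_prod_snd {ι : Type*} {W : List (ι × E[X])} (h : ∀ z ∈ W, z.2.Monic) :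
    (W.map Prod.snd).prod.Monic := by
  induction W with
  | nil => exact monic_one
  | cons z W ih =>
    exact (h z List.mem_cons_self).mul (ih fun w hw => h w (List.mem_cons_of_mem _ hw))

theorem isCoprime_list_prod {a : E[X]} {l : List E[X]} (h : ∀ b ∈ l, IsCoprime a b) :
    IsCoprime a l.prod := by
  induction l with
  | nil => exact isCoprime_one_right
  | cons b l ih =>
    rw [List.prod_cons]
    exact IsCoprime.mul_right (h b List.mem_cons_self) (ih fun c hc => h c (List.mem_cons_of_mem _ hc))

/-- The gcds of `q` with the polynomials `P - μ R`, for `R` prime to `q`, form a factorization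
of `q` as soon as `q` divides the product of these polynomials. -/
theorem prod_gcd_eq {q P R : E[X]} (hqm : q.Monic) (hqR : IsCoprime q R) (W : List (E × E[X]))
    (hnd : (W.map Prod.fst).Nodup) (hW : ∀ z ∈ W, IsMonicGcd q (P - C z.1 * R) z.2)
    (hdvd : q ∣ (W.map fun z => P - C z.1 * R).prod) : (W.map Prod.snd).prod = q := by
  have h1 : (W.map Prod.snd).prod.Monic := monic_list_prod_snd fun z hz => (hW z hz).1
  have h2 : (W.map Prod.snd).prod ∣ q := by
    clear hdvd h1
    induction W with
    | nil => exact one_dvd _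
    | cons z W ih =>
      rw [List.map_cons, List.nodup_cons] at hnd
      rw [List.map_cons, List.prod_cons]
      refine IsCoprime.mul_dvd (isCoprime_list_prod fun b hb => ?_)
        ((hW z List.mem_cons_self).2 _ |>.1 dvd_rfl).1
        (ih hnd.2 fun w hw => hW w (List.mem_cons_of_mem _ hw))
      obtain ⟨w, hw, rfl⟩ := List.mem_map.1 hb
      have hne : z.1 ≠ w.1 := fun h => hnd.1 (h ▸ List.mem_map_of_mem hw)
      rw [← isRelPrime_iff_isCoprime]
      intro d hd1 hd2
      have e1 := ((hW z List.mem_cons_self).2 _).1 hd1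
      have e2 := ((hW w (List.mem_cons_of_mem _ hw)).2 _).1 hd2
      -- The difference of `P - z R` and `P - w R` is a nonzero multiple of `R`, which is prime to
      -- `q`: distinct residues give coprime gcds.
      have e3 : d ∣ C (w.1 - z.1) * R := by
        have := dvd_sub e1.2 e2.2
        convert this using 1
        rw [C_sub]; ring
      have hu : IsUnit (C (w.1 - z.1)) :=
        isUnit_C.2 (isUnit_iff_ne_zero.2 (sub_ne_zero.2 hne.symm))
      exact hqR.isUnit_of_dvd' e1.1 (hu.dvd_mul_left.1 e3)
  -- A divisor of a product is a product of divisors of the factors; each piece divides `q` and one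
  -- `P - μ R`, hence their gcd.
  have h3 : ∀ d, d ∣ q → d ∣ (W.map fun z => P - C z.1 * R).prod → d ∣ (W.map Prod.snd).prod := by
    clear hdvd h1 h2 hnd
    induction W with
    | nil => intro d _ h; exact h
    | cons z W ih =>
      intro d hdq hd
      rw [List.map_cons, List.prod_cons] at hd ⊢
      obtain ⟨a, b, ha, hb, rfl⟩ := exists_dvd_and_dvd_of_dvd_mul hd
      exact mul_dvd_mul (((hW z List.mem_cons_self).2 _).2 ⟨(dvd_mul_right _ _).trans hdq, ha⟩)
        (ih (fun w hw => hW w (List.mem_cons_of_mem _ hw)) _ ((dvd_mul_left _ _).trans hdq) hb)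
  exact eq_of_monic_of_associated h1 hqm (associated_of_dvd_dvd h2 (h3 q dvd_rfl hdvd))

/-- The congruences say that `c z` is the residue at the roots of `z.2`. Subtracting `c g' / g` for
the first factor `g` makes the numerator divisible by `g`, and the quotient satisfies the same
hypotheses, with the same residues, for the remaining factors. -/
theorem partial_fractions {E' : Type*} [Field E'] {ι : Type*}
    (φ : E[X] →+* E') (c : ι → E) (W : List (ι × E[X])) (P : E[X]) (hm : ∀ z ∈ W, z.2.Monic)
    (hsep : (W.map Prod.snd).prod.Separable)
    (hP : ∀ z ∈ W, z.2 ∣ P - C (c z.1) * derivative (W.map Prod.snd).prod)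
    (hdeg : P.degree < (W.map Prod.snd).prod.degree) (hx : φ (W.map Prod.snd).prod ≠ 0) :
    φ P / φ (W.map Prod.snd).prod =
      (W.map fun z => φ (C (c z.1)) * (φ (derivative z.2) / φ z.2)).sum := by
  induction W generalizing P with
  | nil =>
    rw [List.map_nil, List.prod_nil, degree_one, Nat.WithBot.lt_zero_iff, degree_eq_bot] at hdeg
    simp [hdeg]
  | cons z W ih =>
    rw [List.map_cons, List.prod_cons] at *
    set Q := (W.map Prod.snd).prod with hQ
    have hgm := hm z List.mem_cons_self
    rw [map_mul, mul_ne_zero_iff] at hx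
    obtain ⟨P1, hP1⟩ : z.2 ∣ P - C (c z.1) * derivative z.2 * Q := by
      have := hP z List.mem_cons_self
      rw [derivative_mul] at this
      have h2 := dvd_add this (dvd_mul_right z.2 (C (c z.1) * derivative Q))
      convert h2 using 1
      ring
    have hQm : Q.Monic := monic_list_prod_snd fun w hw => hm w (List.mem_cons_of_mem _ hw)
    have hdeg1 : P1.degree < Q.degree := by
      have h3 : (z.2 * P1).degree < (z.2 * Q).degree := by
        rw [← hP1]
        refine (degree_sub_le _ _).trans_lt (max_lt hdeg ?_)
        rw [mul_assoc]
        refine (degree_mul_le _ _).trans_lt ?_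
        have h7 : (derivative z.2 * Q).degree < (z.2 * Q).degree := by
          rw [degree_mul, degree_mul, degree_eq_natDegree hQm.ne_zero]
          exact WithBot.add_lt_add_right (WithBot.natCast_ne_bot _) (degree_derivative_lt hgm.ne_zero)
        refine lt_of_le_of_lt ?_ h7
        calc (C (c z.1)).degree + (derivative z.2 * Q).degree ≤ 0 + (derivative z.2 * Q).degree := by
              gcongr; exact degree_C_le
          _ = _ := zero_add _
      rw [degree_mul, degree_mul] at h3
      exact lt_of_add_lt_add_left h3
    have hcop : IsCoprime z.2 Q := hsep.isCoprime
    have := ih P1 (fun w hw => hm w (List.mem_cons_of_mem _ hw)) hsep.of_mul_right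
      (fun w hw => by
        have hwQ : w.2 ∣ Q := List.dvd_prod (List.mem_map_of_mem hw)
        have h4 := hP w (List.mem_cons_of_mem _ hw)
        have h5 : w.2 ∣ z.2 * (P1 - C (c w.1) * derivative Q) := by
          have : z.2 * (P1 - C (c w.1) * derivative Q) = (P - C (c w.1) * derivative (z.2 * Q)) -
              Q * ((C (c z.1) - C (c w.1)) * derivative z.2) := by
            rw [derivative_mul]; linear_combination -hP1
          rw [this]
          exact dvd_sub h4 (hwQ.mul_right _)
        exact (hcop.symm.of_isCoprime_of_dvd_left hwQ).dvd_of_dvd_mul_left h5) hdeg1 hx.2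
    rw [List.map_cons, List.sum_cons, ← this, map_mul]
    have h6 := congrArg φ hP1
    simp only [map_sub, map_mul] at h6
    have := hx.1
    have := hx.2
    field_simp
    linear_combination h6

/-- Modulo `q` the fraction `P / R` is a root of `m = ∏ (X - μ)`. Multiplying `∏ (P / R - μ) = 0` by
a power of `R` gives `∏ (P - μ R) = 0` modulo `q`. -/
theorem dvd_prod_of_aeval_residue {F : Type*} [Field F] (ι : F →+* E) {q P R m : F[X]}
    [hq : Fact (Irreducible q)] (hR : IsCoprime q R) {L : Multiset E}
    (hm : m.map ι = (L.map fun μ => X - C μ).prod)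
    (hroot : aeval (AdjoinRoot.mk q P / AdjoinRoot.mk q R) m = 0) :
    q.map ι ∣ (L.map fun μ => P.map ι - C μ * R.map ι).prod := by
  set q' := q.map ι
  have hmk (f : F[X]) : eval₂ ((AdjoinRoot.of q').comp ι) (AdjoinRoot.root q') f =
      AdjoinRoot.mk q' (f.map ι) := by
    rw [← eval₂_map, ← AdjoinRoot.aeval_eq]; rfl
  let ψ : AdjoinRoot q →+* AdjoinRoot q' :=
    AdjoinRoot.lift ((AdjoinRoot.of q').comp ι) (AdjoinRoot.root q')
      (by rw [hmk, AdjoinRoot.mk_self])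
  have hψ (f : F[X]) : ψ (AdjoinRoot.mk q f) = AdjoinRoot.mk q' (f.map ι) :=
    (AdjoinRoot.lift_mk _ f).trans (hmk f)
  have hR0 : AdjoinRoot.mk q R ≠ 0 := by
    rw [Ne, AdjoinRoot.mk_eq_zero]
    exact fun h => hq.out.not_isUnit (hR.isUnit_of_dvd' dvd_rfl h)
  have hρ : ψ (AdjoinRoot.mk q P / AdjoinRoot.mk q R) * AdjoinRoot.mk q' (R.map ι) =
      AdjoinRoot.mk q' (P.map ι) := by
    rw [← hψ, ← hψ, ← map_mul, div_mul_cancel₀ _ hR0]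
  set ρ := ψ (AdjoinRoot.mk q P / AdjoinRoot.mk q R)
  have h1 : eval₂ (AdjoinRoot.of q') ρ (m.map ι) = 0 := by
    have h2 := congrArg ψ hroot
    rw [map_zero, aeval_def, hom_eval₂] at h2
    rw [eval₂_map, ← h2]
    congr 1
    ext x
    have h3 := hψ (C x)
    rw [map_C] at h3
    exact h3.symm
  rw [← AdjoinRoot.mk_eq_zero, map_multiset_prod, Multiset.map_map]
  rw [hm, eval₂_multiset_prod, Multiset.map_map] at h1
  have h2 : (L.map (AdjoinRoot.mk q' ∘ fun μ => P.map ι - C μ * R.map ι)).prod =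
      (L.map ((eval₂ (AdjoinRoot.of q') ρ) ∘ fun μ => X - C μ)).prod *
        (L.map fun _ => AdjoinRoot.mk q' (R.map ι)).prod := by
    rw [← Multiset.prod_map_mul]
    refine congrArg _ (Multiset.map_congr rfl fun μ _ => ?_)
    simp only [Function.comp_apply, map_sub, map_mul, eval₂_sub, eval₂_X, eval₂_C, ← hρ]
    rw [AdjoinRoot.mk_C]
    ring
  rw [h2, h1, zero_mul]

end Gcds

end RationalIntegration

/-! ### Traces of algebraic numbers. -/

namespace RationalIntegration

open Polynomial

section Trace

/-- The trace of an algebraic number, divided by its degree. -/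
def meanTrace (z : ℂ) : ℚ := ((minpoly ℚ z).natDegree : ℚ)⁻¹ * -(minpoly ℚ z).nextCoeff

theorem meanTrace_coe {L : Type*} [Field L] [Algebra ℚ L] [Algebra L ℂ]  [Algebra.IsIntegral ℚ L] (z : L) :
    meanTrace (algebraMap L ℂ z) = Algebra.normalizedTrace ℚ L z := by
  rw [Algebra.normalizedTrace_minpoly, meanTrace, smul_eq_mul,
    minpoly.algebraMap_eq (algebraMap L ℂ).injective]

theorem isTraceless_iff {z : ℂ} (hz : IsAlgebraic ℚ z) : IsTraceless z ↔ meanTrace z = 0 := by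
  rw [IsTraceless, meanTrace, mul_eq_zero, or_iff_right, neg_eq_zero]
  exact inv_ne_zero (Nat.cast_ne_zero.2 (minpoly.natDegree_pos hz.isIntegral).ne')

instance : Algebra.IsIntegral ℚ (algebraicClosure ℚ ℂ) :=
  Algebra.isAlgebraic_iff_isIntegral.1 (algebraicClosure.isAlgebraic ℚ ℂ)

/-- The algebraic numbers of trace zero. -/
def tracelessSubmodule : Submodule ℚ ℂ :=
  (LinearMap.ker (Algebra.normalizedTrace ℚ (algebraicClosure ℚ ℂ))).map
    (algebraicClosure ℚ ℂ).val.toLinearMap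

/-- Minimal polynomials behave badly under sums. Identifying tracelessness with the vanishing of the
normalized trace makes it a linear condition on algebraic numbers. -/
theorem mem_tracelessSubmodule {z : ℂ} :
    z ∈ tracelessSubmodule ↔ IsAlgebraic ℚ z ∧ IsTraceless z := by
  constructor
  · rintro ⟨w, hw, rfl⟩
    have h1 : IsAlgebraic ℚ (w : ℂ) := mem_algebraicClosure_iff.1 w.2
    refine ⟨h1, (isTraceless_iff h1).2 ?_⟩
    exact (meanTrace_coe w).trans hw
  · rintro ⟨h1, h2⟩
    refine ⟨⟨z, mem_algebraicClosure_iff.2 h1⟩, ?_, rfl⟩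
    change _ = _
    rw [← meanTrace_coe]
    exact (isTraceless_iff h1).1 h2

theorem sub_meanTrace_mem {z : ℂ} (hz : IsAlgebraic ℚ z) :
    z - (meanTrace z : ℂ) ∈ tracelessSubmodule := by
  let w : algebraicClosure ℚ ℂ := ⟨z, mem_algebraicClosure_iff.2 hz⟩
  refine ⟨w - algebraMap ℚ _ (meanTrace z), ?_, by simp [w]⟩
  change Algebra.normalizedTrace _ _ _ = 0
  rw [map_sub, ← meanTrace_coe, Algebra.normalizedTrace_algebraMap_apply_eq_self]
  exact sub_self _

variable (K : Subfield ℂ) [NumberField K]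

theorem isAlgebraic_of_root {m : K[X]} (hm : m ≠ 0) {z : ℂ} (hz : aeval z m = 0) :
    IsAlgebraic ℚ z :=
  (show IsAlgebraic K z from ⟨m, hm, hz⟩).restrictScalars ℚ

/-- The product of the conjugates of `m ^ k` has degree `k [K : ℚ] deg m` and second coefficient `k
Tr(m.nextCoeff)`. So the shift is the normalized trace of `z`, by transitivity along `ℚ ⊆ K ⊆ K(z)`;
it depends neither on `k` nor on the root. -/
theorem isShift_pow_iff {m : K[X]} (hm : m.Monic) (hirr : Irreducible m) {k : ℕ} (hk : 1 ≤ k)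
    {z : ℂ} (hz : aeval z m = 0) (r : ℚ) : IsShift K (m ^ k) r ↔ r = meanTrace z := by
  have hzint : IsIntegral K z := ⟨m, hm, hz⟩
  have hmin : minpoly K z = m := (minpoly.eq_of_irreducible_of_monic hirr hz hm).symm
  have h1 : conjProd K (m ^ k) = (∏ σ : K →+* ℂ, m.map σ) ^ k := by
    rw [conjProd, ← Finset.prod_pow]
    exact Finset.prod_congr rfl fun σ _ => Polynomial.map_pow _ _
  have hmon : (∏ σ : K →+* ℂ, m.map σ).Monic := monic_prod_of_monic _ _ fun σ _ => hm.map σ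
  have h2 : (conjProd K (m ^ k)).nextCoeff = k * ((Algebra.trace ℚ K m.nextCoeff : ℚ) : ℂ) := by
    have e1 := trace_eq_sum_embeddings (K := ℚ) (L := K) ℂ (x := m.nextCoeff)
    rw [eq_ratCast] at e1
    rw [h1, hmon.nextCoeff_pow, Monic.nextCoeff_prod _ _ fun σ _ => hm.map σ, nsmul_eq_mul, e1]
    congr 1
    refine (Fintype.sum_equiv (RingHom.equivRatAlgHom K ℂ) _ _ fun σ => ?_)
    rw [nextCoeff_map σ.injective]
    rfl
  have h3 : (conjProd K (m ^ k)).leadingCoeff = 1 := by rw [h1]; exact hmon.pow k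
  have h4 : (conjProd K (m ^ k)).natDegree = k * (Module.finrank ℚ K * m.natDegree) := by
    rw [h1, hmon.natDegree_pow, natDegree_prod_of_monic _ _ fun σ _ => hm.map σ]
    simp [hm.natDegree_map, NumberField.Embeddings.card]
  let L := IntermediateField.adjoin K {z}
  have : FiniteDimensional K L := IntermediateField.adjoin.finiteDimensional hzint
  have : FiniteDimensional ℚ L := FiniteDimensional.trans ℚ K L
  have h5 : meanTrace z = (Module.finrank ℚ K : ℚ)⁻¹ * Algebra.trace ℚ K
      ((m.natDegree : K)⁻¹ * -m.nextCoeff) := by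
    have e1 := meanTrace_coe (IntermediateField.AdjoinSimple.gen K z)
    rw [IntermediateField.AdjoinSimple.algebraMap_gen,
      ← Algebra.normalizedTrace_trans_apply ℚ K L, Algebra.normalizedTrace_minpoly K,
      Algebra.normalizedTrace_eq_of_finiteDimensional_apply] at e1
    rw [e1, IntermediateField.minpoly_gen, hmin]
    simp [smul_eq_mul]
  have h6 : ((m.natDegree : K)⁻¹ * -m.nextCoeff) = (m.natDegree : ℚ)⁻¹ • -m.nextCoeff := by
    rw [Algebra.smul_def]; simp
  rw [h6, map_smul, map_neg, smul_eq_mul] at h5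
  have hk0 : (k : ℂ) ≠ 0 := Nat.cast_ne_zero.2 (by omega)
  have h7 : ((meanTrace z : ℚ) : ℂ) =
      -((conjProd K (m ^ k)).nextCoeff / (conjProd K (m ^ k)).leadingCoeff) /
        (conjProd K (m ^ k)).natDegree := by
    rw [h2, h3, h4, h5]
    push_cast
    rw [div_one, ← mul_neg, mul_div_mul_left _ _ hk0]
    ring
  rw [IsShift, ← h7]
  exact_mod_cast Iff.rfl

end Trace

end RationalIntegration

/-! ### Change of constants, and fractions vanishing at infinity. -/

namespace RatFun

open Polynomial

variable {n : ℕ}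

/-- The inclusion between fields of rational functions with different constants. -/
def baseInclusion {k l : Subfield ℂ} (h : k ≤ l) (s : Set (Fin n)) :
    ratField k s →+* ratField l s :=
  (ratField k s).subtype.codRestrict (ratField l s) fun x => ratField_mono h subset_rfl x.2

variable {k l : Subfield ℂ} {s : Set (Fin n)} {i j : Fin n}

theorem coe_baseInclusion (h : k ≤ l) (x : ratField k s) :
    (baseInclusion h s x : RatFun n) = x :=
  RingHom.codRestrict_apply ..

theorem evalVar_map (h : k ≤ l) (p : (ratField k s)[X]) :
    evalVar l s i (p.map (baseInclusion h s)) = evalVar k s i p := by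
  induction p using Polynomial.induction_on' with
  | add p q hp hq => rw [Polynomial.map_add, map_add, hp, hq, map_add]
  | monomial m a =>
    rw [map_monomial, ← C_mul_X_pow_eq_monomial, ← C_mul_X_pow_eq_monomial,
      map_mul, map_mul, map_pow, map_pow, evalVar_C, evalVar_C, evalVar_X, evalVar_X,
      coe_baseInclusion]

theorem evalVar_eq_eval_map (p : (ratField k s)[X]) :
    evalVar k s i p = (p.map (ratField k s).subtype).eval (var i) := by
  rw [eval_map]; rfl

/-- As `a / b` vanishes at `x_i = ∞`, `u` is the polynomial part of `f`. Euclidean division computes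
this part over the smaller field `k`, so `u` needs no new constants. -/
theorem eq_const_of_evalVar (h : k ≤ l) (hi : i ∉ s) {f : RatFun n}
    (hf : f ∈ ratField k (insert i s)) {u : ratField l s} {a b : (ratField l s)[X]}
    (hb : b.Monic) (hab : a.degree < b.degree)
    (hfu : f = u + evalVar l s i a / evalVar l s i b) : (u : RatFun n) ∈ ratField k s := by
  obtain ⟨p, t, ht, -, rfl⟩ := exists_evalVar_div_monic hi hf
  set ι := baseInclusion h s
  have ht' := ht.map ι
  have hpt : p.map ι * b = (C u * b + a) * t.map ι := by
    apply evalVar_injective (k := l) hi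
    rw [map_mul, map_mul, evalVar_map, evalVar_map, map_add, map_mul, evalVar_C]
    have h1 := evalVar_ne_zero (k := k) hi ht.ne_zero
    have h2 := evalVar_ne_zero (k := l) hi hb.ne_zero
    field_simp at hfu
    linear_combination hfu
  have hdm : p.map ι = (p %ₘ t).map ι + t.map ι * (p /ₘ t).map ι := by
    rw [← Polynomial.map_mul, ← Polynomial.map_add, modByMonic_add_div]
  have h3 : t.map ι * b * ((p /ₘ t).map ι - C u) = a * t.map ι - (p %ₘ t).map ι * b := by
    rw [hdm] at hpt
    linear_combination hpt
  have h4 : (p /ₘ t).map ι - C u = 0 := by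
    by_contra hne
    have h5 : (t.map ι * b).degree ≤ (t.map ι * b * ((p /ₘ t).map ι - C u)).degree := by
      exact degree_le_mul_left _ hne
    rw [h3] at h5
    have h6 : ((p %ₘ t).map ι).degree < (t.map ι).degree := by
      rw [degree_map, degree_map]; exact degree_modByMonic_lt _ ht
    refine absurd h5 (not_le.2 ((degree_sub_le _ _).trans_lt (max_lt ?_ ?_)))
    · rw [degree_mul, degree_mul, add_comm, degree_eq_natDegree ht'.ne_zero]
      exact WithBot.add_lt_add_left (WithBot.natCast_ne_bot _) hab
    · rw [degree_mul, degree_mul, degree_eq_natDegree hb.ne_zero]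
      exact WithBot.add_lt_add_right (WithBot.natCast_ne_bot _) h6
  have h7 := congrArg (fun q => coeff q 0) h4
  simp only [coeff_sub, coeff_map, coeff_C_zero, coeff_zero, sub_eq_zero] at h7
  rw [← h7, coe_baseInclusion]
  exact ((p /ₘ t).coeff 0).2

/-- `f` is a fraction vanishing at `x_i = ∞`. -/
def IsProper (l : Subfield ℂ) (s : Set (Fin n)) (i : Fin n) (f : RatFun n) : Prop :=
  ∃ a b : (ratField l s)[X], b.Monic ∧ a.degree < b.degree ∧ f = evalVar l s i a / evalVar l s i b

theorem IsProper.zero : IsProper l s i 0 :=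
  ⟨0, 1, monic_one, by rw [degree_zero, degree_one]; exact WithBot.bot_lt_coe 0, by simp⟩

theorem IsProper.add (hi : i ∉ s) {f g : RatFun n} (hf : IsProper l s i f)
    (hg : IsProper l s i g) : IsProper l s i (f + g) := by
  obtain ⟨a, b, hb, hab, rfl⟩ := hf
  obtain ⟨c, d, hd, hcd, rfl⟩ := hg
  refine ⟨a * d + b * c, b * d, hb.mul hd, (degree_add_le _ _).trans_lt (max_lt ?_ ?_), ?_⟩
  · rw [degree_mul, degree_mul, degree_eq_natDegree hd.ne_zero]
    exact WithBot.add_lt_add_right (WithBot.natCast_ne_bot _) hab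
  · rw [degree_mul, degree_mul, degree_eq_natDegree hb.ne_zero]
    exact WithBot.add_lt_add_left (WithBot.natCast_ne_bot _) hcd
  · rw [div_add_div _ _ (evalVar_ne_zero hi hb.ne_zero) (evalVar_ne_zero hi hd.ne_zero)]
    simp

theorem IsProper.const_mul {f : RatFun n} (hf : IsProper l s i f) {c : ℂ} (hc : c ∈ l) :
    IsProper l s i (const n c * f) := by
  obtain ⟨a, b, hb, hab, rfl⟩ := hf
  refine ⟨C ⟨const n c, const_mem hc⟩ * a, b, hb, ?_, ?_⟩
  · refine lt_of_le_of_lt ?_ hab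
    rw [degree_mul]
    calc _ ≤ 0 + a.degree := by gcongr; exact degree_C_le
      _ = _ := zero_add _
  · rw [map_mul, evalVar_C, mul_div_assoc]

/-- For `j ≠ i`, `∂_j` acts on the coefficients of `g` and kills the leading coefficient `1`, so the
numerator has smaller degree. -/
theorem IsProper.dlog (hij : j ≠ i) {g : (ratField l s)[X]} (hg : g.Monic) :
    IsProper l s i (pd j (evalVar l s i g) / evalVar l s i g) := by
  refine ⟨_, g, hg, ?_, congrArg (· / _) (pd_evalVar g hij)⟩
  let := baseDifferential l s j
  exact RationalIntegration.degree_mapCoeffs_lt hg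

end RatFun

/-! ### Closed forms and logarithmic differentials. -/

namespace RatForm

variable {n : ℕ} {ω η : RatForm n}

theorem Closed.sub (hω : ω.Closed) (hη : η.Closed) : (ω - η).Closed := fun i j => by
  rw [Pi.sub_apply, Pi.sub_apply, RatFun.pd_sub, RatFun.pd_sub, hω, hη]

theorem Closed.add (hω : ω.Closed) (hη : η.Closed) : (ω + η).Closed := fun i j => by
  rw [Pi.add_apply, Pi.add_apply, RatFun.pd_add, RatFun.pd_add, hω, hη]

theorem closed_d (f : RatFun n) : (d f).Closed := fun i j => RatFun.pd_comm i j f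

theorem closed_dlog (f : RatFun n) : (dlog f).Closed := fun i j => by
  by_cases hf : f = 0
  · simp [dlog, hf]
  · rw [dlog, dlog, RatFun.pd_div' _ _ _ hf, RatFun.pd_div' _ _ _ hf, RatFun.pd_comm i j]
    ring

theorem Closed.const_smul (hω : ω.Closed) (c : ℂ) : (RatFun.const n c • ω).Closed := fun i j => by
  rw [Pi.smul_apply, Pi.smul_apply, smul_eq_mul, smul_eq_mul, RatFun.pd_const_mul,
    RatFun.pd_const_mul, hω]

theorem closed_list_sum {l : List (RatForm n)} (h : ∀ η ∈ l, η.Closed) : l.sum.Closed := by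
  induction l with
  | nil => intro i j; simp
  | cons a l ih =>
    rw [List.sum_cons]
    exact (h a List.mem_cons_self).add (ih fun b hb => h b (List.mem_cons_of_mem _ hb))

theorem dlog_mul {f g : RatFun n} (hf : f ≠ 0) (hg : g ≠ 0) :
    dlog (f * g) = dlog f + dlog g := by
  funext i
  simp only [dlog, Pi.add_apply, RatFun.pd_mul]
  field_simp
  ring

theorem dlog_one : dlog (1 : RatFun n) = 0 := by
  funext i; simp [dlog]

theorem dlog_zpow {f : RatFun n} (hf : f ≠ 0) (m : ℤ) :
    dlog (f ^ m) = RatFun.const n (m : ℂ) • dlog f := by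
  funext i
  simp only [dlog, Pi.smul_apply, smul_eq_mul, map_intCast]
  rw [← RatFun.pdD_apply, Derivation.leibniz_zpow, zpow_sub_one₀ hf, RatFun.pdD_apply]
  simp only [zsmul_eq_mul, smul_eq_mul]
  have := zpow_ne_zero m hf
  field_simp

theorem dlog_list_prod {l : List (RatFun n)} (h : ∀ f ∈ l, f ≠ 0) :
    dlog l.prod = (l.map dlog).sum := by
  induction l with
  | nil => exact dlog_one
  | cons a l ih =>
    have h1 := fun b hb => h b (List.mem_cons_of_mem a hb)
    rw [List.prod_cons, dlog_mul (h a List.mem_cons_self)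
      (List.prod_ne_zero fun h0 => h1 0 h0 rfl), ih h1]
    simp

theorem dlog_prod {ι : Type*} (s : Finset ι) {f : ι → RatFun n} (h : ∀ a ∈ s, f a ≠ 0) :
    dlog (∏ a ∈ s, f a) = ∑ a ∈ s, dlog (f a) := by
  classical
  induction s using Finset.induction_on with
  | empty => simp [dlog_one]
  | insert a s ha ih =>
    have h1 := fun b hb => h b (Finset.mem_insert_of_mem hb)
    rw [Finset.prod_insert ha, dlog_mul (h a (Finset.mem_insert_self _ _))
      (Finset.prod_ne_zero_iff.2 h1), ih h1, Finset.sum_insert ha]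

end RatForm

/-! ### The minimal polynomial of the residues and the constant part of the resultant. -/

namespace RationalIntegration

open Polynomial RatFun

variable {n : ℕ} {K : Subfield ℂ} {i : Fin n}

theorem atVar_eq (P : (BaseField K i)[X]) : atVar K i P = evalVar K {j | j < i} i P := rfl

theorem self_notMem (i : Fin n) : i ∉ {j : Fin n | j < i} := lt_irrefl i

theorem coe_constHom (k : Subfield ℂ) (s : Set (Fin n)) (c : k) :
    (constHom k s c : RatFun n) = const n c :=
  RingHom.codRestrict_apply ..

theorem insert_lt (i : Fin n) : insert i {j : Fin n | j < i} = {j | j ≤ i} := by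
  ext j
  simp [le_iff_eq_or_lt]

/-- `m` is the minimal polynomial over `K` of the residues of `P / Q` at the roots of `q`. -/
structure IsResiduePolynomial (K : Subfield ℂ) (i : Fin n) (P Q q : (BaseField K i)[X])
    [Fact (Irreducible q)] (m : K[X]) : Prop where
  monic : m.Monic
  irreducible : Irreducible (m.map (constHom K {j | j < i}))
  aeval_eq : aeval (AdjoinRoot.mk q P / AdjoinRoot.mk q (derivative Q))
    (m.map (constHom K {j | j < i})) = 0

/-- The residues in `x_i` of a closed form are constant. -/
theorem exists_isResiduePolynomial {P q c : (BaseField K i)[X]} [hq : Fact (Irreducible q)]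
    (hqm : q.Monic) (hqc : ¬ q ∣ c) {η : RatForm n} (hη : η.Closed)
    (hηmem : ∀ j, η j ∈ ratField K {j | j ≤ i})
    (hηi : η i = atVar K i P / atVar K i (q * c)) :
    ∃ m, IsResiduePolynomial K i P (q * c) q m := by
  have hi := self_notMem i
  have : Fact q.Monic := ⟨hqm⟩
  set ρ := AdjoinRoot.mk q P / AdjoinRoot.mk q (derivative (q * c)) with hρdef
  have hqc0 : q * c ≠ 0 := mul_ne_zero hq.out.ne_zero fun h => hqc (h ▸ dvd_zero q)
  have hint : IsIntegral (BaseField K i) ρ := by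
    have : Module.Finite (BaseField K i) (AdjoinRoot q) :=
      (AdjoinRoot.powerBasis hq.out.ne_zero).finite
    exact Algebra.IsIntegral.isIntegral ρ
  -- Each `∂_j` with `j < i` kills the residue, hence the coefficients of its minimal polynomial
  -- over `K(x_j : j < i)`, which are therefore constants in `K`.
  have hcoef (d : ℕ) : ∃ a ∈ K, ((minpoly (BaseField K i) ρ).coeff d : RatFun n) = const n a := by
    refine mem_const_of_pd_eq_zero (Finset.univ.filter (· < i)) ?_ ?_
    · convert ((minpoly (BaseField K i) ρ).coeff d).2
      ext; simp
    intro j hj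
    have hji : j ≠ i := (Finset.mem_filter.1 hj).2.ne
    have h1 := hηmem j
    rw [← insert_lt] at h1
    obtain ⟨s, t, ht, hst⟩ := exists_evalVar_div hi h1
    have h2 := hη j i
    let := baseDifferential K {j | j < i} j
    have hP := pd_evalVar (k := K) (s := {j | j < i}) P hji
    have hQ := pd_evalVar (k := K) (s := {j | j < i}) (q * c) hji
    -- This is the closedness relation `∂_j η_i = ∂_i η_j`, pulled back to polynomials by the
    -- injectivity of evaluation at `x_i`.
    have h3 : (Differential.mapCoeffs P * (q * c) - P * Differential.mapCoeffs (q * c)) * t ^ 2 =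
        (derivative s * t - s * derivative t) * (q * c) ^ 2 := by
      have e1 := evalVar_ne_zero (k := K) hi ht
      have e2 := evalVar_ne_zero (k := K) hi hqc0
      rw [hηi, hst, atVar_eq, atVar_eq, pd_div' _ _ _ e1, pd_div' _ _ _ e2, hP, hQ,
        pd_evalVar_self hi, pd_evalVar_self hi, div_eq_div_iff (pow_ne_zero _ e2)
        (pow_ne_zero _ e1)] at h2
      apply evalVar_injective (k := K) hi
      generalize q * c = Qc at *
      simp only [RingHom.map_mul, RingHom.map_sub, RingHom.map_pow]
      linear_combination h2
    have h4 := deriv_residue_eq_zero hqc ht h3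
    have h5 := congrArg (fun p => coeff p d) (mapCoeffs_minpoly_eq_zero hint h4)
    exact congrArg Subtype.val h5
  have hlift : minpoly (BaseField K i) ρ ∈ lifts (constHom K {j | j < i}) := by
    rw [lifts_iff_coeff_lifts]
    intro d
    obtain ⟨a, ha, h⟩ := hcoef d
    exact ⟨⟨a, ha⟩, Subtype.ext ((coe_constHom _ _ _).trans h.symm)⟩
  obtain ⟨m, hm, -, hmm⟩ := lifts_and_natDegree_eq_and_monic hlift (minpoly.monic hint)
  refine ⟨m, hmm, ?_, ?_⟩
  · have := minpoly.irreducible hint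
    rwa [← hm] at this
  · rw [hm]; exact minpoly.aeval _ _

theorem isCoprime_derivative {q c : (BaseField K i)[X]} (hQ : Squarefree (q * c)) :
    IsCoprime q (derivative (q * c)) :=
  (show IsCoprime (q * c) (derivative (q * c)) from
    PerfectField.separable_iff_squarefree.2 hQ).of_mul_left_left

namespace IsResiduePolynomial

variable {P Q q : (BaseField K i)[X]} [hq : Fact (Irreducible q)] {m : K[X]}

theorem irreducible_base (h : IsResiduePolynomial K i P Q q m) : Irreducible m :=
  h.monic.irreducible_of_irreducible_map _ _ h.irreducible

/-- The resultant is `m ^ k` up to a unit, and divisibility between polynomials over `K` can be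
tested after extending the field, so `m ^ k` itself is the largest divisor over `K`. -/
theorem isConstantPart_iff (h : IsResiduePolynomial K i P Q q m) (hqm : q.Monic)
    (hcop : IsCoprime q (derivative Q)) :
    ∃ k : ℕ, 1 ≤ k ∧ ∀ S, IsConstantPart K i (residueResultant K i P Q q) S ↔ S = m ^ k := by
  obtain ⟨u, hu, k, hk, hρ⟩ := resultant_eq_C_mul_pow hqm hcop h.irreducible (h.monic.map _)
    h.aeval_eq
  have hdvd (T : K[X]) : T.map (constHom K {j | j < i}) ∣ residueResultant K i P Q q ↔
      T ∣ m ^ k := by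
    rw [residueResultant, hρ, (isUnit_C.2 (isUnit_iff_ne_zero.2 hu)).dvd_mul_left,
      ← Polynomial.map_pow, map_dvd_map']
  refine ⟨k, hk, fun S => ⟨fun hS => ?_, ?_⟩⟩
  · exact eq_of_monic_of_associated hS.1 (h.monic.pow k) (associated_of_dvd_dvd
      ((hdvd S).1 hS.2.1) (hS.2.2 _ ((hdvd _).2 dvd_rfl)))
  · rintro rfl
    exact ⟨h.monic.pow k, (hdvd _).2 dvd_rfl, fun T hT => (hdvd T).1 hT⟩

end IsResiduePolynomial

theorem exists_isMonicGcd_iff_map {B C' E : Type*} [Field B] [Field C'] [Field E] (ι : B →+* C')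
    (τ : C' →+* E) (σ : B →+* E) (h : τ.comp ι = σ) {P R q : B[X]} (hq : q ≠ 0) {μ : C'} {ν : E}
    (hμ : τ μ = ν) (p : E[X] → Prop) :
    (∃ g, IsMonicGcd (q.map σ) (P.map σ - C ν * R.map σ) g ∧ p g) ↔
      ∃ g, IsMonicGcd (q.map ι) (P.map ι - C μ * R.map ι) g ∧ p (g.map τ) := by
  subst h hμ
  have key : ∀ g, IsMonicGcd (q.map ι) (P.map ι - C μ * R.map ι) g →
      IsMonicGcd (q.map (τ.comp ι)) (P.map (τ.comp ι) - C (τ μ) * R.map (τ.comp ι)) (g.map τ) :=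
    fun g hg => by
      have := hg.map τ
      rwa [Polynomial.map_sub, Polynomial.map_mul, map_map, map_map, map_map, map_C] at this
  constructor
  · rintro ⟨g', hg1, hg2⟩
    obtain ⟨g, hg⟩ := exists_isMonicGcd (Polynomial.map_ne_zero (f := ι) hq)
      (P.map ι - C μ * R.map ι)
    exact ⟨g, hg, by rwa [(key g hg).unique hg1]⟩
  · rintro ⟨g, hg, h⟩
    exact ⟨_, key g hg, h⟩

/-- The constant `μ` of the field `l(x_j : j < i)`. -/
def baseConst (l : Subfield ℂ) (i : Fin n) {μ : ℂ} (hμ : μ ∈ l) :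
    ratField l {j : Fin n | j < i} := ⟨const n μ, const_mem hμ⟩

theorem subtype_baseConst {l : Subfield ℂ} {μ : ℂ} (hμ : μ ∈ l) :
    (ratField l {j : Fin n | j < i}).subtype (baseConst l i hμ) = const n μ := by
  rw [Subfield.subtype_apply, baseConst]

theorem subtype_comp_baseInclusion {l : Subfield ℂ} (hl : K ≤ l) (s : Set (Fin n)) :
    (ratField l s).subtype.comp (baseInclusion hl s) = (ratField K s).subtype := by
  ext x
  rw [RingHom.comp_apply, Subfield.subtype_apply, Subfield.subtype_apply, coe_baseInclusion]

/-- The gcd over `ℂ(x₁, …, xₙ)` is already defined over any `l(x_j : j < i)` with `l` containing `K`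
and `μ`. The case `l = ⊤` puts all gcds over one field, so that they can be multiplied; `l = K(μ -
r)` bounds their constants. -/
theorem isResidueGcd_iff {l : Subfield ℂ} (hl : K ≤ l) {P Q q : (BaseField K i)[X]} (hq : q ≠ 0)
    {μ : ℂ} (hμ : μ ∈ l) (G : RatFun n) : IsResidueGcd K i P Q q μ G ↔
      ∃ g : (ratField l {j : Fin n | j < i})[X],
        IsMonicGcd (q.map (baseInclusion hl {j : Fin n | j < i}))
          (P.map (baseInclusion hl {j : Fin n | j < i}) -
            C (baseConst l i hμ) * (derivative Q).map (baseInclusion hl {j : Fin n | j < i})) g ∧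
          G = evalVar l {j : Fin n | j < i} i g := by
  have := exists_isMonicGcd_iff_map (baseInclusion hl {j : Fin n | j < i})
    (ratField l {j : Fin n | j < i}).subtype (BaseField K i).subtype
    (subtype_comp_baseInclusion hl {j : Fin n | j < i}) (P := P) (R := derivative Q) hq
    (subtype_baseConst hμ) (fun g => G = g.eval (var i))
  simp only [evalVar_eq_eval_map]
  rw [← this]
  exact ⟨fun ⟨g, h1, h2, h3⟩ => ⟨g, ⟨h1, h2⟩, h3⟩, fun ⟨g, h, h3⟩ => ⟨g, h.1, h.2, h3⟩⟩

end RationalIntegration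

/-! ### Elimination of the variable `x_i`. -/

namespace RationalIntegration

open Polynomial RatFun

variable {n : ℕ} {K : Subfield ℂ} {i : Fin n}

/-- The inclusion of the constants in `ℂ(x_j : j < i)`. -/
def topConst (i : Fin n) : ℂ →+* ratField (⊤ : Subfield ℂ) {j : Fin n | j < i} :=
  (const n).codRestrict _ fun _ => const_mem (Subfield.mem_top _)

theorem coe_topConst (μ : ℂ) : (topConst i μ : RatFun n) = const n μ :=
  RingHom.codRestrict_apply ..

/-- The inclusion of `K(x_j : j < i)` in `ℂ(x_j : j < i)`. -/
def topIncl (K : Subfield ℂ) (i : Fin n) :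
    BaseField K i →+* ratField (⊤ : Subfield ℂ) {j : Fin n | j < i} :=
  baseInclusion le_top {j : Fin n | j < i}

/-- Evaluation at `x_i` of polynomials over `ℂ(x_j : j < i)`. -/
def evalTop (i : Fin n) : (ratField (⊤ : Subfield ℂ) {j : Fin n | j < i})[X] →+* RatFun n :=
  evalVar ⊤ {j : Fin n | j < i} i

theorem evalTop_map (p : (BaseField K i)[X]) : evalTop i (p.map (topIncl K i)) = atVar K i p := by
  rw [evalTop, topIncl, evalVar_map, atVar_eq]

theorem evalTop_ne_zero {p : (ratField (⊤ : Subfield ℂ) {j : Fin n | j < i})[X]} (hp : p ≠ 0) :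
    evalTop i p ≠ 0 :=
  evalVar_ne_zero (self_notMem i) hp

theorem topIncl_comp_constHom :
    (topIncl K i).comp (constHom K {j | j < i}) = (topConst i).comp K.subtype := by
  ext x
  rw [RingHom.comp_apply, RingHom.comp_apply, topIncl, coe_baseInclusion, coe_constHom,
    coe_topConst, Subfield.subtype_apply]

/-- A list of residues `μ` and polynomials `g`, the gcds with `P - μ Q'`. -/
def IsResidueFactors (P Q : (BaseField K i)[X])
    (W : List (ℂ × (ratField (⊤ : Subfield ℂ) {j : Fin n | j < i})[X])) : Prop :=
  ∀ z ∈ W, z.2.Monic ∧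
    z.2 ∣ P.map (topIncl K i) - C (topConst i z.1) * (derivative Q).map (topIncl K i)

theorem exists_list_map_eq {α β : Type*} (f : β → α) (p : β → Prop) {l : List α}
    (h : ∀ a ∈ l, ∃ b, a = f b ∧ p b) : ∃ L : List β, l = L.map f ∧ ∀ b ∈ L, p b := by
  induction l with
  | nil => exact ⟨[], rfl, by simp⟩
  | cons a l ih =>
    obtain ⟨b, hb, hpb⟩ := h a List.mem_cons_self
    obtain ⟨L, rfl, hL⟩ := ih fun a ha => h a (List.mem_cons_of_mem _ ha)
    exact ⟨b :: L, by rw [hb, List.map_cons], by simpa [hpb] using hL⟩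

theorem IsResiduePolynomial.exists_residueFactors {P Q q : (BaseField K i)[X]}
    [hq : Fact (Irreducible q)] {m : K[X]} (h : IsResiduePolynomial K i P Q q m) (hqm : q.Monic)
    (hcop : IsCoprime q (derivative Q)) {k : ℕ} (hk : 1 ≤ k) {Λ : List (ℂ × RatFun n)}
    (hΛ : IsResidueList K i P Q q (m ^ k) Λ) :
    ∃ W, Λ = W.map (fun z => (z.1, evalTop i z.2)) ∧ IsResidueFactors P Q W ∧
      (W.map Prod.snd).prod = q.map (topIncl K i) := by
  obtain ⟨hnd, hroot, hgcd⟩ := hΛ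
  obtain ⟨W, rfl, hW⟩ := exists_list_map_eq
    (fun z : ℂ × (ratField (⊤ : Subfield ℂ) {j : Fin n | j < i})[X] => (z.1, evalTop i z.2))
    (fun z => IsMonicGcd (q.map (topIncl K i))
      (P.map (topIncl K i) - C (topConst i z.1) * (derivative Q).map (topIncl K i)) z.2)
    (fun z hz => by
      obtain ⟨g, hg, hG⟩ := (isResidueGcd_iff (l := ⊤) le_top hq.out.ne_zero
        (Subfield.mem_top z.1) z.2).1 (hgcd z hz)
      have : baseConst ⊤ i (Subfield.mem_top z.1) = topConst i z.1 :=
        Subtype.ext (coe_topConst z.1).symm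
      rw [this] at hg
      exact ⟨(z.1, g), Prod.ext rfl hG, hg⟩)
  refine ⟨W, rfl, fun z hz => ⟨(hW z hz).1, (((hW z hz).2 _).1 dvd_rfl).2⟩, ?_⟩
  rw [List.map_map] at hnd hroot
  change (W.map Prod.fst).Nodup at hnd
  change ∀ μ, μ ∈ W.map Prod.fst ↔ _ at hroot
  -- An irreducible `m` has simple roots, and `m ^ k` has the same ones, so the duplicate-free list
  -- of residues is the full multiset of roots of `m`.
  have hroots : (m.map K.subtype).roots = (W.map Prod.fst : Multiset ℂ) := by
    have hsep : (m.map K.subtype).Separable := (h.irreducible_base.separable).map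
    rw [Multiset.Nodup.ext (nodup_roots hsep) (Multiset.coe_nodup.2 hnd)]
    intro μ
    rw [Multiset.mem_coe, hroot, Polynomial.map_pow, mem_roots (h.monic.map _).ne_zero, IsRoot.def,
      IsRoot.def, eval_pow, pow_eq_zero_iff (by omega)]
  have hprod : (m.map (constHom K {j | j < i})).map (topIncl K i) =
      (((W.map fun z => topConst i z.1 : List _) : Multiset _).map fun μ => X - C μ).prod := by
    have h1 := (IsAlgClosed.splits (m.map K.subtype)).eq_prod_roots_of_monic (h.monic.map _)
    rw [map_map, topIncl_comp_constHom, ← map_map, h1, hroots, Polynomial.map_multiset_prod]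
    simp [Function.comp_def]
  have := prod_gcd_eq (hqm.map (topIncl K i)) (P := P.map (topIncl K i))
    (R := (derivative Q).map (topIncl K i)) (hcop.map (mapRingHom (topIncl K i)))
    (W.map fun z => (topConst i z.1, z.2)) ?_ ?_ ?_
  · rwa [List.map_map] at this
  · rw [List.map_map]
    exact (List.nodup_map_iff (topConst i).injective).2 hnd |> fun h => by
      rwa [List.map_map] at h
  · intro z hz
    obtain ⟨w, hw, rfl⟩ := List.mem_map.1 hz
    exact hW w hw
  · have := dvd_prod_of_aeval_residue (topIncl K i) hcop hprod h.aeval_eq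
    rw [Multiset.map_coe, Multiset.prod_coe, List.map_map] at this
    rwa [List.map_map]

theorem sum_residueFactors {P Q : (BaseField K i)[X]} (hQm : Q.Monic) (hQ : Squarefree Q)
    (hPQ : P.degree < Q.degree) {W} (hW : IsResidueFactors P Q W)
    (hprod : (W.map Prod.snd).prod = Q.map (topIncl K i)) :
    atVar K i P / atVar K i Q =
      ((W.map fun z => const n z.1 • RatForm.dlog (evalTop i z.2)).sum : RatForm n) i := by
  have hsum : ((W.map fun z => const n z.1 • RatForm.dlog (evalTop i z.2)).sum : RatForm n) i =
      (W.map fun z => const n z.1 * (evalTop i (derivative z.2) / evalTop i z.2)).sum := by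
    clear hprod hW
    induction W with
    | nil => rfl
    | cons z W ih =>
      rw [List.map_cons, List.sum_cons, Pi.add_apply, ih, List.map_cons, List.sum_cons,
        Pi.smul_apply, RatForm.dlog, evalTop, pd_evalVar_self (self_notMem i), smul_eq_mul]
  have h0 : evalTop i (W.map Prod.snd).prod ≠ 0 := by
    rw [hprod, evalTop_map, atVar_eq]; exact evalVar_ne_zero (self_notMem i) hQm.ne_zero
  have h := partial_fractions (evalTop i) (topConst i) W (P.map (topIncl K i))
    (fun z hz => (hW z hz).1)
    (by rw [hprod]; exact (PerfectField.separable_iff_squarefree.2 hQ).map)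
    (fun z hz => by rw [hprod, derivative_map]; exact (hW z hz).2)
    (by rwa [hprod, degree_map, degree_map]) h0
  rw [hprod, evalTop_map, evalTop_map] at h
  rw [hsum, h]
  congr 1
  refine List.map_congr_left fun z _ => ?_
  rw [evalTop, evalVar_C, coe_topConst]

/-- Removing the logarithmic part eliminates the variable `x_i`. -/
theorem sub_residueFactors_mem {P Q : (BaseField K i)[X]} (hQm : Q.Monic) (hQ : Squarefree Q)
    (hPQ : P.degree < Q.degree) {W} (hW : IsResidueFactors P Q W)
    (hprod : (W.map Prod.snd).prod = Q.map (topIncl K i)) {η ω : RatForm n} (hη : η.Closed)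
    (hηmem : ∀ j, η j ∈ ratField K {j | j ≤ i}) (hη0 : ∀ j, i < j → η j = 0)
    (hηi : η i = atVar K i P / atVar K i Q)
    (hω : ω = η - (W.map fun z => const n z.1 • RatForm.dlog (evalTop i z.2)).sum) :
    ω.Closed ∧ (∀ j, ω j ∈ ratField K {j | j < i}) ∧ ∀ j, ¬ j < i → ω j = 0 := by
  have hi := self_notMem i
  have hclosed : ω.Closed := by
    rw [hω]
    refine hη.sub (RatForm.closed_list_sum fun ζ hζ => ?_)
    obtain ⟨z, -, rfl⟩ := List.mem_map.1 hζ
    exact (RatForm.closed_dlog _).const_smul _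
  have hωi : ω i = 0 := by
    rw [hω, Pi.sub_apply, hηi, sum_residueFactors hQm hQ hPQ hW hprod, sub_self]
  have hgmem (g : (ratField (⊤ : Subfield ℂ) {j : Fin n | j < i})[X]) :
      evalTop i g ∈ ratField (⊤ : Subfield ℂ) {j : Fin n | j ≤ i} := by
    rw [← insert_lt]; exact evalVar_mem g
  have hsum_mem (j : Fin n) :
      ((W.map fun z => const n z.1 • RatForm.dlog (evalTop i z.2)).sum : RatForm n) j ∈
        ratField (⊤ : Subfield ℂ) {j : Fin n | j ≤ i} := by
    clear hprod hW hω
    induction W with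
    | nil => exact zero_mem _
    | cons z W ih =>
      rw [List.map_cons, List.sum_cons]
      exact add_mem (mul_mem (const_mem (Subfield.mem_top _))
        (div_mem (pd_mem _ (hgmem _)) (hgmem _))) ih
  have hω0 (j : Fin n) (hj : i < j) : ω j = 0 := by
    have hsum : ((W.map fun z => const n z.1 • RatForm.dlog (evalTop i z.2)).sum : RatForm n) j
        = 0 := by
      clear hprod hW hω hsum_mem
      induction W with
      | nil => rfl
      | cons z W ih =>
        rw [List.map_cons, List.sum_cons, Pi.add_apply, ih, Pi.smul_apply, RatForm.dlog,
          pd_eq_zero_of_notMem (s := {j | j ≤ i}) (by simpa using hj) (hgmem z.2)]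
        simp
    rw [hω, Pi.sub_apply, hη0 j hj, hsum, sub_zero]
  refine ⟨hclosed, fun j => ?_, fun j hj => ?_⟩
  · by_cases hji : j = i
    · rw [hji, hωi]; exact zero_mem _
    -- Closedness gives `∂_i ω_j = ∂_j ω_i = 0`; at this stage the constants are only known to be
    -- complex.
    have h1 : ω j ∈ ratField (⊤ : Subfield ℂ) {j : Fin n | j < i} := by
      refine mem_of_pd_eq_zero hi ?_ ?_
      · rw [insert_lt, hω]
        exact sub_mem (ratField_mono le_top subset_rfl (hηmem j)) (hsum_mem j)
      · rw [hclosed i j, hωi, pd_zero]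
    -- The residues may lie outside `K`. But the subtracted part vanishes at `x_i = ∞`, so `ω_j` is
    -- the polynomial part in `x_i` of `η_j`, which is over `K`.
    have h2 : IsProper ⊤ {j : Fin n | j < i} i
        (((W.map fun z => const n z.1 • RatForm.dlog (evalTop i z.2)).sum : RatForm n) j) := by
      clear hprod hω hsum_mem
      induction W with
      | nil => exact IsProper.zero
      | cons z W ih =>
        rw [List.map_cons, List.sum_cons]
        exact IsProper.add hi ((IsProper.dlog hji (hW z List.mem_cons_self).1).const_mul
          (Subfield.mem_top _)) (ih fun w hw => hW w (List.mem_cons_of_mem _ hw))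
    obtain ⟨a, b, hb, hab, h3⟩ := h2
    refine eq_const_of_evalVar (l := ⊤) le_top hi (f := η j) (u := ⟨ω j, h1⟩) ?_ hb hab ?_
    · rw [insert_lt]; exact hηmem j
    · rw [← h3]
      change _ = ω j + _
      rw [hω, Pi.sub_apply, sub_add_cancel]
  · rcases (not_lt.1 hj).eq_or_lt with rfl | hj
    · exact hωi
    · exact hω0 j hj

end RationalIntegration

/-! ### Values and derivatives of rational functions at a point. -/

namespace RatFun

open Filter Topology

variable {n : ℕ} {f g : RatFun n} {x : Fin n → ℂ}

/-- The reduced denominator divides any other denominator of `f`, so evaluation may use any fraction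
whose denominator does not vanish at the point. -/
theorem eval_div_of_ne_zero {a b : MvPolynomial (Fin n) ℂ} (hb : MvPolynomial.eval x b ≠ 0)
    (hf : f = algebraMap _ (RatFun n) a / algebraMap _ (RatFun n) b) :
    f.DefinedAt x ∧ f.eval x = MvPolynomial.eval x a / MvPolynomial.eval x b := by
  have hb0 : b ≠ 0 := by rintro rfl; simp at hb
  have h := num_mul_eq a b hb0 f hf
  have hrel : IsRelPrime f.num f.den := IsFractionRing.num_den_reduced _ _
  have hdvd : f.den ∣ b := hrel.symm.dvd_of_dvd_mul_left ⟨a, by rw [h, mul_comm]⟩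
  have hd : MvPolynomial.eval x f.den ≠ 0 := by
    obtain ⟨c, hc⟩ := hdvd
    intro h0
    rw [hc, map_mul, h0, zero_mul] at hb
    exact hb rfl
  have h' := congrArg (MvPolynomial.eval x) h
  rw [map_mul, map_mul] at h'
  exact ⟨hd, by rw [eval, div_eq_div_iff hd hb, h']⟩

theorem DefinedAt.add (hf : f.DefinedAt x) (hg : g.DefinedAt x) :
    (f + g).DefinedAt x ∧ (f + g).eval x = f.eval x + g.eval x := by
  have h : f + g = algebraMap _ (RatFun n) (f.num * g.den + f.den * g.num) /
      algebraMap _ (RatFun n) (f.den * g.den) := by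
    conv_lhs => rw [← num_div_den f, ← num_div_den g]
    rw [div_add_div _ _ (algebraMap_ne_zero (den_ne_zero f)) (algebraMap_ne_zero (den_ne_zero g))]
    simp only [map_add, map_mul]
  obtain ⟨h1, h2⟩ := eval_div_of_ne_zero (x := x) (by rw [map_mul]; exact mul_ne_zero hf hg) h
  refine ⟨h1, h2.trans ?_⟩
  rw [eval, eval, div_add_div _ _ hf hg]
  simp only [map_add, map_mul]

theorem DefinedAt.mul (hf : f.DefinedAt x) (hg : g.DefinedAt x) :
    (f * g).DefinedAt x ∧ (f * g).eval x = f.eval x * g.eval x := by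
  have h : f * g = algebraMap _ (RatFun n) (f.num * g.num) /
      algebraMap _ (RatFun n) (f.den * g.den) := by
    conv_lhs => rw [← num_div_den f, ← num_div_den g]
    rw [div_mul_div_comm, map_mul, map_mul]
  obtain ⟨h1, h2⟩ := eval_div_of_ne_zero (x := x) (by rw [map_mul]; exact mul_ne_zero hf hg) h
  refine ⟨h1, h2.trans ?_⟩
  rw [eval, eval, div_mul_div_comm, map_mul, map_mul]

theorem definedAt_const (c : ℂ) : (const n c).DefinedAt x ∧ (const n c).eval x = c := by
  have := eval_div_of_ne_zero (f := const n c) (x := x) (a := MvPolynomial.C c) (b := 1)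
    (by simp) (by rw [map_one, div_one]; rfl)
  simpa using this

theorem UnitAt.definedAt (hf : f.UnitAt x) : f.DefinedAt x := hf.2

theorem UnitAt.eval_ne_zero (hf : f.UnitAt x) : f.eval x ≠ 0 := div_ne_zero hf.1 hf.2

theorem UnitAt.inv (hf : f.UnitAt x) : f⁻¹.DefinedAt x ∧ f⁻¹.eval x = (f.eval x)⁻¹ := by
  have h : f⁻¹ = algebraMap _ (RatFun n) f.den / algebraMap _ (RatFun n) f.num := by
    conv_lhs => rw [← num_div_den f, inv_div]
  obtain ⟨h1, h2⟩ := eval_div_of_ne_zero (x := x) hf.1 h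
  exact ⟨h1, by rw [h2, eval, inv_div]⟩

theorem UnitAt.div (hg : g.UnitAt x) (hf : f.DefinedAt x) :
    (f / g).DefinedAt x ∧ (f / g).eval x = f.eval x / g.eval x := by
  rw [div_eq_mul_inv, div_eq_mul_inv, ← hg.inv.2]
  exact hf.mul hg.inv.1

theorem definedAt_sum {ι : Type*} (s : Finset ι) (F : ι → RatFun n)
    (h : ∀ j ∈ s, (F j).DefinedAt x) :
    (∑ j ∈ s, F j).DefinedAt x ∧ (∑ j ∈ s, F j).eval x = ∑ j ∈ s, (F j).eval x := by
  classical
  induction s using Finset.induction_on with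
  | empty => simpa using definedAt_const (n := n) (x := x) 0
  | insert a s ha ih =>
    obtain ⟨h1, h2⟩ := ih fun j hj => h j (Finset.mem_insert_of_mem hj)
    rw [Finset.sum_insert ha, Finset.sum_insert ha, ← h2]
    exact (h a (Finset.mem_insert_self _ _)).add h1

theorem analyticAt_polynomial (p : MvPolynomial (Fin n) ℂ) (x : Fin n → ℂ) :
    AnalyticAt ℂ (fun y => MvPolynomial.eval y p) x :=
  AnalyticOnNhd.eval_mvPolynomial p x (Set.mem_univ x)

theorem fderiv_polynomial (p : MvPolynomial (Fin n) ℂ) (x : Fin n → ℂ) (k : Fin n) :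
    fderiv ℂ (fun y => MvPolynomial.eval y p) x (Pi.single k 1) =
      MvPolynomial.eval x (MvPolynomial.pderiv k p) := by
  have hd (q : MvPolynomial (Fin n) ℂ) := (analyticAt_polynomial q x).differentiableAt
  induction p using MvPolynomial.induction_on with
  | C a => simp
  | add p q hp hq =>
    simp only [map_add]
    rw [fderiv_fun_add (hd p) (hd q), add_apply, hp, hq]
  | mul_X p j hp =>
    simp only [map_mul, Derivation.leibniz]
    rw [fderiv_fun_mul (hd p) (hd _)]
    have hX : (fun y : Fin n → ℂ => MvPolynomial.eval y (MvPolynomial.X j : MvPolynomial (Fin n) ℂ))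
        = fun y => y j := by funext y; simp
    have hX' : fderiv ℂ (fun y : Fin n → ℂ => y j) x (Pi.single k 1) =
        (Pi.single k (1 : ℂ) : Fin n → ℂ) j := by
      exact congrArg (fun L : (Fin n → ℂ) →L[ℂ] ℂ => L (Pi.single k 1))
        (ContinuousLinearMap.proj (R := ℂ) (φ := fun _ : Fin n => ℂ) j).fderiv
    simp only [add_apply, smul_apply, hp, hX',
      smul_eq_mul, map_add, MvPolynomial.pderiv_X, MvPolynomial.eval_X, map_mul]
    congr 2
    by_cases h : j = k
    · subst h; simp
    · simp [h]

theorem DefinedAt.analyticAt (hf : f.DefinedAt x) : AnalyticAt ℂ f.eval x :=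
  (analyticAt_polynomial _ x).div (analyticAt_polynomial _ x) hf

theorem isOpen_definedAt (f : RatFun n) : IsOpen {x | f.DefinedAt x} :=
  isOpen_ne_fun (MvPolynomial.continuous_eval _) continuous_const

theorem DefinedAt.pd (hf : f.DefinedAt x) (k : Fin n) :
    (RatFun.pd k f).DefinedAt x ∧
      (RatFun.pd k f).eval x = fderiv ℂ f.eval x (Pi.single k 1) := by
  obtain ⟨h1, h2⟩ := eval_div_of_ne_zero (f := RatFun.pd k f) (x := x) (b := f.den ^ 2)
    (by rw [map_pow]; exact pow_ne_zero 2 hf) rfl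
  refine ⟨h1, h2.trans ?_⟩
  have e1 := hf.analyticAt.differentiableAt
  have e2 := (analyticAt_polynomial f.den x).differentiableAt
  have e : (fun y => f.eval y * MvPolynomial.eval y f.den) =ᶠ[𝓝 x]
      fun y => MvPolynomial.eval y f.num := by
    filter_upwards [(isOpen_definedAt f).mem_nhds hf] with y hy
    exact div_mul_cancel₀ _ hy
  have e3 := congrArg (fun L : (Fin n → ℂ) →L[ℂ] ℂ => L (Pi.single k 1)) e.fderiv_eq
  rw [fderiv_fun_mul e1 e2, fderiv_polynomial] at e3
  simp only [add_apply, smul_apply, fderiv_polynomial, smul_eq_mul] at e3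
  rw [map_sub, map_mul, map_mul, map_pow, ← e3, div_eq_iff (pow_ne_zero 2 hf)]
  have h0 : MvPolynomial.eval x f.num = f.eval x * MvPolynomial.eval x f.den :=
    (div_mul_cancel₀ _ hf).symm
  rw [h0]
  ring

theorem isOpen_unitAt (f : RatFun n) : IsOpen {x | f.UnitAt x} :=
  (isOpen_ne_fun (MvPolynomial.continuous_eval _) continuous_const).inter
    (isOpen_ne_fun (MvPolynomial.continuous_eval _) continuous_const)

/-- A nonzero polynomial does not vanish identically on a nonempty open set. -/
theorem exists_eval_ne_zero {p : MvPolynomial (Fin n) ℂ} (hp : p ≠ 0) {U : Set (Fin n → ℂ)}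
    (hU : IsOpen U) (hne : U.Nonempty) : ∃ x ∈ U, MvPolynomial.eval x p ≠ 0 := by
  by_contra! hcon
  obtain ⟨x, hx⟩ := hne
  obtain ⟨ε, hε, hball⟩ := Metric.isOpen_iff.1 hU x hx
  refine hp (MvPolynomial.funext_set (fun i => Metric.ball (x i) ε) (fun i => ?_) fun y hy => ?_)
  · exact infinite_of_mem_nhds (x i) (Metric.ball_mem_nhds _ hε)
  · rw [map_zero]
    refine hcon y (hball ?_)
    rw [ball_pi _ hε]
    exact hy

end RatFun

/-! ### Logarithmic differentials of analytic branches. -/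

section

open Filter Topology

section LogDeriv

variable {n : ℕ} {g h : (Fin n → ℂ) → ℂ} {x : Fin n → ℂ} {u v : Fin n → ℂ}

/-- `g` is analytic at `x`, with logarithmic gradient `u` there. -/
def HasLogGradAt (g : (Fin n → ℂ) → ℂ) (u : Fin n → ℂ) (x : Fin n → ℂ) : Prop :=
  AnalyticAt ℂ g x ∧ ∀ k, fderiv ℂ g x (Pi.single k 1) = u k * g x

theorem HasLogGradAt.mul (hg : HasLogGradAt g u x) (hh : HasLogGradAt h v x) :
    HasLogGradAt (fun y => g y * h y) (u + v) x := by
  refine ⟨hg.1.mul hh.1, fun k => ?_⟩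
  rw [fderiv_fun_mul hg.1.differentiableAt hh.1.differentiableAt]
  simp only [add_apply, smul_apply, smul_eq_mul, hg.2, hh.2, Pi.add_apply]
  ring

theorem HasLogGradAt.prod {ι : Type*} (s : Finset ι) {g : ι → (Fin n → ℂ) → ℂ}
    {u : ι → Fin n → ℂ} (hg : ∀ j ∈ s, HasLogGradAt (g j) (u j) x) :
    HasLogGradAt (fun y => ∏ j ∈ s, g j y) (∑ j ∈ s, u j) x := by
  classical
  induction s using Finset.induction_on with
  | empty =>
    refine ⟨by simpa using analyticAt_const, fun k => ?_⟩
    simp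
  | insert a s ha ih =>
    simp only [Finset.prod_insert ha, Finset.sum_insert ha]
    exact (hg a (Finset.mem_insert_self _ _)).mul
      (ih fun j hj => hg j (Finset.mem_insert_of_mem hj))

theorem hasLogGradAt_exp (hh : AnalyticAt ℂ h x) :
    HasLogGradAt (fun y => Complex.exp (h y)) (fun k => fderiv ℂ h x (Pi.single k 1)) x := by
  refine ⟨hh.cexp, fun k => ?_⟩
  rw [hh.differentiableAt.hasFDerivAt.cexp.fderiv]
  simp only [smul_apply, smul_eq_mul]
  ring

theorem RatFun.UnitAt.fderiv_eval {f : RatFun n} (hf : f.UnitAt x) (k : Fin n) :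
    fderiv ℂ f.eval x (Pi.single k 1) = (RatForm.dlog f k).eval x * f.eval x := by
  rw [RatForm.dlog, (hf.div (hf.definedAt.pd k).1).2, (hf.definedAt.pd k).2,
    div_mul_cancel₀ _ hf.eval_ne_zero]

theorem RatFun.UnitAt.fderiv_log {f : RatFun n} (hf : f.UnitAt x) (hh : AnalyticAt ℂ h x)
    (he : ∀ᶠ y in 𝓝 x, Complex.exp (h y) = f.eval y) (k : Fin n) :
    fderiv ℂ h x (Pi.single k 1) = (RatForm.dlog f k).eval x := by
  have e := congrArg (fun L : (Fin n → ℂ) →L[ℂ] ℂ => L (Pi.single k 1)) (EventuallyEq.fderiv_eq he)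
  have e0 : Complex.exp (h x) = f.eval x := he.self_of_nhds
  rw [(hasLogGradAt_exp hh).2] at e
  beta_reduce at e
  rw [e0] at e
  exact mul_right_cancel₀ hf.eval_ne_zero (e.trans (hf.fderiv_eval k))

theorem RatFun.UnitAt.hasLogGradAt_root {f : RatFun n} (hf : f.UnitAt x) (hh : AnalyticAt ℂ h x)
    {q : ℕ} (hq : 0 < q) (he : ∀ᶠ y in 𝓝 x, h y ^ q = f.eval y) :
    h x ≠ 0 ∧ HasLogGradAt h (fun k => 1 / (q : ℂ) * (RatForm.dlog f k).eval x) x := by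
  have h0 : h x ≠ 0 := by
    intro h0
    have := he.self_of_nhds
    rw [h0, zero_pow hq.ne'] at this
    exact hf.eval_ne_zero this.symm
  refine ⟨h0, hh, fun k => ?_⟩
  have e := congrArg (fun L : (Fin n → ℂ) →L[ℂ] ℂ => L (Pi.single k 1)) (EventuallyEq.fderiv_eq he)
  rw [hf.fderiv_eval k, ← he.self_of_nhds, fderiv_fun_pow q hh.differentiableAt] at e
  simp only [smul_apply, nsmul_eq_mul, smul_eq_mul] at e
  obtain ⟨m, rfl⟩ : ∃ m, q = m + 1 := ⟨q - 1, by omega⟩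
  have hq' : ((m + 1 : ℕ) : ℂ) ≠ 0 := by exact_mod_cast hq.ne'
  rw [Nat.add_sub_cancel, pow_succ] at e
  have e' : ((m + 1 : ℕ) : ℂ) * fderiv ℂ h x (Pi.single k 1) =
      (RatForm.dlog f k).eval x * h x :=
    mul_left_cancel₀ (pow_ne_zero m h0) (by linear_combination e)
  field_simp
  linear_combination e'

end LogDeriv

namespace HyperexpData

variable {n : ℕ} {r : HyperexpData n} {V U : Set (Fin n → ℂ)} {g H : (Fin n → ℂ) → ℂ}
  {ω : RatForm n}

/-- Logarithmic gradients add over products: `e^{F₀}` contributes `dF₀`, the root of `A` contributes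
`dA / (q A)`, and `exp(λ log F)` contributes `λ dF / F`. No pole occurs at regular points. -/
theorem IsBranch.hasLogGradAt (h : r.IsBranch V g) (hq : 0 < r.q)
    (hω : ω = RatForm.d r.F0 + (RatFun.const n (1 / (r.q : ℂ))) • RatForm.dlog r.A +
      ∑ j, RatFun.const n (r.lam j) • RatForm.dlog (r.F j)) {x : Fin n → ℂ} (hx : x ∈ V) :
    (∀ k, (ω k).DefinedAt x) ∧ g x ≠ 0 ∧ HasLogGradAt g (fun k => (ω k).eval x) x := by
  obtain ⟨hV, -, hreg, a, l, ha, haq, hl, hle, hg⟩ := h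
  have hnhds := hV.mem_nhds hx
  obtain ⟨h0, hA, hF⟩ := hreg hx
  have hdA (k) := hA.div (hA.definedAt.pd k).1
  have hcA (k) := (RatFun.definedAt_const (x := x) (1 / (r.q : ℂ))).1.mul (hdA k).1
  have hdF (k j) := (hF j).div ((hF j).definedAt.pd k).1
  have hcF (k j) := (RatFun.definedAt_const (x := x) (r.lam j)).1.mul (hdF k j).1
  have hsum (k) := RatFun.definedAt_sum (x := x) Finset.univ
    (fun j => RatFun.const n (r.lam j) * (RatFun.pd k (r.F j) / r.F j)) (fun j _ => (hcF k j).1)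
  have hωk (k) : ω k = RatFun.pd k r.F0 + RatFun.const n (1 / (r.q : ℂ)) *
      (RatFun.pd k r.A / r.A) +
      ∑ j, RatFun.const n (r.lam j) * (RatFun.pd k (r.F j) / r.F j) := by
    rw [hω]
    simp [RatForm.d, RatForm.dlog, Finset.sum_apply]
  have htot (k) := ((h0.pd k).1.add (hcA k).1).1.add (hsum k).1
  have heval (k) : (ω k).eval x = fderiv ℂ r.F0.eval x (Pi.single k 1) +
      1 / (r.q : ℂ) * (RatForm.dlog r.A k).eval x +
      ∑ j, r.lam j * (RatForm.dlog (r.F j) k).eval x := by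
    rw [hωk, (htot k).2, ((h0.pd k).1.add (hcA k).1).2, (h0.pd k).2, (hcA k).2, (hsum k).2,
      (RatFun.definedAt_const _).2]
    congr 1
    refine Finset.sum_congr rfl fun j _ => ?_
    rw [(hcF k j).2, (RatFun.definedAt_const _).2]
    rfl
  obtain ⟨ha0, hal⟩ := hA.hasLogGradAt_root (ha x hx) hq (eventually_of_mem hnhds haq)
  have hev : g =ᶠ[𝓝 x] fun y => Complex.exp (r.F0.eval y) * a y *
      ∏ j, Complex.exp (r.lam j * l j y) := eventually_of_mem hnhds hg
  have hmain := ((hasLogGradAt_exp h0.analyticAt).mul hal).mul (HasLogGradAt.prod Finset.univ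
    fun j _ => hasLogGradAt_exp (h := fun y => r.lam j * l j y)
      ((analyticAt_const (v := r.lam j)).mul (hl j x hx)))
  refine ⟨fun k => by rw [hωk]; exact (htot k).1, ?_, hmain.1.congr hev.symm, fun k => ?_⟩
  · rw [hg x hx]
    exact mul_ne_zero (mul_ne_zero (Complex.exp_ne_zero _) ha0)
      (Finset.prod_ne_zero_iff.2 fun j _ => Complex.exp_ne_zero _)
  · rw [hev.fderiv_eq, hev.self_of_nhds, hmain.2]
    beta_reduce
    rw [heval]
    congr 1
    simp only [Pi.add_apply, Finset.sum_apply]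
    congr 1
    refine Finset.sum_congr rfl fun j _ => ?_
    rw [← (hF j).fderiv_log (hl j x hx) (eventually_of_mem hnhds (hle j)),
      fderiv_const_mul (hl j x hx).differentiableAt]
    simp

theorem IsBranch.hasLogDifferential (h : r.IsBranch V g) (hq : 0 < r.q)
    (hω : ω = RatForm.d r.F0 + (RatFun.const n (1 / (r.q : ℂ))) • RatForm.dlog r.A +
      ∑ j, RatFun.const n (r.lam j) • RatForm.dlog (r.F j)) : HasLogDifferential V g ω where
  isOpen := h.1
  isConnected := h.2.1
  analytic x hx := (h.hasLogGradAt hq hω hx).2.2.1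
  ne_zero := by
    obtain ⟨x, hx⟩ := h.2.1.nonempty
    exact ⟨x, hx, (h.hasLogGradAt hq hω hx).2.1⟩
  eq x hx k := by
    obtain ⟨h1, -, h2⟩ := h.hasLogGradAt hq hω hx
    rw [h2.2]
    change _ * (_ / _ * _) = _
    rw [← mul_assoc, mul_div_cancel₀ _ (h1 k)]

theorem isOpen_regular (r : HyperexpData n) : IsOpen r.regular := by
  have h : r.regular = {x | r.F0.DefinedAt x} ∩ ({x | r.A.UnitAt x} ∩
      ⋂ j, {x | (r.F j).UnitAt x}) := by
    ext x; simp [regular]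
  rw [h]
  exact (RatFun.isOpen_definedAt _).inter ((RatFun.isOpen_unitAt _).inter
    (isOpen_iInter_of_finite fun j => RatFun.isOpen_unitAt _))

theorem _root_.RatFun.UnitAt.exists_log {f : RatFun n} {x : Fin n → ℂ} (hf : f.UnitAt x) :
    ∃ l : (Fin n → ℂ) → ℂ, ∀ᶠ y in 𝓝 x, AnalyticAt ℂ l y ∧ Complex.exp (l y) = f.eval y := by
  -- Dividing by the value at `x` moves the argument close to `1`, inside the slit plane where the
  -- principal logarithm is analytic.
  refine ⟨fun y => Complex.log (f.eval y / f.eval x) + Complex.log (f.eval x), ?_⟩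
  have hx0 := hf.eval_ne_zero
  have hc : ContinuousAt (fun y => f.eval y / f.eval x) x :=
    hf.definedAt.analyticAt.continuousAt.div_const _
  have h1 : ∀ᶠ y in 𝓝 x, f.eval y / f.eval x ∈ Complex.slitPlane :=
    hc.eventually_mem (Complex.isOpen_slitPlane.mem_nhds (by simp [div_self hx0]))
  filter_upwards [h1, (RatFun.isOpen_unitAt f).mem_nhds hf] with y hy hfy
  refine ⟨((hfy.definedAt.analyticAt.div analyticAt_const hx0).clog hy).add analyticAt_const, ?_⟩
  rw [Complex.exp_add, Complex.exp_log (Complex.slitPlane_ne_zero hy), Complex.exp_log hx0,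
    div_mul_cancel₀ _ hx0]

theorem exists_isBranch (hq : 0 < r.q) (hU : IsOpen U) {x : Fin n → ℂ}
    (hx : x ∈ U ∩ r.regular) : ∃ V g, x ∈ V ∧ V ⊆ U ∧ r.IsBranch V g := by
  obtain ⟨la, hla⟩ := hx.2.2.1.exists_log
  choose l hl using fun j => (hx.2.2.2 j).exists_log
  have hev := ((hU.inter r.isOpen_regular).eventually_mem hx).and
    (hla.and (eventually_all.2 hl))
  obtain ⟨ε, hε, hball⟩ := Metric.eventually_nhds_iff_ball.1 hev
  refine ⟨Metric.ball x ε, fun y => Complex.exp (r.F0.eval y) * Complex.exp (1 / (r.q : ℂ) * la y) *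
      ∏ j, Complex.exp (r.lam j * l j y), Metric.mem_ball_self hε, fun y hy => (hball y hy).1.1,
    Metric.isOpen_ball, ⟨⟨x, Metric.mem_ball_self hε⟩, (convex_ball x ε).isPreconnected⟩,
    fun y hy => (hball y hy).1.2, fun y => Complex.exp (1 / (r.q : ℂ) * la y), l,
    fun y hy => (analyticAt_const.mul (hball y hy).2.1.1).cexp, fun y hy => ?_,
    fun j y hy => ((hball y hy).2.2 j).1, fun j y hy => ((hball y hy).2.2 j).2, fun y hy => rfl⟩
  have hq' : (r.q : ℂ) ≠ 0 := by exact_mod_cast hq.ne'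
  rw [← Complex.exp_nat_mul, ← mul_assoc, mul_one_div_cancel hq', one_mul, (hball y hy).2.1.2]

/-- `H` and a branch `g` satisfy the same equation on `V` and `g` has no zero there, so `H / g` has
zero derivative and is constant on the connected set `V`. -/
theorem expresses (hq : 0 < r.q)
    (hω : ω = RatForm.d r.F0 + (RatFun.const n (1 / (r.q : ℂ))) • RatForm.dlog r.A +
      ∑ j, RatFun.const n (r.lam j) • RatForm.dlog (r.F j)) (hH : HasLogDifferential U H ω) :
    r.Expresses U H := by
  refine ⟨fun x hx => exists_isBranch hq hH.isOpen hx, fun V g hVU hg => ?_⟩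
  have hH' (x) (hx : x ∈ V) (k : Fin n) :
      fderiv ℂ H x (Pi.single k 1) = (ω k).eval x * H x := by
    have h1 := (hg.hasLogGradAt hq hω hx).1 k
    rw [RatFun.eval, div_mul_eq_mul_div, eq_div_iff h1, ← hH.eq x (hVU hx) k, mul_comm]
  have hquot (x) (hx : x ∈ V) : AnalyticAt ℂ (fun y => H y / g y) x :=
    (hH.analytic x (hVU hx)).div (hg.hasLogGradAt hq hω hx).2.2.1 (hg.hasLogGradAt hq hω hx).2.1
  have hfd (x) (hx : x ∈ V) : fderiv ℂ (fun y => H y / g y) x = 0 := by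
    obtain ⟨h1, h2, h3⟩ := hg.hasLogGradAt hq hω hx
    have e : (fun y => H y / g y * g y) =ᶠ[𝓝 x] H := by
      filter_upwards [hg.1.mem_nhds hx] with y hy
      exact div_mul_cancel₀ _ (hg.hasLogGradAt hq hω hy).2.1
    have hk (k : Fin n) : fderiv ℂ (fun y => H y / g y) x (Pi.single k 1) = 0 := by
      have e' := congrArg (fun L : (Fin n → ℂ) →L[ℂ] ℂ => L (Pi.single k 1)) e.fderiv_eq
      rw [fderiv_fun_mul (hquot x hx).differentiableAt h3.1.differentiableAt, hH' x hx] at e'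
      simp only [add_apply, smul_apply, smul_eq_mul, h3.2] at e'
      have h4 : H x / g x * ((ω k).eval x * g x) = (ω k).eval x * H x := by field_simp
      rw [h4, add_eq_left] at e'
      exact (mul_eq_zero.1 e').resolve_left h2
    ext v
    rw [zero_apply, pi_eq_sum_univ' v, map_sum]
    refine Finset.sum_eq_zero fun k _ => ?_
    rw [map_smul, hk, smul_zero]
  obtain ⟨x0, hx0⟩ := hg.2.1.nonempty
  have hconst : ∀ x ∈ V, H x / g x = H x0 / g x0 := fun x hx =>
    hg.1.is_const_of_fderiv_eq_zero hg.2.1.isPreconnected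
      (fun y hy => (hquot y hy).differentiableAt.differentiableWithinAt)
      (fun y hy => hfd y hy) hx hx0
  have hHc : ∀ x ∈ V, H x = H x0 / g x0 * g x := fun x hx => by
    rw [← hconst x hx, div_mul_cancel₀ _ (hg.hasLogGradAt hq hω hx).2.1]
  refine ⟨_, fun hc => ?_, hHc⟩
  -- If the constant were zero, `H` would vanish near `x0`, hence on all of the connected set `U` by
  -- the identity theorem.
  obtain ⟨x1, hx1, hne⟩ := hH.ne_zero
  refine hne (hH.analytic.eqOn_zero_of_preconnected_of_eventuallyEq_zero
    hH.isConnected.isPreconnected (hVU hx0) ?_ hx1)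
  filter_upwards [hg.1.mem_nhds hx0] with y hy
  rw [hHc y hy, hc, zero_mul]; rfl

end HyperexpData

/-- Where `H ≠ 0` and `ω` has no pole, the symmetry of the second derivatives of `H` gives the
equality of the values of `∂_i ω_j` and `∂_j ω_i`. If their difference were a nonzero rational
function, it would be nonzero at some such point, since a nonzero polynomial cannot vanish on a
nonempty open set. -/
theorem HasLogDifferential.closed {n : ℕ} {U : Set (Fin n → ℂ)} {H : (Fin n → ℂ) → ℂ}
    {ω : RatForm n} (h : HasLogDifferential U H ω) : ω.Closed := by
  intro i j
  by_contra hne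
  set f := RatFun.pd i (ω j) - RatFun.pd j (ω i) with hf
  have hf0 : f ≠ 0 := sub_ne_zero.2 hne
  have hnum : f.num ≠ 0 := by
    intro h0
    apply hf0
    rw [← RatFun.num_div_den f, h0, map_zero, zero_div]
  have hWopen : IsOpen (U ∩ H ⁻¹' {0}ᶜ) :=
    h.analytic.continuousOn.isOpen_inter_preimage h.isOpen isOpen_compl_singleton
  obtain ⟨x0, hx0, hx0'⟩ := h.ne_zero
  obtain ⟨x, ⟨hxU, hxH⟩, hx⟩ := RatFun.exists_eval_ne_zero
    (mul_ne_zero (mul_ne_zero hnum (RatFun.den_ne_zero f))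
      (mul_ne_zero (RatFun.den_ne_zero (ω i)) (RatFun.den_ne_zero (ω j))))
    hWopen ⟨x0, hx0, hx0'⟩
  rw [map_mul, map_mul, map_mul, mul_ne_zero_iff, mul_ne_zero_iff, mul_ne_zero_iff] at hx
  obtain ⟨⟨h1, h2⟩, h3, h4⟩ := hx
  have hd (k : Fin n) (y) (hy : y ∈ U) (hk : (ω k).DefinedAt y) :
      fderiv ℂ H y (Pi.single k 1) = (ω k).eval y * H y := by
    rw [RatFun.eval, div_mul_eq_mul_div, eq_div_iff hk, ← h.eq y hy k, mul_comm]
  have hsecond (k l : Fin n) (hk : (ω k).DefinedAt x) (hl : (ω l).DefinedAt x) :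
      fderiv ℂ (fderiv ℂ H) x (Pi.single l 1) (Pi.single k 1) =
        (RatFun.pd l (ω k)).eval x * H x + (ω k).eval x * ((ω l).eval x * H x) := by
    have e : (fun y => fderiv ℂ H y (Pi.single k 1)) =ᶠ[𝓝 x] fun y => (ω k).eval y * H y := by
      filter_upwards [h.isOpen.mem_nhds hxU, (RatFun.isOpen_definedAt _).mem_nhds hk] with y hy hky
      exact hd k y hy hky
    have e' := congrArg (fun L : (Fin n → ℂ) →L[ℂ] ℂ => L (Pi.single l 1)) e.fderiv_eq
    rw [fderiv_clm_apply (h.analytic x hxU).fderiv.differentiableAt (differentiableAt_const _),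
      fderiv_fun_mul hk.analyticAt.differentiableAt (h.analytic x hxU).differentiableAt] at e'
    simp only [add_apply, smul_apply, smul_eq_mul, hd l x hxU hl, ← (hk.pd l).2] at e'
    simp at e'
    rw [e']
    ring
  have hsymm : IsSymmSndFDerivAt ℂ H x :=
    (h.analytic x hxU).contDiffAt.isSymmSndFDerivAt (n := 2) (by simp)
  have key := hsymm.eq (Pi.single j 1) (Pi.single i 1)
  rw [hsecond i j h3 h4, hsecond j i h4 h3] at key
  have heq : (RatFun.pd j (ω i)).eval x = (RatFun.pd i (ω j)).eval x :=
    mul_right_cancel₀ (b := H x) hxH (by linear_combination key)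
  have hfd : f.DefinedAt x := h2
  have hadd := (hfd.add (RatFun.DefinedAt.pd h3 j).1).2
  rw [hf, sub_add_cancel, ← hf, heq, right_eq_add] at hadd
  exact (RatFun.UnitAt.eval_ne_zero (f := f) ⟨h1, h2⟩) hadd

end

/-! ### The invariant of the algorithm and its termination. -/

namespace RationalIntegration

open Polynomial RatFun

variable {n : ℕ} {K : Subfield ℂ} {i : Fin n} {ω₀ : RatForm n}

/-- The properties of the working variables that hold throughout a run on the input `ω₀`. -/
structure IsCoherent (K : Subfield ℂ) (ω₀ : RatForm n) (s : State n) : Prop where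
  F0_mem : s.F0 ∈ ratField K Set.univ
  A_mem : ∀ a ∈ s.A, a.1 ∈ ratField K Set.univ ∧ a.1 ≠ 0
  Res_mem : ∀ z ∈ s.Res, z.1 ∈ tracelessSubmodule ∧ z.2 ≠ 0 ∧
    z.2 ∈ ratField (IntermediateField.adjoin K {z.1}).toSubfield Set.univ
  form_eq : ω₀ = s.ω + RatForm.d s.F0 +
    (s.A.map fun a => const n (a.2 : ℂ) • RatForm.dlog a.1).sum +
    (s.Res.map fun z => const n z.1 • RatForm.dlog z.2).sum

/-- The invariant of the algorithm on the input `ω₀`. -/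
def Invariant (K : Subfield ℂ) (ω₀ : RatForm n) : Config K n → Prop
  | .outer k s => IsCoherent K ω₀ s ∧ k ≤ n ∧ s.ω.Closed ∧
      (∀ j, s.ω j ∈ ratField K {j : Fin n | (j : ℕ) < k}) ∧ ∀ j : Fin n, k ≤ j → s.ω j = 0
  | .inner i P Q todo s => IsCoherent K ω₀ s ∧ Q.Monic ∧ Squarefree Q ∧ P.degree < Q.degree ∧
      (∀ q ∈ todo, q.Monic ∧ Irreducible q) ∧ (∃ c, c * todo.prod = Q) ∧
      ∃ (η : RatForm n) (W : _), η.Closed ∧ (∀ j, η j ∈ ratField K {j | j ≤ i}) ∧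
        (∀ j, i < j → η j = 0) ∧ η i = atVar K i P / atVar K i Q ∧ IsResidueFactors P Q W ∧
        (W.map Prod.snd).prod * todo.prod.map (topIncl K i) = Q.map (topIncl K i) ∧
        s.ω = η - (W.map fun z => const n z.1 • RatForm.dlog (evalTop i z.2)).sum
  | .done r => r.IsRepresentation K ω₀

theorem setOf_le (i : Fin n) : {j : Fin n | j ≤ i} = {j : Fin n | (j : ℕ) < i + 1} := by
  ext j
  exact Fin.le_def.trans Nat.lt_succ_iff.symm

/-- The form `η` of the inner invariant is fixed here, as the remaining form right after the Hermite
reduction; it does not change until the next variable. `W` collects the residues and gcds of the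
factors already treated, so it starts empty. -/
theorem Invariant.hermite {s : State n} {P Q : (BaseField K i)[X]} {R : RatFun n}
    {Qs : List (BaseField K i)[X]} (h : Invariant K ω₀ (.outer (i + 1) s))
    (hR : IsHermiteReduction K i (s.ω i) P Q R) (hQs : IsFactorization K i Q Qs) :
    Invariant K ω₀
      (.inner i P Q Qs { s with ω := s.ω - RatForm.d R, F0 := s.F0 + R }) := by
  obtain ⟨hs, -, hcl, hmem, h0⟩ := h
  obtain ⟨hQ, hsq, hdeg, hRm, hf⟩ := hR
  refine ⟨⟨add_mem hs.F0_mem (ratField_mono le_rfl (Set.subset_univ _) hRm), hs.A_mem, hs.Res_mem,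
    ?_⟩, hQ, hsq, hdeg, hQs.1, ⟨1, by rw [one_mul, hQs.2]⟩, s.ω - RatForm.d R, [],
    hcl.sub (RatForm.closed_d R), fun j => ?_, fun j hj => ?_, ?_, by simp [IsResidueFactors],
    by rw [hQs.2]; simp, by simp⟩
  · have : RatForm.d (s.F0 + R) = RatForm.d s.F0 + RatForm.d R := funext fun j => pd_add j _ _
    simp only
    rw [this]
    conv_lhs => rw [hs.form_eq]
    abel
  · refine sub_mem ?_ (pd_mem j hRm)
    rw [setOf_le]; exact hmem j
  · rw [Pi.sub_apply, h0 j hj, RatForm.d, pd_eq_zero_of_notMem (s := {j | j ≤ i})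
      (by simpa using hj) hRm, sub_zero]
  · rw [Pi.sub_apply, hf, RatForm.d, add_sub_cancel_right]

/-- With no factor left, the gcds in `W` multiply to `Q` and the elimination of `x_i` applies. -/
theorem Invariant.next {s : State n} {P Q : (BaseField K i)[X]}
    (h : Invariant K ω₀ (.inner i P Q [] s)) : Invariant K ω₀ (.outer i s) := by
  obtain ⟨hs, hQ, hsq, hdeg, -, -, η, W, hη, hηm, hη0, hηi, hW, hprod, hω⟩ := h
  rw [List.prod_nil, Polynomial.map_one, mul_one] at hprod
  obtain ⟨h1, h2, h3⟩ := sub_residueFactors_mem hQ hsq hdeg hW hprod hη hηm hη0 hηi hω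
  exact ⟨hs, i.2.le, h1, h2, fun j hj => h3 j (not_lt.2 hj)⟩

theorem Invariant.exists_constantPart {s : State n} {P Q q : (BaseField K i)[X]}
    {todo : List (BaseField K i)[X]} (h : Invariant K ω₀ (.inner i P Q (q :: todo) s)) :
    q.Monic ∧ Irreducible q ∧ IsCoprime q (derivative Q) ∧
    ∃ m, (∀ _ : Fact (Irreducible q), IsResiduePolynomial K i P Q q m) ∧
      m.Monic ∧ Irreducible m ∧ ∃ k ≥ 1, ∀ S,
      IsConstantPart K i (residueResultant K i P Q q) S ↔ S = m ^ k := by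
  obtain ⟨hs, hQ, hsq, hdeg, hirr, ⟨c, rfl⟩, η, W, hη, hηm, hη0, hηi, hW, hprod, hω⟩ := h
  obtain ⟨hqm, hqi⟩ := hirr q List.mem_cons_self
  have : Fact (Irreducible q) := ⟨hqi⟩
  have e : c * (q :: todo).prod = q * (c * todo.prod) := by rw [List.prod_cons]; ring
  rw [e] at hsq hηi ⊢
  have hndvd : ¬ q ∣ c * todo.prod := fun hd =>
    hqi.not_isUnit (hsq q (mul_dvd_mul_left q hd))
  obtain ⟨m, hm⟩ := exists_isResiduePolynomial hqm hndvd hη hηm hηi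
  have hcop := isCoprime_derivative hsq
  exact ⟨hqm, hqi, hcop, m, fun _ => hm, hm.monic, hm.irreducible_base,
    hm.isConstantPart_iff hqm hcop⟩

theorem aeval_eq_zero_of_isRoot_pow {m : K[X]} {k : ℕ} {μ : ℂ}
    (h : ((m ^ k).map K.subtype).IsRoot μ) : aeval μ m = 0 := by
  rw [IsRoot.def, Polynomial.map_pow, eval_pow] at h
  rw [aeval_def, ← eval_map]
  exact eq_zero_of_pow_eq_zero h

theorem Invariant.factor [NumberField K] {s : State n} {P Q q : (BaseField K i)[X]}
    {todo : List (BaseField K i)[X]} {S : K[X]} {r : ℚ} {Λ : List (ℂ × RatFun n)}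
    (h : Invariant K ω₀ (.inner i P Q (q :: todo) s))
    (hS : IsConstantPart K i (residueResultant K i P Q q) S) (hr : IsShift K S r)
    (hΛ : IsResidueList K i P Q q S Λ) :
    Invariant K ω₀ (.inner i P Q todo
      { s with
        ω := s.ω - (Λ.map fun z => const n z.1 • RatForm.dlog z.2).sum
        A := s.A ++ [(atVar K i q, r)]
        Res := s.Res ++ Λ.map fun z => (z.1 - (r : ℂ), z.2) }) := by
  obtain ⟨hqm, hqi, hcop, m, hm, hmm, hmi, k, hk, hkS⟩ := h.exists_constantPart
  obtain ⟨hs, hQ, hsq, hdeg, hirr, ⟨c, hc⟩, η, W, hη, hηm, hη0, hηi, hW, hprod, hω⟩ := h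
  have : Fact (Irreducible q) := ⟨hqi⟩
  obtain rfl := (hkS S).1 hS
  have hqne : atVar K i q ≠ 0 := by
    rw [atVar_eq]; exact evalVar_ne_zero (self_notMem i) hqm.ne_zero
  have hroot (z) (hz : z ∈ Λ) : aeval z.1 m = 0 :=
    aeval_eq_zero_of_isRoot_pow ((hΛ.2.1 z.1).1 (List.mem_map_of_mem hz))
  have htr (z) (hz : z ∈ Λ) : r = meanTrace z.1 :=
    (isShift_pow_iff K hmm hmi hk (hroot z hz) r).1 hr
  obtain ⟨W', hΛW, hW', hprod'⟩ := (hm this).exists_residueFactors hqm hcop hk hΛ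
  have hW0 (z) (hz : z ∈ W') : evalTop i z.2 ≠ 0 := evalTop_ne_zero (hW' z hz).1.ne_zero
  -- The gcds multiply to `q`. Hence replacing `λ` by `λ - r` in `∑ λ dG_λ / G_λ` changes the sum by
  -- `r dq / q`, which is what the new factor of `A` contributes.
  have hdlog : (Λ.map fun z => RatForm.dlog z.2).sum = RatForm.dlog (atVar K i q) := by
    rw [← evalTop_map, ← hprod', map_list_prod, List.map_map, RatForm.dlog_list_prod, hΛW,
      List.map_map, List.map_map]
    · rfl
    · intro f hf
      obtain ⟨z, hz, rfl⟩ := List.mem_map.1 hf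
      exact hW0 z hz
  refine ⟨⟨hs.F0_mem, fun a ha => ?_, fun z hz => ?_, ?_⟩, hQ, hsq, hdeg,
    fun p hp => hirr p (List.mem_cons_of_mem _ hp),
    ⟨c * q, by rw [mul_assoc, ← List.prod_cons, hc]⟩, η, W ++ W', hη, hηm, hη0, hηi,
    fun z hz => (List.mem_append.1 hz).elim (hW z) (hW' z), ?_, ?_⟩
  · rcases List.mem_append.1 ha with ha | ha
    · exact hs.A_mem a ha
    · obtain rfl := List.mem_singleton.1 ha
      refine ⟨?_, hqne⟩
      rw [atVar_eq]
      exact ratField_mono le_rfl (Set.subset_univ _) (evalVar_mem q)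
  · rcases List.mem_append.1 hz with hz | hz
    · exact hs.Res_mem z hz
    · obtain ⟨w, hw, rfl⟩ := List.mem_map.1 hz
      -- `r` is rational, so `λ` lies in `K(λ - r)` and the gcd, defined over `K(λ)`, has its
      -- constants in `K(λ - r)`.
      have hmem : w.1 ∈ (IntermediateField.adjoin K {w.1 - (r : ℂ)}).toSubfield := by
        have h1 : w.1 - (r : ℂ) ∈ (IntermediateField.adjoin K {w.1 - (r : ℂ)}).toSubfield :=
          IntermediateField.mem_adjoin_simple_self K _
        have := add_mem h1 (SubfieldClass.ratCast_mem
          (IntermediateField.adjoin K {w.1 - (r : ℂ)}).toSubfield r)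
        rwa [sub_add_cancel] at this
      have hK : K ≤ (IntermediateField.adjoin K {w.1 - (r : ℂ)}).toSubfield := fun x hx =>
        (IntermediateField.adjoin K {w.1 - (r : ℂ)}).algebraMap_mem ⟨x, hx⟩
      obtain ⟨g, hg, hG⟩ := (isResidueGcd_iff hK hqi.ne_zero hmem _).1 (hΛ.2.2 w hw)
      refine ⟨?_, ?_, ?_⟩
      · rw [htr w hw]
        exact sub_meanTrace_mem (isAlgebraic_of_root K hmi.ne_zero (hroot w hw))
      · simp only [hG]
        exact evalVar_ne_zero (self_notMem i) hg.1.ne_zero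
      · simp only [hG]
        exact ratField_mono le_rfl (Set.subset_univ _) (evalVar_mem g)
  · conv_lhs => rw [hs.form_eq]
    simp only [List.map_append, List.sum_append, List.map_cons, List.map_nil, List.sum_cons,
      List.sum_nil, List.map_map, add_zero]
    have key : (List.map ((fun z : ℂ × RatFun n => const n z.1 • RatForm.dlog z.2) ∘
        fun z => (z.1 - (r : ℂ), z.2)) Λ).sum =
        (Λ.map fun z => const n z.1 • RatForm.dlog z.2).sum -
          const n (r : ℂ) • RatForm.dlog (atVar K i q) := by
      rw [← hdlog, List.smul_sum, List.map_map, eq_sub_iff_add_eq, ← List.sum_map_add]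
      congr 1
      refine List.map_congr_left fun z _ => ?_
      simp only [Function.comp, map_sub, sub_smul, sub_add_cancel]
    rw [key]
    abel
  · rw [List.map_append, List.prod_append, hprod', mul_assoc, ← Polynomial.map_mul,
      ← List.prod_cons, hprod]
  · simp only
    rw [hω, hΛW, List.map_append, List.sum_append, List.map_map, sub_sub]
    rfl

theorem smul_dlog_prod_zpow (q : ℕ) (hq : q ≠ 0) (A : List (RatFun n × ℚ)) (hA : ∀ a ∈ A, a.1 ≠ 0)
    (hm : ∀ a ∈ A, ∃ m : ℤ, (m : ℚ) = q * a.2) :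
    const n (1 / (q : ℂ)) • RatForm.dlog (A.map fun a => a.1 ^ (((q : ℚ) * a.2).num)).prod =
      (A.map fun a => const n (a.2 : ℂ) • RatForm.dlog a.1).sum := by
  have hq' : (q : ℂ) ≠ 0 := by exact_mod_cast hq
  induction A with
  | nil => simp [RatForm.dlog_one]
  | cons a A ih =>
    have h0 : ∀ f ∈ A.map fun a => a.1 ^ (((q : ℚ) * a.2).num), f ≠ 0 := by
      intro f hf
      obtain ⟨b, hb, rfl⟩ := List.mem_map.1 hf
      exact zpow_ne_zero _ (hA b (List.mem_cons_of_mem _ hb))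
    obtain ⟨m, hm'⟩ := hm a List.mem_cons_self
    have ha := hA a List.mem_cons_self
    rw [List.map_cons, List.prod_cons, RatForm.dlog_mul (zpow_ne_zero _ ha)
      (List.prod_ne_zero fun h => h0 0 h rfl), smul_add,
      ih (fun b hb => hA b (List.mem_cons_of_mem _ hb))
        fun b hb => hm b (List.mem_cons_of_mem _ hb), List.map_cons, List.sum_cons,
      RatForm.dlog_zpow ha, smul_smul, ← map_mul, ← hm', Rat.num_intCast]
    have : (m : ℂ) = q * (a.2 : ℂ) := by exact_mod_cast congrArg (Rat.cast (K := ℂ)) hm'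
    rw [this, one_div, inv_mul_cancel_left₀ hq']

theorem sum_smul_dlog_eq {ι κ : Type*} [Fintype ι] [Fintype κ] (z : ι → ℂ) (G : ι → RatFun n)
    (hG : ∀ k, G k ≠ 0) (lam : κ → ℂ) (F : κ → RatFun n) (M : ι → κ → ℤ)
    (hM : ∀ k, z k = ∑ j, (M k j : ℂ) * lam j) (hF : ∀ j, F j = ∏ k, G k ^ (M k j)) :
    ∑ k, const n (z k) • RatForm.dlog (G k) = ∑ j, const n (lam j) • RatForm.dlog (F j) := by
  have hj (j) : RatForm.dlog (F j) = ∑ k, const n (M k j : ℂ) • RatForm.dlog (G k) := by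
    rw [hF, RatForm.dlog_prod _ fun k _ => zpow_ne_zero _ (hG k)]
    exact Finset.sum_congr rfl fun k _ => RatForm.dlog_zpow (hG k) _
  simp only [hj, Finset.smul_sum, smul_smul, ← map_mul]
  rw [Finset.sum_comm]
  refine Finset.sum_congr rfl fun k _ => ?_
  rw [hM, map_sum, Finset.sum_smul]
  simp only [mul_comm]

theorem list_sum_smul_dlog_eq {p : ℕ} (L : List (ℂ × RatFun n)) (hL : ∀ z ∈ L, z.2 ≠ 0)
    (lam : Fin p → ℂ) (F : Fin p → RatFun n) (M : Fin L.length → Fin p → ℤ)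
    (hM : ∀ k, (L.get k).1 = ∑ j, (M k j : ℂ) * lam j) (hF : ∀ j, F j = ∏ k, (L.get k).2 ^ (M k j)) :
    (L.map fun z => const n z.1 • RatForm.dlog z.2).sum =
      ∑ j, const n (lam j) • RatForm.dlog (F j) := by
  rw [← sum_smul_dlog_eq (fun k => (L.get k).1) (fun k => (L.get k).2)
    (fun k => hL _ (List.get_mem _ _)) lam F M hM hF]
  conv_lhs => rw [← List.ofFn_get L, List.map_ofFn, List.sum_ofFn]
  rfl

theorem IsOutput.form_eq {s : State n} {r : HyperexpData n}
    (hs : IsCoherent K ω₀ s) (hω : s.ω = 0) (h : IsOutput s r) :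
    ω₀ = RatForm.d r.F0 + (const n (1 / (r.q : ℂ))) • RatForm.dlog r.A +
      ∑ j, const n (r.lam j) • RatForm.dlog (r.F j) := by
  obtain ⟨M, hM, hF⟩ := h.factors
  rw [hs.form_eq, hω, zero_add, h.F0_eq, h.A_eq,
    smul_dlog_prod_zpow r.q h.q_least.1.1.ne' s.A (fun a ha => (hs.A_mem a ha).2) h.q_least.1.2,
    list_sum_smul_dlog_eq s.Res (fun z hz => (hs.Res_mem z hz).2.1) r.lam r.F M hM hF]

theorem IsOutput.isRepresentation {s : State n} {r : HyperexpData n}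
    (hs : IsCoherent K ω₀ s) (hω : s.ω = 0) (h : IsOutput s r) : r.IsRepresentation K ω₀ := by
  have hq : 0 < r.q := h.q_least.1.1
  obtain ⟨M, hM, hF⟩ := h.factors
  -- Each `λ_j` is an integer combination of entries of `Res`, and traceless numbers form a vector
  -- space.
  have hlam (j) : r.lam j ∈ tracelessSubmodule := by
    have h1 : r.lam j ∈ Submodule.span ℤ {z : ℂ | z ∈ s.Res.map Prod.fst} := by
      rw [← h.basis_span]; exact Submodule.subset_span ⟨j, rfl⟩
    have h2 : Submodule.span ℤ {z : ℂ | z ∈ s.Res.map Prod.fst} ≤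
        tracelessSubmodule.restrictScalars ℤ := by
      refine Submodule.span_le.2 fun z hz => ?_
      obtain ⟨w, hw, rfl⟩ := List.mem_map.1 hz
      exact (hs.Res_mem w hw).1
    exact h2 h1
  have hA0 : ∀ f ∈ s.A.map fun a => a.1 ^ (((r.q : ℚ) * a.2).num), f ≠ 0 := by
    intro f hf
    obtain ⟨a, ha, rfl⟩ := List.mem_map.1 hf
    exact zpow_ne_zero _ (hs.A_mem a ha).2
  have hform := h.form_eq hs hω
  refine ⟨h.F0_eq ▸ hs.F0_mem, ?_, ?_, hq, ?_, fun j => ?_, fun j => ?_, fun j => ?_, ?_, hform,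
    fun V g hg => hg.hasLogDifferential hq hform⟩
  · rw [h.A_eq]
    refine list_prod_mem fun f hf => ?_
    obtain ⟨a, ha, rfl⟩ := List.mem_map.1 hf
    exact zpow_mem (hs.A_mem a ha).1 _
  · rw [h.A_eq]
    exact List.prod_ne_zero fun h0 => hA0 0 h0 rfl
  · refine IntermediateField.finiteDimensional_adjoin fun x hx => ?_
    obtain ⟨j, rfl⟩ := hx
    exact ((mem_tracelessSubmodule.1 (hlam j)).1.isIntegral).tower_top
  -- Conversely each first entry of `Res` is an integer combination of the `λ_j`, so the constants
  -- of its gcd lie in `K(λ₁, …, λ_p)`.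
  · rw [hF]
    refine prod_mem fun k _ => zpow_mem ?_ _
    refine ratField_mono ?_ le_rfl (hs.Res_mem _ (List.get_mem _ _)).2.2
    change IntermediateField.adjoin K {(s.Res.get k).1} ≤ r.constField K
    rw [IntermediateField.adjoin_simple_le_iff, hM]
    exact sum_mem fun j _ => mul_mem (intCast_mem _ _)
      (IntermediateField.subset_adjoin K _ ⟨j, rfl⟩)
  · rw [hF]
    exact Finset.prod_ne_zero_iff.2 fun k _ =>
      zpow_ne_zero _ (hs.Res_mem _ (List.get_mem _ _)).2.1
  · exact (mem_tracelessSubmodule.1 (hlam j)).2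
  · exact (LinearIndependent.iff_fractionRing ℤ ℚ).1 h.basis_indep

theorem Invariant.step [NumberField K] {c c' : Config K n} (h : Invariant K ω₀ c)
    (hc : Step K c c') : Invariant K ω₀ c' := by
  cases hc with
  | hermite i s P Q R Qs hR hQs => exact h.hermite hR hQs
  | factor i s P Q q todo S r Λ hS hr hΛ => exact h.factor hS hr hΛ
  | next i s P Q => exact h.next
  | finish s r hr => exact hr.isRepresentation h.1 (funext fun j => h.2.2.2.2 j (Nat.zero_le _))

theorem invariant_start {ω : RatForm n} (hω : ω.IsOver K) (hcl : ω.Closed) :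
    Invariant K ω (start K ω) := by
  refine ⟨⟨zero_mem _, by simp, by simp, ?_⟩, le_rfl, hcl, fun j => ?_, fun j hj => ?_⟩
  · have : RatForm.d (0 : RatFun n) = 0 := funext fun j => pd_zero j
    simp [this]
  · exact ratField_mono le_rfl (fun j _ => j.2) (hω j)
  · exact absurd j.2 (not_lt.2 hj)

theorem Reaches.invariant [NumberField K] {ω : RatForm n} (hω : ω.IsOver K) (hcl : ω.Closed)
    {c : Config K n} (hc : Reaches K ω c) : Invariant K ω c := by
  induction hc with
  | refl => exact invariant_start hω hcl
  | tail _ h ih => exact ih.step h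

/-- A bound for the progress of the algorithm. -/
def Config.measure : Config K n → ℕ ×ₗ ℕ
  | .outer k _ => toLex (k + 1, 0)
  | .inner i _ _ todo _ => toLex (i + 1, todo.length + 1)
  | .done _ => toLex (0, 0)

/-- Lexicographic descent: a Hermite step lowers the first entry from `i + 2` to `i + 1`, a factor
step shortens the list, and leaving the inner loop lowers the second entry from `1` to `0`, which is
why the list length is increased by one. -/
theorem Step.measure_lt [NumberField K] {c c' : Config K n} (h : Step K c c') :
    c'.measure < c.measure := by
  cases h <;> simp [Config.measure, Prod.Lex.toLex_lt_toLex]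

theorem acc_step [NumberField K] (c : Config K n) : Acc (fun c' c => Step K c c') c :=
  (Subrelation.wf (fun h => h.measure_lt)
    (InvImage.wf Config.measure (wellFounded_lt (α := ℕ ×ₗ ℕ)))).apply c

end RationalIntegration

/-! ### The algorithm never gets stuck. -/

namespace RationalIntegration

open Polynomial RatFun

variable {n : ℕ} {K : Subfield ℂ} {i : Fin n} {ω₀ : RatForm n}

theorem exists_isOutput (s : State n) : ∃ r, IsOutput s r := by
  have hq : {q : ℕ | 0 < q ∧ ∀ a ∈ s.A, ∃ m : ℤ, (m : ℚ) = q * a.2}.Nonempty := by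
    refine ⟨(s.A.map fun a => a.2.den).prod, List.prod_pos fun d hd => ?_, fun a ha => ?_⟩
    · obtain ⟨a, -, rfl⟩ := List.mem_map.1 hd
      exact a.2.pos
    · obtain ⟨c, hc⟩ := List.dvd_prod (List.mem_map_of_mem (f := fun a : RatFun n × ℚ => a.2.den) ha)
      refine ⟨c * a.2.num, ?_⟩
      rw [hc]
      push_cast
      rw [mul_right_comm, Rat.den_mul_eq_num, mul_comm]
  set N := Submodule.span ℤ {z : ℂ | z ∈ s.Res.map Prod.fst} with hN
  -- A finitely generated torsion-free `ℤ`-module is free, which provides the basis `λ`.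
  have hfin : Module.Finite ℤ N := Module.Finite.span_of_finite ℤ (List.finite_toSet _)
  obtain ⟨p, ⟨b⟩⟩ : ∃ p, Nonempty (Module.Basis (Fin p) ℤ N) := ⟨_, ⟨Module.finBasis ℤ N⟩⟩
  have hmem (k : Fin s.Res.length) : (s.Res.get k).1 ∈ N :=
    Submodule.subset_span (List.mem_map_of_mem (List.get_mem s.Res k))
  refine ⟨⟨s.F0, (s.A.map fun a => a.1 ^ (((sInf {q : ℕ | 0 < q ∧ ∀ a ∈ s.A,
    ∃ m : ℤ, (m : ℚ) = q * a.2} : ℕ) : ℚ) * a.2).num).prod, sInf {q : ℕ | 0 < q ∧ ∀ a ∈ s.A, ∃ m : ℤ, (m : ℚ) = q * a.2}, p,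
    fun j => b j, fun j => ∏ k, (s.Res.get k).2 ^ (b.repr ⟨_, hmem k⟩ j)⟩, rfl,
    ⟨Nat.sInf_mem hq, fun _ h => Nat.sInf_le h⟩, rfl, ?_, ?_,
    ⟨fun k j => b.repr ⟨_, hmem k⟩ j, fun k => ?_, fun j => rfl⟩⟩
  · exact b.linearIndependent.map' N.subtype N.ker_subtype
  · have h1 := congrArg (Submodule.map N.subtype) b.span_eq
    rw [Submodule.map_span, Submodule.map_top, Submodule.range_subtype, ← Set.range_comp] at h1
    exact h1
  · have := congrArg N.subtype (b.sum_repr ⟨_, hmem k⟩)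
    rw [map_sum] at this
    refine this.symm.trans (Finset.sum_congr rfl fun j _ => ?_)
    rw [map_zsmul, zsmul_eq_mul]
    rfl

theorem exists_hermite_of_leibniz {F E : Type*} [Field F] [CharZero F] [Field E] (φ : F[X] →+* E)
    (hφ : Function.Injective φ) (δ : E → E) (hadd : ∀ a b, δ (a + b) = δ a + δ b)
    (hmul : ∀ a b, δ (a * b) = a * δ b + b * δ a) (hD : ∀ p, δ (φ p) = φ (derivative p))
    (s t : F[X]) (ht : t ≠ 0) :
    ∃ P Q a b : F[X], Q.Monic ∧ Squarefree Q ∧ P.degree < Q.degree ∧ b ≠ 0 ∧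
      φ s / φ t = φ P / φ Q + δ (φ a / φ b) :=
  exists_hermite φ hφ
    (Derivation.mk' (AddMonoidHom.toIntLinearMap (AddMonoidHom.mk' δ hadd)) hmul) hD s t ht

theorem exists_isHermiteReduction {f : RatFun n} (hf : f ∈ ratField K {j | j ≤ i}) :
    ∃ P Q R, IsHermiteReduction K i f P Q R := by
  have hi := self_notMem i
  rw [← insert_lt] at hf
  obtain ⟨a, b, hb, rfl⟩ := exists_evalVar_div hi hf
  obtain ⟨P, Q, c, d, hQ, hsq, hdeg, hd, h⟩ := exists_hermite_of_leibniz
    (evalVar K {j | j < i} i) (evalVar_injective hi) (pd i) (pd_add i)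
    (fun f g => by rw [pd_mul]) (fun p => pd_evalVar_self hi p) a b hb
  refine ⟨P, Q, _, hQ, hsq, hdeg, ?_, h⟩
  rw [← insert_lt]
  exact div_mem (evalVar_mem c) (evalVar_mem d)

theorem exists_isFactorization {Q : (BaseField K i)[X]} (hQ : Q.Monic) :
    ∃ Qs, IsFactorization K i Q Qs := by
  classical
  refine ⟨(UniqueFactorizationMonoid.normalizedFactors Q).toList, fun q hq => ?_, ?_⟩
  · rw [Multiset.mem_toList] at hq
    have hqi := UniqueFactorizationMonoid.irreducible_of_normalized_factor q hq
    refine ⟨?_, hqi⟩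
    rw [← UniqueFactorizationMonoid.normalize_normalized_factor q hq]
    exact monic_normalize hqi.ne_zero
  · rw [Multiset.prod_toList, UniqueFactorizationMonoid.prod_normalizedFactors_eq hQ.ne_zero,
      hQ.normalize_eq_self]

theorem exists_isResidueList {P Q q : (BaseField K i)[X]} (hq : q ≠ 0) {S : K[X]} (hS : S ≠ 0) :
    ∃ Λ, IsResidueList K i P Q q S Λ := by
  classical
  choose g hg using fun μ : ℂ => exists_isMonicGcd (q := q.map (BaseField K i).subtype)
    ((Polynomial.map_ne_zero_iff (BaseField K i).subtype.injective).2 hq)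
    (P.map (BaseField K i).subtype -
        C (RatFun.const n μ) * (derivative Q).map (BaseField K i).subtype)
  have hS' : S.map K.subtype ≠ 0 := (Polynomial.map_ne_zero_iff K.subtype.injective).2 hS
  have hfst : (((S.map K.subtype).roots.toFinset.toList).map
      fun μ => (μ, (g μ).eval (var i))).map Prod.fst = (S.map K.subtype).roots.toFinset.toList := by
    rw [List.map_map]
    exact List.map_id _
  refine ⟨((S.map K.subtype).roots.toFinset.toList).map fun μ => (μ, (g μ).eval (var i)),
    ?_, fun μ => ?_, fun z hz => ?_⟩
  · rw [hfst]; exact Finset.nodup_toList _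
  · rw [hfst, Finset.mem_toList, Multiset.mem_toFinset, mem_roots hS']
  · obtain ⟨μ, -, rfl⟩ := List.mem_map.1 hz
    exact ⟨g μ, (hg μ).1, (hg μ).2, rfl⟩

theorem Invariant.progress [NumberField K] {c : Config K n} (h : Invariant K ω₀ c) :
    (∃ r, c = .done r) ∨ ∃ c', Step K c c' := by
  match c, h with
  | .done r, _ => exact .inl ⟨r, rfl⟩
  | .outer 0 s, _ =>
    obtain ⟨r, hr⟩ := exists_isOutput s
    exact .inr ⟨_, .finish s r hr⟩
  | .outer (k + 1) s, h =>
    obtain ⟨-, hk, -, hmem, -⟩ := h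
    have hf := hmem ⟨k, hk⟩
    have e : {j : Fin n | j ≤ ⟨k, hk⟩} = {j : Fin n | (j : ℕ) < k + 1} := setOf_le ⟨k, hk⟩
    rw [← e] at hf
    obtain ⟨P, Q, R, hR⟩ := exists_isHermiteReduction hf
    obtain ⟨Qs, hQs⟩ := exists_isFactorization hR.1
    exact .inr ⟨_, .hermite ⟨k, hk⟩ s P Q R Qs hR hQs⟩
  | .inner i P Q [] s, _ => exact .inr ⟨_, .next i s P Q⟩
  | .inner i P Q (q :: todo) s, h =>
    obtain ⟨hqm, hqi, hcop, m, -, hmm, hmi, k, hk, hkS⟩ := h.exists_constantPart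
    -- Any root of `m` serves to compute the shift, as all have the same mean trace.
    obtain ⟨z, hz⟩ := IsAlgClosed.exists_aeval_eq_zero ℂ m
      (by rw [← Polynomial.degree_map m K.subtype, Polynomial.degree_map]
          exact (degree_pos_of_irreducible hmi).ne')
    obtain ⟨Λ, hΛ⟩ := exists_isResidueList (P := P) (Q := Q) hqm.ne_zero (hmm.pow k).ne_zero
    exact .inr ⟨_, .factor i s P Q q todo (m ^ k) (meanTrace z) Λ ((hkS _).2 rfl)
      ((isShift_pow_iff K hmm hmi hk hz _).2 rfl) hΛ⟩

theorem exists_reaches_done [NumberField K] {ω : RatForm n} (hω : ω.IsOver K) (hcl : ω.Closed) :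
    ∃ r, Reaches K ω (.done r) := by
  have key (c : Config K n) (hc : Acc (fun c' c => Step K c c') c) (hr : Reaches K ω c) :
      ∃ r, Reaches K ω (.done r) := by
    induction hc with
    | intro c _ ih =>
      rcases (hr.invariant hω hcl).progress with ⟨r, rfl⟩ | ⟨c', hc'⟩
      · exact ⟨r, hr⟩
      · exact ih c' hc' (hr.tail hc')
  exact key _ (acc_step _) .refl

theorem exists_isRepresentation [NumberField K] {ω : RatForm n} (hω : ω.IsOver K)
    (hcl : ω.Closed) : ∃ r : HyperexpData n, r.IsRepresentation K ω := by
  obtain ⟨r, hr⟩ := exists_reaches_done hω hcl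
  exact ⟨r, hr.invariant hω hcl⟩

end RationalIntegration

/-! ### Existence of representations and correctness of the algorithm. -/

theorem HyperexpData.IsRepresentation.expresses {n : ℕ} {K : Subfield ℂ} {ω : RatForm n}
    {r : HyperexpData n} (h : r.IsRepresentation K ω) {U : Set (Fin n → ℂ)} {H : (Fin n → ℂ) → ℂ}
    (hH : HasLogDifferential U H ω) : r.Expresses U H :=
  HyperexpData.expresses h.q_pos h.form_eq hH

theorem exists_representation_of_isHyperexponential (K : Subfield ℂ) [NumberField K] (n : ℕ)
    (U : Set (Fin n → ℂ)) (H : (Fin n → ℂ) → ℂ) (h : IsHyperexponential K U H) :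
    ∃ (ω : RatForm n) (r : HyperexpData n), ω.IsOver K ∧ HasLogDifferential U H ω ∧
      r.IsRepresentation K ω ∧ r.Expresses U H := by
  obtain ⟨ω, hω, hH⟩ := h
  obtain ⟨r, hr⟩ := RationalIntegration.exists_isRepresentation hω hH.closed
  exact ⟨ω, r, hω, hH, hr, hr.expresses hH⟩

theorem rationalIntegration_correct (K : Subfield ℂ) [NumberField K] (n : ℕ) (ω : RatForm n)
    (hω : ω.IsOver K) (hcl : ω.Closed) :
    Acc (fun c' c => RationalIntegration.Step K c c') (RationalIntegration.start K ω) ∧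
      (∀ c, RationalIntegration.Reaches K ω c →
        (∃ r, c = .done r) ∨ ∃ c', RationalIntegration.Step K c c') ∧
      (∀ r, RationalIntegration.Reaches K ω (.done r) →
        r.IsRepresentation K ω ∧
        ∀ U H, HasLogDifferential U H ω → r.Expresses U H) :=
  ⟨RationalIntegration.acc_step _, fun _ hc => (hc.invariant hω hcl).progress, fun _ hr =>
    have h := hr.invariant hω hcl
    ⟨h, fun _ _ hH => HyperexpData.IsRepresentation.expresses h hH⟩⟩

-- Computable operations on numbers and lists.

attribute [fun_prop] Computable

namespace Computable

variable {α β γ σ : Type*} [Primcodable α] [Primcodable β] [Primcodable γ] [Primcodable σ]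

attribute [fun_prop] Computable.id Computable.const Computable.comp Computable.pair

@[fun_prop] theorem fst_fun {f : α → β × γ} (h : Computable f) : Computable fun a => (f a).1 :=
  Computable.fst.comp h

@[fun_prop] theorem snd_fun {f : α → β × γ} (h : Computable f) : Computable fun a => (f a).2 :=
  Computable.snd.comp h

@[fun_prop] theorem append_fun {f g : α → List β} (hf : Computable f) (hg : Computable g) :
    Computable fun a => f a ++ g a := Computable.list_append.comp hf hg

@[fun_prop] theorem cons_fun {f : α → β} {g : α → List β} (hf : Computable f) (hg : Computable g) :
    Computable fun a => f a :: g a := Computable.list_cons.comp hf hg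

@[fun_prop] theorem add_fun {f g : α → ℕ} (hf : Computable f) (hg : Computable g) :
    Computable fun a => f a + g a := Primrec.nat_add.to_comp.comp hf hg

@[fun_prop] theorem sub_fun {f g : α → ℕ} (hf : Computable f) (hg : Computable g) :
    Computable fun a => f a - g a := Primrec.nat_sub.to_comp.comp hf hg

@[fun_prop] theorem mul_fun {f g : α → ℕ} (hf : Computable f) (hg : Computable g) :
    Computable fun a => f a * g a := Primrec.nat_mul.to_comp.comp hf hg

@[fun_prop] theorem and_fun {f g : α → Bool} (hf : Computable f) (hg : Computable g) :
    Computable fun a => f a && g a := Primrec.and.to_comp.comp hf hg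

@[fun_prop] theorem not_fun {f : α → Bool} (hf : Computable f) : Computable fun a => !f a :=
  Primrec.not.to_comp.comp hf

@[fun_prop] theorem beq_fun [DecidableEq β] {f g : α → β} (hf : Computable f)
    (hg : Computable g) : Computable fun a => f a == g a := Primrec.beq.to_comp.comp hf hg

@[fun_prop] theorem eq_fun [DecidableEq β] {f g : α → β} (hf : Computable f)
    (hg : Computable g) : Computable fun a => decide (f a = g a) :=
  Primrec.eq.decide.to_comp.comp hf hg

@[fun_prop] theorem ble_fun {f g : α → ℕ} (hf : Computable f) (hg : Computable g) :
    Computable fun a => decide (f a ≤ g a) := Primrec.nat_le.decide.to_comp.comp hf hg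

@[fun_prop] theorem cond_fun {c : α → Bool} {f g : α → β} (hc : Computable c)
    (hf : Computable f) (hg : Computable g) : Computable fun a => bif c a then f a else g a :=
  Computable.cond hc hf hg

@[fun_prop] theorem length_fun {f : α → List β} (hf : Computable f) :
    Computable fun a => (f a).length := Computable.list_length.comp hf

@[fun_prop] theorem range_fun {f : α → ℕ} (hf : Computable f) :
    Computable fun a => List.range (f a) := Primrec.list_range.to_comp.comp hf

@[fun_prop] theorem getD_fun {f : α → List β} {g : α → ℕ} (d : β) (hf : Computable f)
    (hg : Computable g) : Computable fun a => (f a).getD (g a) d :=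
  (Primrec.list_getD d).to_comp.comp hf hg

@[fun_prop] theorem nat_rec_fun {f : α → ℕ} {g : α → σ} {h : α → ℕ → σ → σ} (hf : Computable f)
    (hg : Computable g) (hh : Computable fun p : (α × ℕ) × σ => h p.1.1 p.1.2 p.2) :
    Computable fun a => Nat.rec (motive := fun _ => σ) (g a) (h a) (f a) := by
  refine Computable.nat_rec (h := fun a p => h a p.1 p.2) hf hg ?_
  exact hh.comp (g := fun p : α × (ℕ × σ) => ((p.1, p.2.1), p.2.2)) (by fun_prop)

@[fun_prop] theorem pow_fun {f g : α → ℕ} (hf : Computable f) (hg : Computable g) :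
    Computable fun a => f a ^ g a := by
  have : Computable fun a => Nat.rec (motive := fun _ => ℕ) 1 (fun _ x => x * f a) (g a) := by
    fun_prop
  refine this.of_eq fun a => ?_
  induction g a with
  | zero => rfl
  | succ k ih => rw [pow_succ, ← ih]

@[fun_prop] theorem foldl_fun {f : α → List β} {g : α → σ} {h : α → σ → β → σ}
    (hf : Computable f) (hg : Computable g)
    (hh : Computable fun p : (α × σ) × β => h p.1.1 p.1.2 p.2) :
    Computable fun a => (f a).foldl (h a) (g a) := by
  have h1 : Computable fun a => Nat.rec (motive := fun _ => σ) (g a)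
      (fun k s => ((f a)[k]?.map fun b => h a s b).getD s) (f a).length := by
    refine nat_rec_fun (by fun_prop) hg (h := fun a k s => ((f a)[k]?.map fun b => h a s b).getD s) ?_
    refine Computable.option_getD (Computable.option_map ?_ ?_) ?_
    · exact Computable.list_getElem?.comp (by fun_prop) (by fun_prop)
    · exact hh.comp (g := fun p : ((α × ℕ) × σ) × β => ((p.1.1.1, p.1.2), p.2)) (by fun_prop)
    · fun_prop
  refine h1.of_eq fun a => ?_
  have key (k : ℕ) : Nat.rec (motive := fun _ => σ) (g a)
      (fun k s => ((f a)[k]?.map fun b => h a s b).getD s) k = ((f a).take k).foldl (h a) (g a) := by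
    induction k with
    | zero => rfl
    | succ k ih =>
      simp only
      rw [ih, List.take_add_one, List.foldl_append]
      cases (f a)[k]? <;> rfl
  rw [key, List.take_length]

@[fun_prop] theorem map_fun {f : α → List β} {g : α → β → σ} (hf : Computable f)
    (hg : Computable fun p : α × β => g p.1 p.2) : Computable fun a => (f a).map (g a) := by
  have : Computable fun a => (f a).foldl (fun s b => s ++ [g a b]) [] := by
    refine foldl_fun hf (by fun_prop) ?_
    have := hg.comp (g := fun p : (α × List σ) × β => (p.1.1, p.2)) (by fun_prop)
    fun_prop
  refine this.of_eq fun a => ?_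
  have key (l : List β) (s : List σ) :
      l.foldl (fun s b => s ++ [g a b]) s = s ++ l.map (g a) := by
    induction l generalizing s with
    | nil => simp
    | cons b l ih => rw [List.foldl_cons, ih, List.map_cons, List.append_assoc]; rfl
  rw [key, List.nil_append]

@[fun_prop] theorem flatMap_fun {f : α → List β} {g : α → β → List σ} (hf : Computable f)
    (hg : Computable fun p : α × β => g p.1 p.2) : Computable fun a => (f a).flatMap (g a) :=
  (Primrec.list_flatten.to_comp.comp (map_fun hf hg)).of_eq fun _ => rfl

@[fun_prop] theorem all_fun {f : α → List β} {g : α → β → Bool} (hf : Computable f)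
    (hg : Computable fun p : α × β => g p.1 p.2) : Computable fun a => (f a).all (g a) := by
  have : Computable fun a => (f a).foldl (fun s b => s && g a b) true := by
    refine foldl_fun hf (by fun_prop) ?_
    have := hg.comp (g := fun p : (α × Bool) × β => (p.1.1, p.2)) (by fun_prop)
    fun_prop
  refine this.of_eq fun a => ?_
  have key (l : List β) (s : Bool) : l.foldl (fun s b => s && g a b) s = (s && l.all (g a)) := by
    induction l generalizing s with
    | nil => simp
    | cons b l ih => rw [List.foldl_cons, ih, List.all_cons, Bool.and_assoc]
  rw [key, Bool.true_and]

@[fun_prop] theorem replicate_fun {f : α → ℕ} {g : α → β} (hf : Computable f)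
    (hg : Computable g) : Computable fun a => List.replicate (f a) (g a) := by
  have : Computable fun a => (List.range (f a)).map fun _ => g a := by fun_prop
  exact this.of_eq fun a => by rw [List.map_const', List.length_range]

@[fun_prop] theorem mem_fun [DecidableEq β] {f : α → List β} {g : α → β}
    (hf : Computable f) (hg : Computable g) : Computable fun a => decide (g a ∈ f a) := by
  have : Computable fun a => !((f a).all fun b => !decide (g a = b)) := by fun_prop
  refine this.of_eq fun a => ?_
  rw [List.not_all_eq_any_not, Bool.eq_iff_iff]
  simp

end Computable

/-! ### Formal sums of products of named algebraic numbers. -/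

/-- A sum of products of named numbers, as a list of lists of names. -/
abbrev WordSum : Type := List (List ℕ)

/-- A polynomial whose coefficients are products of named numbers, as a list of terms
(list of exponents, list of names). -/
abbrev WordPoly : Type := List (List ℕ × List ℕ)

/-- A fraction of two polynomials. -/
abbrev WordFrac : Type := WordPoly × WordPoly

namespace AlgebraicNumberCoding

variable (ν : AlgebraicNumberCoding)

theorem isAlgebraic_val (a : ℕ) : IsAlgebraic ℚ (ν.val a) := by
  have : ν.val a ∈ {z : ℂ | IsAlgebraic ℚ z} := ν.range_val ▸ ⟨a, rfl⟩
  exact this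

theorem exists_val {z : ℂ} (hz : IsAlgebraic ℚ z) : ∃ a, ν.val a = z := by
  have : z ∈ Set.range ν.val := ν.range_val ▸ hz
  exact this

/-- A name of `0`. -/
def zeroName : ℕ := (ν.exists_val (z := 0) isAlgebraic_zero).choose

/-- A name of `1`. -/
def oneName : ℕ := (ν.exists_val (z := 1) isAlgebraic_one).choose

/-- A name of `-1`. -/
def negName : ℕ := (ν.exists_val (z := -1) isAlgebraic_one.neg).choose

@[simp] theorem val_zeroName : ν.val ν.zeroName = 0 :=
  (ν.exists_val (z := 0) isAlgebraic_zero).choose_spec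

@[simp] theorem val_oneName : ν.val ν.oneName = 1 :=
  (ν.exists_val (z := 1) isAlgebraic_one).choose_spec

@[simp] theorem val_negName : ν.val ν.negName = -1 :=
  (ν.exists_val (z := -1) isAlgebraic_one.neg).choose_spec

/-- Addition of names. -/
def addName : ℕ → ℕ → ℕ := ν.add_computable.choose

/-- Multiplication of names. -/
def mulName : ℕ → ℕ → ℕ := ν.mul_computable.choose

@[simp] theorem val_addName (a b : ℕ) : ν.val (ν.addName a b) = ν.val a + ν.val b :=
  ν.add_computable.choose_spec.2 a b

@[simp] theorem val_mulName (a b : ℕ) : ν.val (ν.mulName a b) = ν.val a * ν.val b :=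
  ν.mul_computable.choose_spec.2 a b

/-- The name of a product. -/
def prodName (w : List ℕ) : ℕ := w.foldl ν.mulName ν.oneName

/-- The name of a sum of products. -/
def sumName (w : WordSum) : ℕ := w.foldl (fun s u => ν.addName s (ν.prodName u)) ν.zeroName

/-- The value of a product. -/
def wordVal (w : List ℕ) : ℂ := (w.map ν.val).prod

/-- The value of a sum of products. -/
def sumVal (w : WordSum) : ℂ := (w.map ν.wordVal).sum

open Classical in
/-- The zero test. -/
def isZero (w : WordSum) : Bool := decide (ν.val (ν.sumName w) = ν.val ν.zeroName)

@[simp] theorem wordVal_nil : ν.wordVal [] = 1 := rfl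

@[simp] theorem wordVal_cons (a : ℕ) (w : List ℕ) : ν.wordVal (a :: w) = ν.val a * ν.wordVal w := by
  simp [wordVal]

@[simp] theorem wordVal_append (v w : List ℕ) :
    ν.wordVal (v ++ w) = ν.wordVal v * ν.wordVal w := by
  simp [wordVal]

@[simp] theorem wordVal_replicate (k a : ℕ) : ν.wordVal (List.replicate k a) = ν.val a ^ k := by
  simp [wordVal]

@[simp] theorem sumVal_nil : ν.sumVal [] = 0 := rfl

@[simp] theorem sumVal_cons (u : List ℕ) (w : WordSum) :
    ν.sumVal (u :: w) = ν.wordVal u + ν.sumVal w := by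
  simp [sumVal]

@[simp] theorem sumVal_append (v w : WordSum) : ν.sumVal (v ++ w) = ν.sumVal v + ν.sumVal w := by
  simp [sumVal]

@[simp] theorem sumVal_replicate (k : ℕ) (u : List ℕ) :
    ν.sumVal (List.replicate k u) = k * ν.wordVal u := by
  simp [sumVal]

theorem sumVal_map_cons (a : ℕ) (w : WordSum) :
    ν.sumVal (w.map fun u => a :: u) = ν.val a * ν.sumVal w := by
  induction w with
  | nil => simp
  | cons u w ih => rw [List.map_cons, sumVal_cons, ih, wordVal_cons, sumVal_cons, mul_add]

@[simp] theorem val_prodName (w : List ℕ) : ν.val (ν.prodName w) = ν.wordVal w := by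
  have key (w : List ℕ) (s : ℕ) : ν.val (w.foldl ν.mulName s) = ν.val s * ν.wordVal w := by
    induction w generalizing s with
    | nil => simp
    | cons a w ih => rw [List.foldl_cons, ih, val_mulName, wordVal_cons, mul_assoc]
  rw [prodName, key, val_oneName, one_mul]

@[simp] theorem val_sumName (w : WordSum) : ν.val (ν.sumName w) = ν.sumVal w := by
  have key (w : WordSum) (s : ℕ) :
      ν.val (w.foldl (fun s u => ν.addName s (ν.prodName u)) s) = ν.val s + ν.sumVal w := by
    induction w generalizing s with
    | nil => simp
    | cons a w ih => rw [List.foldl_cons, ih, val_addName, sumVal_cons, val_prodName, add_assoc]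
  rw [sumName, key, val_zeroName, zero_add]

@[simp] theorem isZero_iff (w : WordSum) : ν.isZero w = true ↔ ν.sumVal w = 0 := by
  rw [isZero, decide_eq_true_iff, val_sumName, val_zeroName]

section Computability

variable {α : Type*} [Primcodable α]

@[fun_prop] theorem computable_addName {f g : α → ℕ} (hf : Computable f) (hg : Computable g) :
    Computable fun a => ν.addName (f a) (g a) :=
  Computable₂.comp ν.add_computable.choose_spec.1 hf hg

@[fun_prop] theorem computable_mulName {f g : α → ℕ} (hf : Computable f) (hg : Computable g) :
    Computable fun a => ν.mulName (f a) (g a) :=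
  Computable₂.comp ν.mul_computable.choose_spec.1 hf hg

@[fun_prop] theorem computable_prodName {f : α → List ℕ} (hf : Computable f) :
    Computable fun a => ν.prodName (f a) := by
  unfold prodName
  exact Computable.foldl_fun (h := fun _ => ν.mulName) hf (by fun_prop) (by fun_prop)

@[fun_prop] theorem computable_sumName {f : α → WordSum} (hf : Computable f) :
    Computable fun a => ν.sumName (f a) := by
  unfold sumName
  fun_prop

@[fun_prop] theorem computable_isZero {f : α → WordSum} (hf : Computable f) :
    Computable fun a => ν.isZero (f a) := by
  classical
  exact (ν.eq_computable.decide.comp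
    (g := fun a => (ν.sumName (f a), ν.zeroName)) (by fun_prop)).of_eq fun a => rfl

end Computability

end AlgebraicNumberCoding

/-! Operations on codes of polynomials in `n` variables. -/

namespace WordPoly

/-- The first `n` exponents. -/
def norm (n : ℕ) (e : List ℕ) : List ℕ := (List.range n).map fun i => e.getD i 0

/-- The sum of two lists of exponents. -/
def addExp (n : ℕ) (e e' : List ℕ) : List ℕ :=
  (List.range n).map fun i => e.getD i 0 + e'.getD i 0

/-- The exponents after differentiation. -/
def decExp (n i : ℕ) (e : List ℕ) : List ℕ :=
  (List.range n).map fun j => bif j == i then e.getD j 0 - 1 else e.getD j 0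

/-- The product. -/
def mul (n : ℕ) (c d : WordPoly) : WordPoly :=
  c.flatMap fun s => d.map fun t => (addExp n s.1 t.1, s.2 ++ t.2)

/-- The product by a named number. -/
def smul (a : ℕ) (c : WordPoly) : WordPoly := c.map fun t => (t.1, a :: t.2)

/-- The partial derivative. -/
def pd (n i : ℕ) (c : WordPoly) : WordPoly :=
  c.flatMap fun t => List.replicate (t.1.getD i 0) (decExp n i t.1, t.2)

/-- The coefficient of a monomial with exponents `e`. -/
def coeff (n : ℕ) (e : List ℕ) (c : WordPoly) : WordSum :=
  c.flatMap fun t => bif decide (norm n t.1 = e) then [t.2] else []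

/-- The zero test. -/
def isZero (ν : AlgebraicNumberCoding) (n : ℕ) (c : WordPoly) : Bool :=
  c.all fun t => ν.isZero (coeff n (norm n t.1) c)

/-- The constant polynomial `1`. -/
def one : WordPoly := [([], [])]

section Computability

variable {α : Type*} [Primcodable α]

@[fun_prop] theorem computable_norm {f : α → ℕ} {g : α → List ℕ} (hf : Computable f)
    (hg : Computable g) : Computable fun a => norm (f a) (g a) := by
  unfold norm; fun_prop

@[fun_prop] theorem computable_addExp {f : α → ℕ} {g h : α → List ℕ} (hf : Computable f)
    (hg : Computable g) (hh : Computable h) : Computable fun a => addExp (f a) (g a) (h a) := by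
  unfold addExp; fun_prop

@[fun_prop] theorem computable_decExp {f k : α → ℕ} {g : α → List ℕ} (hf : Computable f)
    (hk : Computable k) (hg : Computable g) : Computable fun a => decExp (f a) (k a) (g a) := by
  unfold decExp; fun_prop

@[fun_prop] theorem computable_mul {f : α → ℕ} {g h : α → WordPoly} (hf : Computable f)
    (hg : Computable g) (hh : Computable h) : Computable fun a => mul (f a) (g a) (h a) := by
  unfold mul; fun_prop

@[fun_prop] theorem computable_smul {f : α → ℕ} {g : α → WordPoly} (hf : Computable f)
    (hg : Computable g) : Computable fun a => smul (f a) (g a) := by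
  unfold smul; fun_prop

@[fun_prop] theorem computable_pd {f k : α → ℕ} {g : α → WordPoly} (hf : Computable f)
    (hk : Computable k) (hg : Computable g) : Computable fun a => pd (f a) (k a) (g a) := by
  unfold pd; fun_prop

@[fun_prop] theorem computable_coeff {f : α → ℕ} {e : α → List ℕ} {g : α → WordPoly}
    (hf : Computable f) (he : Computable e) (hg : Computable g) :
    Computable fun a => coeff (f a) (e a) (g a) := by
  unfold coeff
  refine Computable.flatMap_fun hg (Computable.cond_fun (Computable.eq_fun ?_ ?_) ?_ ?_)
  · exact computable_norm (by fun_prop) (by fun_prop)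
  · fun_prop
  · exact Computable.cons_fun (by fun_prop) (by fun_prop)
  · fun_prop

@[fun_prop] theorem computable_isZero (ν : AlgebraicNumberCoding) {f : α → ℕ} {g : α → WordPoly}
    (hf : Computable f) (hg : Computable g) : Computable fun a => isZero ν (f a) (g a) := by
  unfold isZero; fun_prop

end Computability

variable (ν : AlgebraicNumberCoding) (n : ℕ)

/-- The exponents, as a monomial. -/
def expo (e : List ℕ) : Fin n →₀ ℕ := Finsupp.equivFunOnFinite.symm fun i => e.getD i 0

@[simp] theorem expo_apply (e : List ℕ) (i : Fin n) : expo n e i = e.getD i 0 := rfl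

/-- The polynomial with code `c`. -/
def poly (c : WordPoly) : MvPolynomial (Fin n) ℂ :=
  (c.map fun t => MvPolynomial.monomial (expo n t.1) (ν.wordVal t.2)).sum

theorem getD_map_range (f : ℕ → ℕ) (i : Fin n) : ((List.range n).map f).getD i 0 = f i := by
  simp [List.getD_eq_getElem?_getD]

theorem norm_eq_iff (e e' : List ℕ) : norm n e = norm n e' ↔ expo n e = expo n e' := by
  constructor
  · intro h
    ext i
    have := congrArg (fun l => l.getD (i : ℕ) 0) h
    simpa [norm, getD_map_range] using this
  · intro h
    refine List.map_congr_left fun i hi => ?_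
    have := DFunLike.congr_fun h ⟨i, List.mem_range.1 hi⟩
    simpa using this

theorem expo_addExp (e e' : List ℕ) : expo n (addExp n e e') = expo n e + expo n e' := by
  ext i
  rw [Finsupp.add_apply, expo_apply, addExp, getD_map_range, expo_apply, expo_apply]

theorem expo_decExp (i : Fin n) (e : List ℕ) :
    expo n (decExp n i e) = expo n e - Finsupp.single i 1 := by
  ext j
  rw [expo_apply, decExp, getD_map_range, Finsupp.tsub_apply, expo_apply]
  by_cases h : j = i
  · subst h; simp
  · have : (j : ℕ) ≠ i := fun h' => h (Fin.ext h')
    have h' : ((j : ℕ) == (i : ℕ)) = false := beq_eq_false_iff_ne.2 this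
    rw [h', cond_false, Finsupp.single_eq_of_ne h, Nat.sub_zero]

@[simp] theorem poly_nil : poly ν n [] = 0 := rfl

@[simp] theorem poly_cons (t : List ℕ × List ℕ) (c : WordPoly) :
    poly ν n (t :: c) = MvPolynomial.monomial (expo n t.1) (ν.wordVal t.2) + poly ν n c := by
  simp [poly]

@[simp] theorem poly_append (c d : WordPoly) : poly ν n (c ++ d) = poly ν n c + poly ν n d := by
  simp [poly]

@[simp] theorem poly_one : poly ν n one = 1 := by
  have : expo n [] = 0 := by ext; simp
  simp [one, this]

@[simp] theorem poly_mul (c d : WordPoly) : poly ν n (mul n c d) = poly ν n c * poly ν n d := by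
  induction c with
  | nil => simp [mul]
  | cons s c ih =>
    have h : mul n (s :: c) d =
        (d.map fun t => (addExp n s.1 t.1, s.2 ++ t.2)) ++ mul n c d := rfl
    rw [h, poly_append, ih, poly_cons, add_mul]
    congr 1
    clear ih h
    induction d with
    | nil => simp
    | cons t d ih =>
      rw [List.map_cons, poly_cons, ih, poly_cons, mul_add, MvPolynomial.monomial_mul, expo_addExp,
        ν.wordVal_append]

@[simp] theorem poly_smul (a : ℕ) (c : WordPoly) :
    poly ν n (smul a c) = MvPolynomial.C (ν.val a) * poly ν n c := by
  induction c with
  | nil => simp [smul]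
  | cons s c ih =>
    have h : smul a (s :: c) = (s.1, a :: s.2) :: smul a c := rfl
    rw [h, poly_cons, ih, poly_cons, mul_add, MvPolynomial.C_mul_monomial, ν.wordVal_cons]

@[simp] theorem poly_replicate (k : ℕ) (t : List ℕ × List ℕ) :
    poly ν n (List.replicate k t) =
      MvPolynomial.monomial (expo n t.1) (ν.wordVal t.2 * k) := by
  simp only [poly, List.map_replicate, List.sum_replicate, MvPolynomial.smul_monomial]
  rw [nsmul_eq_mul, mul_comm]

@[simp] theorem poly_pd (i : Fin n) (c : WordPoly) :
    poly ν n (pd n i c) = MvPolynomial.pderiv i (poly ν n c) := by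
  induction c with
  | nil => simp [pd]
  | cons t c ih =>
    have h : pd n i (t :: c) =
        List.replicate (t.1.getD i 0) (decExp n i t.1, t.2) ++ pd n i c := rfl
    rw [h, poly_append, ih, poly_cons, map_add, poly_replicate, MvPolynomial.pderiv_monomial,
      expo_decExp, expo_apply]

theorem coeff_poly (e : List ℕ) (c : WordPoly) :
    MvPolynomial.coeff (expo n e) (poly ν n c) = ν.sumVal (coeff n (norm n e) c) := by
  induction c with
  | nil => simp [coeff]
  | cons t c ih =>
    have h : coeff n (norm n e) (t :: c) =
        (bif decide (norm n t.1 = norm n e) then [t.2] else []) ++ coeff n (norm n e) c := rfl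
    rw [h, poly_cons, MvPolynomial.coeff_add, ih, ν.sumVal_append, MvPolynomial.coeff_monomial]
    congr 1
    by_cases h' : norm n t.1 = norm n e
    · rw [if_pos ((norm_eq_iff n _ _).1 h'), decide_eq_true h']; simp
    · rw [if_neg fun h => h' ((norm_eq_iff n _ _).2 h), decide_eq_false h']; simp

/-- Only exponents that occur in the code can carry a nonzero coefficient, so testing these finitely
many coefficients decides whether a polynomial is zero. -/
theorem exists_of_coeff_ne_zero {m : Fin n →₀ ℕ} {c : WordPoly}
    (h : MvPolynomial.coeff m (poly ν n c) ≠ 0) : ∃ t ∈ c, expo n t.1 = m := by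
  induction c with
  | nil => simp at h
  | cons t c ih =>
    by_cases ht : expo n t.1 = m
    · exact ⟨t, List.mem_cons_self, ht⟩
    · rw [poly_cons, MvPolynomial.coeff_add, MvPolynomial.coeff_monomial, if_neg ht, zero_add] at h
      obtain ⟨t', h1, h2⟩ := ih h
      exact ⟨t', List.mem_cons_of_mem _ h1, h2⟩

@[simp] theorem isZero_iff (c : WordPoly) : isZero ν n c = true ↔ poly ν n c = 0 := by
  rw [isZero, List.all_eq_true]
  constructor
  · intro h
    ext m
    rw [MvPolynomial.coeff_zero]
    by_contra hm
    obtain ⟨t, ht, rfl⟩ := exists_of_coeff_ne_zero ν n hm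
    rw [coeff_poly] at hm
    exact hm ((ν.isZero_iff _).1 (h t ht))
  · intro h t _
    rw [ν.isZero_iff, ← coeff_poly, h, MvPolynomial.coeff_zero]

/-- The conversion to a list of terms with named coefficients. -/
def toPolyCode (c : WordPoly) : PolyCode := c.map fun t => (t.1, ν.prodName t.2)

/-- The conversion from a list of terms with named coefficients. -/
def ofPolyCode (c : PolyCode) : WordPoly := c.map fun t => (t.1, [t.2])

theorem monomial_eq_C_mul_prod (e : List ℕ) (a : ℂ) :
    MvPolynomial.monomial (expo n e) a =
      MvPolynomial.C a * ∏ i : Fin n, MvPolynomial.X i ^ (e.getD i 0) := by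
  rw [MvPolynomial.monomial_eq, Finsupp.prod_fintype _ _ (fun i => pow_zero _)]
  rfl

@[simp] theorem poly_toPolyCode (c : WordPoly) : ν.poly n (toPolyCode ν c) = poly ν n c := by
  simp only [AlgebraicNumberCoding.poly, toPolyCode, poly, List.map_map, monomial_eq_C_mul_prod]
  simp [Function.comp_def]

@[simp] theorem poly_ofPolyCode (c : PolyCode) : poly ν n (ofPolyCode c) = ν.poly n c := by
  simp only [AlgebraicNumberCoding.poly, ofPolyCode, poly, List.map_map, monomial_eq_C_mul_prod]
  simp [Function.comp_def]

section Computability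

variable {α : Type*} [Primcodable α]

@[fun_prop] theorem computable_toPolyCode {f : α → WordPoly} (hf : Computable f) :
    Computable fun a => toPolyCode ν (f a) := by
  unfold toPolyCode; fun_prop

@[fun_prop] theorem computable_ofPolyCode {f : α → PolyCode} (hf : Computable f) :
    Computable fun a => ofPolyCode (f a) := by
  unfold ofPolyCode; fun_prop

end Computability

end WordPoly

/-! ### Codes with coefficients in prescribed names. -/

namespace WordPoly

/-- All the names in `c` belong to `S`. -/
def uses (S : List ℕ) (c : WordPoly) : Bool := c.all fun t => t.2.all fun a => decide (a ∈ S)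

@[fun_prop] theorem computable_uses {α : Type*} [Primcodable α] {f : α → List ℕ} {g : α → WordPoly}
    (hf : Computable f) (hg : Computable g) : Computable fun a => uses (f a) (g a) := by
  unfold uses; fun_prop

theorem uses_iff {S : List ℕ} {c : WordPoly} :
    uses S c = true ↔ ∀ t ∈ c, ∀ a ∈ t.2, a ∈ S := by
  simp [uses]

theorem uses_append {S : List ℕ} {c d : WordPoly} (hc : uses S c = true) (hd : uses S d = true) :
    uses S (c ++ d) = true := by
  rw [uses_iff] at *
  intro t ht
  exact (List.mem_append.1 ht).elim (hc t) (hd t)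

theorem uses_mul {S : List ℕ} {c d : WordPoly} (n : ℕ) (hc : uses S c = true)
    (hd : uses S d = true) : uses S (mul n c d) = true := by
  rw [uses_iff] at *
  intro t ht a ha
  obtain ⟨s, hs, ht⟩ := List.mem_flatMap.1 ht
  obtain ⟨u, hu, rfl⟩ := List.mem_map.1 ht
  exact (List.mem_append.1 ha).elim (hc s hs a) (hd u hu a)

theorem uses_smul {S : List ℕ} {c : WordPoly} {a : ℕ} (ha : a ∈ S) (hc : uses S c = true) :
    uses S (smul a c) = true := by
  rw [uses_iff] at *
  intro t ht b hb
  obtain ⟨s, hs, rfl⟩ := List.mem_map.1 ht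
  rcases List.mem_cons.1 hb with rfl | hb
  · exact ha
  · exact hc s hs b hb

/-- This turns membership in a field of rational functions into a decidable condition on the words
of a code; multiplying out the coefficients would hide it. -/
theorem algebraMap_poly_mem {ν : AlgebraicNumberCoding} {n : ℕ} {S : List ℕ} {c : WordPoly}
    {k : Subfield ℂ} (hS : ∀ a ∈ S, ν.val a ∈ k) (hc : uses S c = true) :
    algebraMap _ (RatFun n) (poly ν n c) ∈ RatFun.ratField k Set.univ := by
  rw [uses_iff] at hc
  induction c with
  | nil => rw [poly_nil, map_zero]; exact zero_mem _
  | cons t c ih =>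
    rw [poly_cons, map_add, monomial_eq_C_mul_prod, map_mul, map_prod]
    refine add_mem (mul_mem (RatFun.const_mem ?_) (prod_mem fun i _ => ?_))
      (ih fun t ht => hc t (List.mem_cons_of_mem _ ht))
    · refine list_prod_mem fun z hz => ?_
      obtain ⟨a, ha, rfl⟩ := List.mem_map.1 hz
      exact hS a (hc t List.mem_cons_self a ha)
    · rw [map_pow]
      exact pow_mem (RatFun.var_mem (Set.mem_univ i)) _

end WordPoly

/-! ### Fractions of coded polynomials. -/

namespace WordFrac

open WordPoly

variable (ν : AlgebraicNumberCoding) (n : ℕ)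

/-- The fraction with code `f`. -/
def val (f : WordFrac) : RatFun n :=
  algebraMap _ (RatFun n) (poly ν n f.1) / algebraMap _ (RatFun n) (poly ν n f.2)

/-- The denominator is not zero. -/
def Valid (f : WordFrac) : Prop := poly ν n f.2 ≠ 0

/-- The sum. -/
def add (f g : WordFrac) : WordFrac :=
  (WordPoly.mul n f.1 g.2 ++ WordPoly.mul n f.2 g.1, WordPoly.mul n f.2 g.2)

/-- The product. -/
def mul (f g : WordFrac) : WordFrac := (WordPoly.mul n f.1 g.1, WordPoly.mul n f.2 g.2)

/-- The partial derivative. -/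
def pd (i : ℕ) (f : WordFrac) : WordFrac :=
  (WordPoly.mul n (WordPoly.pd n i f.1) f.2 ++
    smul ν.negName (WordPoly.mul n f.1 (WordPoly.pd n i f.2)), WordPoly.mul n f.2 f.2)

/-- The logarithmic derivative. -/
def dlog (i : ℕ) (f : WordFrac) : WordFrac :=
  (WordPoly.mul n (WordPoly.pd n i f.1) f.2 ++
    smul ν.negName (WordPoly.mul n f.1 (WordPoly.pd n i f.2)), WordPoly.mul n f.1 f.2)

section Computability

variable {α : Type*} [Primcodable α]

@[fun_prop] theorem computable_add {f : α → ℕ} {g h : α → WordFrac} (hf : Computable f)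
    (hg : Computable g) (hh : Computable h) : Computable fun a => add (f a) (g a) (h a) := by
  unfold add; fun_prop

@[fun_prop] theorem computable_mul {f : α → ℕ} {g h : α → WordFrac} (hf : Computable f)
    (hg : Computable g) (hh : Computable h) : Computable fun a => mul (f a) (g a) (h a) := by
  unfold mul; fun_prop

@[fun_prop] theorem computable_pd {f k : α → ℕ} {g : α → WordFrac} (hf : Computable f)
    (hk : Computable k) (hg : Computable g) : Computable fun a => pd ν (f a) (k a) (g a) := by
  unfold pd; fun_prop

@[fun_prop] theorem computable_dlog {f k : α → ℕ} {g : α → WordFrac} (hf : Computable f)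
    (hk : Computable k) (hg : Computable g) : Computable fun a => dlog ν (f a) (k a) (g a) := by
  unfold dlog; fun_prop

end Computability

variable {ν n} {f g : WordFrac}

theorem Valid.ne_zero (hf : Valid ν n f) : algebraMap _ (RatFun n) (poly ν n f.2) ≠ 0 :=
  RatFun.algebraMap_ne_zero hf

theorem Valid.add (hf : Valid ν n f) (hg : Valid ν n g) :
    Valid ν n (add n f g) ∧ val ν n (WordFrac.add n f g) = val ν n f + val ν n g := by
  refine ⟨?_, ?_⟩
  · rw [Valid, WordFrac.add, poly_mul]; exact mul_ne_zero hf hg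
  · simp only [val, WordFrac.add, poly_append, poly_mul, map_add, map_mul]
    rw [div_add_div _ _ hf.ne_zero hg.ne_zero]

theorem Valid.mul (hf : Valid ν n f) (hg : Valid ν n g) :
    Valid ν n (mul n f g) ∧ val ν n (WordFrac.mul n f g) = val ν n f * val ν n g := by
  refine ⟨?_, ?_⟩
  · rw [Valid, WordFrac.mul, poly_mul]; exact mul_ne_zero hf hg
  · simp only [val, WordFrac.mul, poly_mul, map_mul]
    rw [div_mul_div_comm]

theorem val_pd_eq (hf : Valid ν n f) (i : Fin n) : RatFun.pd i (val ν n f) =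
    (algebraMap _ (RatFun n) (poly ν n (WordPoly.pd n i f.1)) *
      algebraMap _ (RatFun n) (poly ν n f.2) - algebraMap _ (RatFun n) (poly ν n f.1) *
      algebraMap _ (RatFun n) (poly ν n (WordPoly.pd n i f.2))) /
      algebraMap _ (RatFun n) (poly ν n f.2) ^ 2 := by
  rw [val, RatFun.pd_div' _ _ _ hf.ne_zero, RatFun.pd_algebraMap, RatFun.pd_algebraMap, poly_pd,
    poly_pd]
  congr 1
  ring

theorem Valid.pd (hf : Valid ν n f) (i : Fin n) :
    Valid ν n (pd ν n i f) ∧ val ν n (WordFrac.pd ν n i f) = RatFun.pd i (val ν n f) := by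
  refine ⟨?_, ?_⟩
  · rw [Valid, WordFrac.pd, poly_mul]; exact mul_ne_zero hf hf
  · rw [val_pd_eq hf]
    simp only [val, WordFrac.pd, poly_append, poly_mul, poly_smul, map_add, map_mul,
      ν.val_negName, map_neg, map_one]
    rw [pow_two]
    ring

theorem Valid.dlog (hf : Valid ν n f) (hf' : poly ν n f.1 ≠ 0) (i : Fin n) :
    Valid ν n (dlog ν n i f) ∧
      val ν n (WordFrac.dlog ν n i f) = RatForm.dlog (val ν n f) i := by
  refine ⟨?_, ?_⟩
  · rw [Valid, WordFrac.dlog, poly_mul]; exact mul_ne_zero hf' hf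
  · rw [RatForm.dlog, val_pd_eq hf]
    have h1 := hf.ne_zero
    have h2 := RatFun.algebraMap_ne_zero hf'
    simp only [val, WordFrac.dlog, poly_append, poly_mul, poly_smul, map_add, map_mul,
      ν.val_negName, map_neg, map_one]
    field_simp
    ring

variable (ν n) in
/-- The fractions whose coefficients are polynomials in the numbers named in `S`. -/
def Codable (S : List ℕ) (z : RatFun n) : Prop :=
  ∃ f : WordFrac, Valid ν n f ∧ uses S f.1 = true ∧ uses S f.2 = true ∧ val ν n f = z

theorem mem_ratField_of_uses {S : List ℕ} {k : Subfield ℂ} (hS : ∀ a ∈ S, ν.val a ∈ k)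
    (h1 : uses S f.1 = true) (h2 : uses S f.2 = true) :
    val ν n f ∈ RatFun.ratField k Set.univ :=
  div_mem (algebraMap_poly_mem hS h1) (algebraMap_poly_mem hS h2)

theorem Codable.inv {S : List ℕ} {z : RatFun n} (hz : Codable ν n S z) : Codable ν n S z⁻¹ := by
  obtain ⟨f, h1, h2, h3, rfl⟩ := hz
  -- Exchanging numerator and denominator would give a zero denominator here, but `0⁻¹ = 0`, so the
  -- code of zero is kept.
  by_cases h : poly ν n f.1 = 0
  · refine ⟨f, h1, h2, h3, ?_⟩
    rw [val, h, map_zero, zero_div, inv_zero]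
  · exact ⟨(f.2, f.1), h, h3, h2, by rw [val, val, inv_div]⟩

theorem Codable.add {S : List ℕ} {y z : RatFun n} (hy : Codable ν n S y) (hz : Codable ν n S z) :
    Codable ν n S (y + z) := by
  obtain ⟨f, h1, h2, h3, rfl⟩ := hy
  obtain ⟨g, h4, h5, h6, rfl⟩ := hz
  exact ⟨_, (h1.add h4).1, uses_append (uses_mul n h2 h6) (uses_mul n h3 h5), uses_mul n h3 h6,
    (h1.add h4).2⟩

theorem Codable.mul {S : List ℕ} {y z : RatFun n} (hy : Codable ν n S y) (hz : Codable ν n S z) :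
    Codable ν n S (y * z) := by
  obtain ⟨f, h1, h2, h3, rfl⟩ := hy
  obtain ⟨g, h4, h5, h6, rfl⟩ := hz
  exact ⟨_, (h1.mul h4).1, uses_mul n h2 h5, uses_mul n h3 h6, (h1.mul h4).2⟩

theorem codable_one (S : List ℕ) : Codable ν n S 1 :=
  ⟨(one, one), by simp [Valid], by simp [uses, one], by simp [uses, one], by simp [val]⟩

theorem codable_val {S : List ℕ} {a : ℕ} (ha : a ∈ S) :
    Codable ν n S (RatFun.const n (ν.val a)) :=
  ⟨(smul a one, one), by simp [Valid], uses_smul ha (by simp [uses, one]), by simp [uses, one], by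
    rw [val, poly_smul, poly_one, mul_one, map_one, div_one]; rfl⟩

theorem codable_var (S : List ℕ) (i : Fin n) : Codable ν n S (RatFun.var i) := by
  refine ⟨([((List.range n).map fun j : ℕ => if j = (i : ℕ) then 1 else 0, [])], one), by simp [Valid],
    by simp [uses], by simp [uses, one], ?_⟩
  have h : expo n ((List.range n).map fun j : ℕ => if j = (i : ℕ) then 1 else 0) = Finsupp.single i 1 := by
    ext j
    rw [expo_apply, getD_map_range, Finsupp.single_apply]
    simp [Fin.ext_iff, eq_comm]
  rw [val, poly_one, map_one, div_one, poly_cons, poly_nil, add_zero, h]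
  rfl

/-- Codable fractions are closed under the field operations and contain the generators. Words carry
no sign, so negation needs the name of `-1` among the prescribed ones. -/
theorem codable_of_mem {S : List ℕ} (hS : ν.negName ∈ S) {z : RatFun n}
    (hz : z ∈ RatFun.ratField (Subfield.closure (ν.val '' {a | a ∈ S})) Set.univ) :
    Codable ν n S z := by
  have hneg {y : RatFun n} (hy : Codable ν n S y) : Codable ν n S (-y) := by
    have := (codable_val (n := n) hS).mul hy
    rwa [ν.val_negName, map_neg, map_one, neg_one_mul] at this
  induction hz using Subfield.closure_induction with
  | mem x hx =>
    rcases hx with ⟨c, hc, rfl⟩ | ⟨i, -, rfl⟩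
    · induction hc using Subfield.closure_induction with
      | mem x hx => obtain ⟨a, ha, rfl⟩ := hx; exact codable_val ha
      | one => rw [map_one]; exact codable_one S
      | add x y _ _ hx hy => rw [map_add]; exact hx.add hy
      | neg x _ hx => rw [map_neg]; exact hneg hx
      | inv x _ hx => rw [map_inv₀]; exact hx.inv
      | mul x y _ _ hx hy => rw [map_mul]; exact hx.mul hy
    · exact codable_var S i
  | one => exact codable_one S
  | add x y _ _ hx hy => exact hx.add hy
  | neg x _ hx => exact hneg hx
  | inv x _ hx => exact hx.inv
  | mul x y _ _ hx hy => exact hx.mul hy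

/-- The conversion to a code. -/
def toRatCode (ν : AlgebraicNumberCoding) (f : WordFrac) : RatCode :=
  (toPolyCode ν f.1, toPolyCode ν f.2)

@[fun_prop] theorem computable_toRatCode (ν : AlgebraicNumberCoding) {α : Type*} [Primcodable α]
    {f : α → WordFrac} (hf : Computable f) : Computable fun a => toRatCode ν (f a) := by
  unfold toRatCode; fun_prop

@[simp] theorem ratFun_toRatCode (f : WordFrac) : ν.ratFun n (toRatCode ν f) = val ν n f := by
  simp [AlgebraicNumberCoding.ratFun, toRatCode, val]

end WordFrac

/-! ### Recognition of minimal polynomials over `ℤ`. -/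

section

open Polynomial

/-- The monic integer polynomial with coefficients `c - B`, for `c` in the list `l`, the leading
ones first. -/
def intPoly (l : List ℕ) (B : ℕ) : ℤ[X] :=
  l.foldl (fun (p : ℤ[X]) (c : ℕ) => p * X + C ((c : ℤ) - B)) 1

@[simp] theorem intPoly_nil (B : ℕ) : intPoly [] B = 1 := rfl

theorem intPoly_concat (l : List ℕ) (c B : ℕ) :
    intPoly (l ++ [c]) B = intPoly l B * X + C ((c : ℤ) - B) := by
  rw [intPoly, List.foldl_append]; rfl

theorem monic_natDegree_intPoly (l : List ℕ) (B : ℕ) :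
    (intPoly l B).Monic ∧ (intPoly l B).natDegree = l.length := by
  induction l using List.reverseRecOn with
  | nil => simp
  | append_singleton l c ih =>
    have h1 : (intPoly l B * X).natDegree = l.length + 1 := by
      rw [natDegree_mul_X ih.1.ne_zero, ih.2]
    have h2 : (intPoly l B * X).Monic := ih.1.mul monic_X
    have h3 : (C ((c : ℤ) - B)).degree < (intPoly l B * X).degree := by
      rw [degree_eq_natDegree h2.ne_zero, h1]
      exact degree_C_le.trans_lt (by exact_mod_cast Nat.succ_pos _)
    rw [intPoly_concat, List.length_append, List.length_singleton]
    exact ⟨h2.add_of_left h3, by rw [natDegree_add_C, h1]⟩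

theorem coeff_intPoly_cons (c : ℕ) (l : List ℕ) (B : ℕ) :
    (intPoly (c :: l) B).coeff l.length = (c : ℤ) - B := by
  induction l using List.reverseRecOn with
  | nil => simp [intPoly]
  | append_singleton l d ih =>
    rw [← List.cons_append, intPoly_concat, List.length_append, List.length_singleton, coeff_add,
      coeff_mul_X, ih, coeff_C_succ, add_zero]

theorem nextCoeff_intPoly_cons (c : ℕ) (l : List ℕ) (B : ℕ) :
    (intPoly (c :: l) B).nextCoeff = (c : ℤ) - B := by
  rw [nextCoeff_of_natDegree_pos, (monic_natDegree_intPoly _ _).2, List.length_cons,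
    Nat.add_sub_cancel, coeff_intPoly_cons]
  rw [(monic_natDegree_intPoly _ _).2, List.length_cons]; omega

theorem abs_coeff_intPoly_le {l : List ℕ} {B : ℕ} (hl : ∀ c ∈ l, c ≤ 2 * B) (i : ℕ)
    (hi : i < l.length) : |(intPoly l B).coeff i| ≤ B := by
  induction l using List.reverseRecOn generalizing i with
  | nil => simp at hi
  | append_singleton l d ih =>
    rw [intPoly_concat, coeff_add]
    cases i with
    | zero =>
      have := hl d (by simp)
      rw [mul_coeff_zero, coeff_X_zero, mul_zero, zero_add, coeff_C_zero, abs_le]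
      omega
    | succ i =>
      rw [coeff_mul_X, coeff_C_succ, add_zero]
      exact ih (fun c hc => hl c (List.mem_append_left _ hc)) i (by simpa using hi)

/-- The constant term is peeled off at each step. Shifting by `B` writes integers of absolute value
at most `B` as natural numbers, so lists of naturals below a bound enumerate all candidates. -/
theorem exists_intPoly_eq {p : ℤ[X]} (hp : p.Monic) {B : ℕ} (hB : ∀ i, |p.coeff i| ≤ B) :
    ∃ l, intPoly l B = p ∧ ∀ c ∈ l, c ≤ 2 * B := by
  induction hd : p.natDegree generalizing p with
  | zero => exact ⟨[], by rw [intPoly_nil, hp.natDegree_eq_zero.1 hd], by simp⟩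
  | succ d ih =>
    have h1 : p.divX.natDegree = d := by rw [natDegree_divX_eq_natDegree_tsub_one, hd]; rfl
    have h2 : p.divX.Monic := by
      rw [Monic, leadingCoeff, h1, coeff_divX, ← hd]
      exact hp
    obtain ⟨l, hl, hlB⟩ := ih h2 (fun i => by rw [coeff_divX]; exact hB _) h1
    have h0 := abs_le.1 (hB 0)
    refine ⟨l ++ [(p.coeff 0 + B).toNat], ?_, fun c hc => ?_⟩
    · have h3 : (((p.coeff 0 + B).toNat : ℕ) : ℤ) = p.coeff 0 + B := Int.toNat_of_nonneg (by omega)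
      rw [intPoly_concat, hl, h3, add_sub_cancel_right, divX_mul_X_add]
    · rcases List.mem_append.1 hc with hc | hc
      · exact hlB c hc
      · rw [List.mem_singleton] at hc
        omega

/-- The lists of length less than `d` with entries less than `M`. -/
def boundedLists (M d : ℕ) : List (List ℕ) :=
  Nat.rec [] (fun _ s => [] :: s.flatMap fun l => (List.range M).map fun c => c :: l) d

theorem mem_boundedLists {M d : ℕ} {l : List ℕ} :
    l ∈ boundedLists M d ↔ l.length < d ∧ ∀ c ∈ l, c < M := by
  induction d generalizing l with
  | zero => simp [boundedLists]
  | succ d ih =>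
    have h : boundedLists M (d + 1) =
        [] :: (boundedLists M d).flatMap fun l => (List.range M).map fun c => c :: l := rfl
    rw [h]
    cases l with
    | nil => simp
    | cons a l => simp [ih, and_left_comm]

/-- A bound for the coefficients of the divisors of `intPoly l B`. -/
def divisorBound (l : List ℕ) (B : ℕ) : ℕ := (2 * (B + 1)) ^ l.length

@[fun_prop] theorem computable_boundedLists {α : Type*} [Primcodable α] {f g : α → ℕ}
    (hf : Computable f) (hg : Computable g) : Computable fun a => boundedLists (f a) (g a) := by
  unfold boundedLists
  fun_prop

@[fun_prop] theorem computable_divisorBound {α : Type*} [Primcodable α] {f : α → List ℕ}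
    {g : α → ℕ} (hf : Computable f) (hg : Computable g) :
    Computable fun a => divisorBound (f a) (g a) := by
  unfold divisorBound; fun_prop

/-- Cauchy's bound for the roots of a monic polynomial whose other coefficients have absolute value
at most `B`. -/
theorem norm_le_of_aeval_intPoly {l : List ℕ} {B : ℕ} (hl : ∀ c ∈ l, c ≤ 2 * B) {z : ℂ}
    (hz : aeval z (intPoly l B) = 0) : ‖z‖ ≤ B + 1 := by
  obtain ⟨hm, hd⟩ := monic_natDegree_intPoly l B
  have hm' := hm.map (Int.castRingHom ℂ)
  have hroot : ((intPoly l B).map (Int.castRingHom ℂ)).IsRoot z := by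
    rw [IsRoot.def, eval_map]
    exact hz
  have hlt : ‖z‖ ≤ (cauchyBound ((intPoly l B).map (Int.castRingHom ℂ)) : ℝ) :=
    NNReal.coe_le_coe.2 (hroot.norm_lt_cauchyBound hm'.ne_zero).le
  refine hlt.trans ?_
  rw [cauchyBound, hm'.leadingCoeff]
  push_cast
  gcongr
  have : (Finset.range ((intPoly l B).map (Int.castRingHom ℂ)).natDegree).sup
      (fun i => ‖((intPoly l B).map (Int.castRingHom ℂ)).coeff i‖₊) ≤ (B : NNReal) := by
    refine Finset.sup_le fun i hi => ?_
    rw [Finset.mem_range, hm.natDegree_map, hd] at hi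
    rw [← NNReal.coe_le_coe, coe_nnnorm, coeff_map, eq_intCast, Complex.norm_intCast]
    have := (Int.cast_le (R := ℝ)).2 (abs_coeff_intPoly_le hl i hi)
    rw [Int.cast_abs, Int.cast_natCast] at this
    rw [NNReal.coe_natCast]
    exact this
  simpa using (NNReal.coe_le_coe.2 this)

/-- The minimal polynomial divides `intPoly l B`, so its roots have modulus at most `B + 1` and its
coefficients are at most `2^d (B+1)^d`, with `d` the length of `l`. If its degree were smaller, it
would thus be one of the finitely many polynomials excluded by `h`. -/
theorem minpoly_eq_intPoly {l : List ℕ} {B : ℕ} (hl : ∀ c ∈ l, c ≤ 2 * B) {z : ℂ}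
    (hz : aeval z (intPoly l B) = 0)
    (h : ∀ l' ∈ boundedLists (2 * divisorBound l B + 1) l.length,
      aeval z (intPoly l' (divisorBound l B)) ≠ 0) :
    minpoly ℤ z = intPoly l B := by
  obtain ⟨hm, hd⟩ := monic_natDegree_intPoly l B
  have hint : IsIntegral ℤ z := ⟨_, hm, hz⟩
  have hdvd := minpoly.isIntegrallyClosed_dvd hint hz
  have hgm := minpoly.monic hint
  rcases lt_or_ge (minpoly ℤ z).natDegree l.length with hlt | hge
  · exfalso
    have hcoeff (i : ℕ) : |(minpoly ℤ z).coeff i| ≤ (divisorBound l B : ℕ) := by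
      have hroots : ∀ w ∈ ((minpoly ℤ z).map (Int.castRingHom ℂ)).roots, ‖w‖ ≤ (B : ℝ) + 1 := by
        intro w hw
        have h1 := (mem_roots'.1 hw).2
        rw [IsRoot.def, eval_map] at h1
        refine norm_le_of_aeval_intPoly hl ?_
        obtain ⟨c, hc⟩ := hdvd
        rw [hc, map_mul]
        change eval₂ (algebraMap ℤ ℂ) w _ * _ = 0
        rw [show eval₂ (algebraMap ℤ ℂ) w (minpoly ℤ z) = 0 from h1, zero_mul]
      have hb := coeff_le_of_roots_le (B := (B : ℝ) + 1) (f := Int.castRingHom ℂ) i hgm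
        (IsAlgClosed.splits _) hroots
      rw [coeff_map, eq_intCast, Complex.norm_intCast] at hb
      have h1 : ((B : ℝ) + 1) ^ ((minpoly ℤ z).natDegree - i) ≤ ((B : ℝ) + 1) ^ l.length :=
        pow_le_pow_right₀ (by linarith [Nat.cast_nonneg (α := ℝ) B]) (by omega)
      have h2 : (((minpoly ℤ z).natDegree.choose i : ℕ) : ℝ) ≤ 2 ^ l.length := by
        exact_mod_cast (Nat.choose_le_two_pow _ _).trans (Nat.pow_le_pow_right (by norm_num) hlt.le)
      have h3 : ((|(minpoly ℤ z).coeff i| : ℤ) : ℝ) ≤ ((divisorBound l B : ℕ) : ℝ) := by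
        rw [divisorBound]
        push_cast
        rw [mul_pow, mul_comm ((2 : ℝ) ^ _)]
        exact hb.trans (mul_le_mul h1 h2 (by positivity) (by positivity))
      exact_mod_cast h3
    obtain ⟨l', hl', hlB'⟩ := exists_intPoly_eq hgm hcoeff
    refine h l' (mem_boundedLists.2 ⟨?_, fun c hc => Nat.lt_succ_of_le (hlB' c hc)⟩) ?_
    · rw [← (monic_natDegree_intPoly l' (divisorBound l B)).2, hl']; exact hlt
    · rw [hl', minpoly.aeval]
  · exact (eq_of_monic_of_dvd_of_natDegree_le hgm hm hdvd (by rw [hd]; exact hge)).symm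

namespace AlgebraicNumberCoding

variable (ν : AlgebraicNumberCoding)

/-- The value of `intPoly l B` at the number named `a`. -/
def intPolyWords (a : ℕ) (l : List ℕ) (B : ℕ) : WordSum :=
  l.foldl (fun s c => (s.map fun u => a :: u) ++ List.replicate c [] ++
    List.replicate B [ν.negName]) [[]]

@[fun_prop] theorem computable_intPolyWords {α : Type*} [Primcodable α] {f g : α → ℕ}
    {l : α → List ℕ} (hf : Computable f) (hl : Computable l) (hg : Computable g) :
    Computable fun a => ν.intPolyWords (f a) (l a) (g a) := by
  unfold intPolyWords; fun_prop

@[simp] theorem sumVal_intPolyWords (a : ℕ) (l : List ℕ) (B : ℕ) :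
    ν.sumVal (ν.intPolyWords a l B) = aeval (ν.val a) (intPoly l B) := by
  induction l using List.reverseRecOn with
  | nil => simp [intPolyWords]
  | append_singleton l c ih =>
    have h : ν.intPolyWords a (l ++ [c]) B = ((ν.intPolyWords a l B).map fun u => a :: u) ++
        List.replicate c [] ++ List.replicate B [ν.negName] := by
      rw [intPolyWords, List.foldl_append]; rfl
    rw [h, sumVal_append, sumVal_append, sumVal_map_cons, ih, intPoly_concat]
    simp
    ring

/-- The test that `intPoly l B` is the minimal polynomial of the number named `a`. -/
def isMinpoly (a : ℕ) (l : List ℕ) (B : ℕ) : Bool :=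
  (l.all fun c => decide (c ≤ 2 * B)) && ν.isZero (ν.intPolyWords a l B) &&
    (boundedLists (2 * divisorBound l B + 1) l.length).all fun l' =>
      !ν.isZero (ν.intPolyWords a l' (divisorBound l B))

@[fun_prop] theorem computable_isMinpoly {α : Type*} [Primcodable α] {f g : α → ℕ}
    {l : α → List ℕ} (hf : Computable f) (hl : Computable l) (hg : Computable g) :
    Computable fun a => ν.isMinpoly (f a) (l a) (g a) := by
  unfold isMinpoly; fun_prop

theorem minpoly_eq_of_isMinpoly {a : ℕ} {l : List ℕ} {B : ℕ} (h : ν.isMinpoly a l B = true) :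
    IsIntegral ℤ (ν.val a) ∧ minpoly ℤ (ν.val a) = intPoly l B := by
  simp only [isMinpoly, Bool.and_eq_true, List.all_eq_true, decide_eq_true_iff, isZero_iff,
    sumVal_intPolyWords, Bool.not_eq_true', ← Bool.not_eq_true] at h
  exact ⟨⟨_, (monic_natDegree_intPoly l B).1, h.1.2⟩, minpoly_eq_intPoly h.1.1 h.1.2 h.2⟩

theorem exists_isMinpoly {a : ℕ} (h : IsIntegral ℤ (ν.val a)) :
    ∃ l B, ν.isMinpoly a l B = true := by
  set p := minpoly ℤ (ν.val a) with hp
  have hm : p.Monic := minpoly.monic h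
  obtain ⟨l, hl, hlB⟩ := exists_intPoly_eq (p := p) hm
    (B := p.support.sup fun i => (p.coeff i).natAbs) fun i => by
      by_cases hi : i ∈ p.support
      · rw [Int.abs_eq_natAbs]
        exact_mod_cast Finset.le_sup (f := fun i => (p.coeff i).natAbs) hi
      · rw [notMem_support_iff.1 hi, abs_zero]; positivity
  refine ⟨l, p.support.sup fun i => (p.coeff i).natAbs, ?_⟩
  simp only [isMinpoly, Bool.and_eq_true, List.all_eq_true, decide_eq_true_iff, isZero_iff,
    sumVal_intPolyWords, Bool.not_eq_true', ← Bool.not_eq_true]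
  refine ⟨⟨hlB, by rw [hl, hp, minpoly.aeval]⟩, fun l' hl' h0 => ?_⟩
  obtain ⟨hm', hd'⟩ := monic_natDegree_intPoly l'
    (divisorBound l (p.support.sup fun i => (p.coeff i).natAbs))
  have h1 := minpoly.min ℤ (ν.val a) hm' h0
  have h2 := natDegree_le_natDegree h1
  rw [hd', ← hp, ← hl, (monic_natDegree_intPoly _ _).2] at h2
  exact absurd (mem_boundedLists.1 hl').1 (not_lt.2 h2)

end AlgebraicNumberCoding

end

/-! ### Representations on the powers of one algebraic integer. -/

section

open Polynomial RationalIntegration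

theorem exists_common_denominator {ι : Type*} [Fintype ι] (f : ι → ℚ) :
    ∃ d : ℕ, 0 < d ∧ ∀ i, ∃ m : ℤ, (m : ℚ) = d * f i := by
  refine ⟨∏ i, (f i).den, Finset.prod_pos fun i _ => (f i).pos, fun i => ?_⟩
  obtain ⟨c, hc⟩ := Finset.dvd_prod_of_mem (fun i => (f i).den) (Finset.mem_univ i)
  refine ⟨c * (f i).num, ?_⟩
  rw [hc]
  push_cast
  rw [mul_right_comm, Rat.den_mul_eq_num, mul_comm]

/-- Repeating the bound `B` as first entry of the list makes the second leading coefficient `B - B =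
0`. -/
theorem isTraceless_of_mul_eq {l : List ℕ} {B D : ℕ} {z E : ℂ} (hE : IsIntegral ℤ E)
    (hmin : minpoly ℤ E = intPoly (B :: l) B) (hD : 0 < D) (hz : (D : ℂ) * z = E) :
    z ∈ tracelessSubmodule := by
  have h1 : minpoly ℚ E = (minpoly ℤ E).map (algebraMap ℤ ℚ) :=
    minpoly.isIntegrallyClosed_eq_field_fractions' ℚ hE
  have h2 : E ∈ tracelessSubmodule := by
    refine mem_tracelessSubmodule.2 ⟨(hE.tower_top (A := ℚ)).isAlgebraic, ?_⟩
    rw [IsTraceless, h1, hmin, nextCoeff_map (algebraMap ℤ ℚ).injective_int,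
      nextCoeff_intPoly_cons, sub_self, map_zero]
  have h3 : z = ((D : ℚ)⁻¹) • E := by
    have hD' : (D : ℂ) ≠ 0 := by exact_mod_cast hD.ne'
    rw [← hz, Algebra.smul_def]
    push_cast
    simp [hD']
  rw [h3]
  exact tracelessSubmodule.smul_mem _ h2

/-- A relation with coefficients `g` is a polynomial of degree at most `p` vanishing at `θ`, hence
zero, and its coefficient of degree `k + 1` is `g k * u k`. The constants `w` play no role because
the power `0` is not used. -/
theorem linearIndependent_of_affine_powers {p : ℕ} {θ : ℂ} (hp : p < (minpoly ℚ θ).natDegree)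
    {lam : Fin p → ℂ} {u w : Fin p → ℚ} (hu : ∀ k, u k ≠ 0)
    (h : ∀ k, lam k = (u k : ℂ) * θ ^ ((k : ℕ) + 1) + (w k : ℂ)) : LinearIndependent ℚ lam := by
  rw [Fintype.linearIndependent_iff]
  intro g hg k
  set P : ℚ[X] := ∑ j : Fin p, (C (g j * u j) * X ^ ((j : ℕ) + 1) + C (g j * w j)) with hP
  have h0 : aeval θ P = 0 := by
    rw [← hg, hP, map_sum]
    refine Finset.sum_congr rfl fun j _ => ?_
    rw [h, Algebra.smul_def]
    simp
    ring
  have hdeg : P.degree < (minpoly ℚ θ).degree := by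
    refine lt_of_le_of_lt (b := (p : WithBot ℕ)) ?_ ?_
    · refine (degree_sum_le _ _).trans (Finset.sup_le fun j _ => ?_)
      refine (degree_add_le _ _).trans (max_le ((degree_C_mul_X_pow_le _ _).trans ?_)
        (degree_C_le.trans ?_))
      · exact_mod_cast j.2
      · exact_mod_cast Nat.zero_le p
    · rw [degree_eq_natDegree fun h0 => by rw [h0] at hp; simp at hp]
      exact_mod_cast hp
  have hP0 : P = 0 := by
    by_contra hne
    exact absurd (minpoly.degree_le_of_ne_zero ℚ θ hne h0) (not_le.2 hdeg)
  have hc := congrArg (fun q => coeff q ((k : ℕ) + 1)) hP0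
  simp only [hP, finsetSum_coeff, coeff_add, coeff_C_mul, coeff_X_pow, coeff_C_succ, add_zero,
    coeff_zero] at hc
  rw [Finset.sum_eq_single k] at hc
  · simpa [hu k] using hc
  · intro j _ hj
    rw [if_neg, mul_zero]
    intro h; exact hj (Fin.ext (by omega))
  · simp

theorem eq_zero_of_ratCast_mem {ρ : ℚ} (h : (ρ : ℂ) ∈ tracelessSubmodule) : ρ = 0 := by
  have h1 := (mem_tracelessSubmodule.1 h).2
  have h2 : minpoly ℚ ((ρ : ℚ) : ℂ) = X - C ρ := minpoly.eq_X_sub_C ℂ ρ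
  rw [IsTraceless, h2, nextCoeff_X_sub_C, neg_eq_zero] at h1
  exact h1

theorem exists_eq_adjoin_simple {F E : Type*} [Field F] [CharZero F] [Field E] [Algebra F E]
    (S : IntermediateField F E) [FiniteDimensional F S] :
    ∃ α : E, S = IntermediateField.adjoin F {α} := by
  obtain ⟨α, hα⟩ := Field.exists_primitive_element F S
  refine ⟨α, ?_⟩
  have h := congrArg (IntermediateField.map S.val) hα
  rw [IntermediateField.adjoin_map, Set.image_singleton, ← AlgHom.fieldRange_eq_map,
    IntermediateField.fieldRange_val] at h
  exact h.symm

theorem exists_integral_generator {ι : Type*} [Finite ι] (z : ι → ℂ)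
    (hz : ∀ i, IsAlgebraic ℚ (z i)) :
    ∃ θ : ℂ, IsIntegral ℤ θ ∧ ∀ i, z i ∈ IntermediateField.adjoin ℚ {θ} := by
  have hfin : FiniteDimensional ℚ (IntermediateField.adjoin ℚ (Set.range z)) :=
    IntermediateField.finiteDimensional_adjoin fun x hx => by
      obtain ⟨i, rfl⟩ := hx; exact (hz i).isIntegral
  obtain ⟨α, hα⟩ := exists_eq_adjoin_simple (IntermediateField.adjoin ℚ (Set.range z))
  have hαalg : IsAlgebraic ℚ α := by
    rw [hα] at hfin
    have h1 : IsAlgebraic ℚ (⟨α, IntermediateField.mem_adjoin_simple_self ℚ α⟩ :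
      IntermediateField.adjoin ℚ {α}) := Algebra.IsAlgebraic.isAlgebraic _
    exact h1.algebraMap (A := ℂ)
  obtain ⟨y, hy, hint⟩ := ((IsFractionRing.isAlgebraic_iff ℤ ℚ ℂ).2 hαalg).exists_integral_multiple
  refine ⟨y • α, hint, fun i => ?_⟩
  have h1 : α ∈ IntermediateField.adjoin ℚ {y • α} := by
    have h2 := (IntermediateField.adjoin ℚ {y • α}).smul_mem
      (IntermediateField.mem_adjoin_simple_self ℚ (y • α)) (x := ((y : ℚ))⁻¹)
    have hy' : (y : ℂ) ≠ 0 := by exact_mod_cast hy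
    have h3 : ((y : ℚ)⁻¹) • (y • α) = α := by
      rw [Algebra.smul_def, zsmul_eq_mul]
      push_cast
      simp [hy']
    rwa [h3] at h2
  have h4 : z i ∈ IntermediateField.adjoin ℚ {α} := by
    rw [← hα]
    exact IntermediateField.subset_adjoin ℚ _ ⟨i, rfl⟩
  exact (IntermediateField.adjoin_simple_le_iff.2 h1) h4

/-- Expand `z` in powers of `θ` and replace each power by its traceless part. The error is a
rational number which is also traceless, hence zero. So the constant power can be dropped and `p`,
one less than the degree, terms remain. -/
theorem exists_eq_sum_powers {θ z : ℂ} (hθ : IsIntegral ℚ θ)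
    (hz : z ∈ IntermediateField.adjoin ℚ {θ}) (ht : z ∈ tracelessSubmodule) {p : ℕ}
    (hp : (minpoly ℚ θ).natDegree = p + 1) :
    ∃ c : Fin p → ℚ, z = ∑ k, (c k : ℂ) *
      (θ ^ ((k : ℕ) + 1) - (meanTrace (θ ^ ((k : ℕ) + 1)) : ℂ)) := by
  obtain ⟨g, hg⟩ : ∃ g : ℚ[X], z = aeval θ g := by
    have h1 : z ∈ (IntermediateField.adjoin ℚ {θ}).toSubalgebra := hz
    rw [IntermediateField.adjoin_simple_toSubalgebra_of_isAlgebraic hθ.isAlgebraic,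
      Algebra.adjoin_singleton_eq_range_aeval] at h1
    obtain ⟨g, hg⟩ := h1
    exact ⟨g, hg.symm⟩
  set f := g %ₘ minpoly ℚ θ with hf
  have hzf : z = aeval θ f := by
    rw [hg, hf, ← aeval_modByMonic_eq_self_of_root (minpoly.aeval ℚ θ)]
  have hdeg : f.natDegree < p + 1 := by
    rw [← hp]
    exact natDegree_modByMonic_lt _ (minpoly.monic hθ) (minpoly.ne_one ℚ θ)
  have hsum : z = (f.coeff 0 : ℂ) + ∑ k : Fin p, (f.coeff (k + 1) : ℂ) * θ ^ ((k : ℕ) + 1) := by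
    rw [hzf, aeval_eq_sum_range' hdeg, Finset.sum_range_succ', add_comm, Finset.sum_range]
    simp [Algebra.smul_def]
  refine ⟨fun k => f.coeff (k + 1), ?_⟩
  have hmem : z - ∑ k : Fin p, (f.coeff (k + 1) : ℂ) *
      (θ ^ ((k : ℕ) + 1) - (meanTrace (θ ^ ((k : ℕ) + 1)) : ℂ)) ∈ tracelessSubmodule := by
    refine sub_mem ht (sum_mem fun k _ => ?_)
    have h1 := tracelessSubmodule.smul_mem (f.coeff (k + 1))
      (sub_meanTrace_mem (hθ.pow ((k : ℕ) + 1)).isAlgebraic)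
    rwa [Algebra.smul_def] at h1
  have heq : z - ∑ k : Fin p, (f.coeff (k + 1) : ℂ) *
      (θ ^ ((k : ℕ) + 1) - (meanTrace (θ ^ ((k : ℕ) + 1)) : ℂ)) =
      ((f.coeff 0 + ∑ k : Fin p, f.coeff (k + 1) * meanTrace (θ ^ ((k : ℕ) + 1)) : ℚ) : ℂ) := by
    conv_lhs => rw [hsum]
    simp only [mul_sub, Finset.sum_sub_distrib]
    push_cast
    ring
  rw [heq] at hmem
  rw [eq_zero_of_ratCast_mem hmem, Rat.cast_zero, sub_eq_zero] at heq
  exact heq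

namespace HyperexpData

variable {n : ℕ} {K : Subfield ℂ} {ω : RatForm n} {r : HyperexpData n}

theorem IsRepresentation.lam_mem [NumberField K] (h : r.IsRepresentation K ω) (j : Fin r.p) :
    r.lam j ∈ tracelessSubmodule := by
  refine mem_tracelessSubmodule.2 ⟨?_, h.traceless j⟩
  have := h.finite
  have h1 : IsAlgebraic K (⟨r.lam j, IntermediateField.subset_adjoin K _ ⟨j, rfl⟩⟩ :
    r.constField K) := Algebra.IsAlgebraic.isAlgebraic _
  have h2 : IsAlgebraic K (r.lam j) := h1.algebraMap (A := ℂ)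
  exact h2.restrictScalars ℚ

/-- A representation in which the `λ_k` are affine functions of the powers of one algebraic
integer. -/
theorem IsRepresentation.exists_powers [NumberField K] (h : r.IsRepresentation K ω) :
    ∃ (θ : ℂ) (r' : HyperexpData n) (D U : ℕ) (w : Fin r'.p → ℤ), IsIntegral ℤ θ ∧
      (minpoly ℚ θ).natDegree = r'.p + 1 ∧ r'.IsRepresentation K ω ∧ 0 < D ∧ 0 < U ∧
      ∀ k, (D : ℂ) * r'.lam k = U * θ ^ ((k : ℕ) + 1) - w k := by
  obtain ⟨θ, hθ, hmem⟩ := exists_integral_generator r.lam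
    fun j => (mem_tracelessSubmodule.1 (h.lam_mem j)).1
  have hθ' : IsIntegral ℚ θ := hθ.tower_top
  obtain ⟨p, hp⟩ : ∃ p, (minpoly ℚ θ).natDegree = p + 1 :=
    ⟨_, (Nat.succ_pred_eq_of_pos (minpoly.natDegree_pos hθ')).symm⟩
  choose c hc using fun j => exists_eq_sum_powers hθ' (hmem j) (h.lam_mem j) hp
  obtain ⟨d, hd, hm⟩ := exists_common_denominator fun x : Fin r.p × Fin p => c x.1 x.2
  choose m hm using fun j k => hm (j, k)
  obtain ⟨U, hU, hw⟩ := exists_common_denominator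
    fun k : Fin p => meanTrace (θ ^ ((k : ℕ) + 1))
  choose w hw using hw
  have hd' : (d : ℂ) ≠ 0 := by exact_mod_cast hd.ne'
  have hU' : (U : ℂ) ≠ 0 := by exact_mod_cast hU.ne'
  -- Dividing by the common denominator `d` makes the old exponents integer combinations of the new
  -- ones, so the new functions are products of integer powers of the old.
  set lam : Fin p → ℂ := fun k =>
    (θ ^ ((k : ℕ) + 1) - (meanTrace (θ ^ ((k : ℕ) + 1)) : ℂ)) / d with hlam
  have hlamt (k) : lam k ∈ tracelessSubmodule := by
    have h1 := tracelessSubmodule.smul_mem ((d : ℚ)⁻¹)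
      (sub_meanTrace_mem (hθ'.pow ((k : ℕ) + 1)).isAlgebraic)
    rw [Algebra.smul_def] at h1
    simp only [hlam]
    rw [div_eq_inv_mul]
    simpa using h1
  have hsum (j) : r.lam j = ∑ k, (m j k : ℂ) * lam k := by
    rw [hc j]
    refine Finset.sum_congr rfl fun k _ => ?_
    have h1 : ((m j k : ℤ) : ℂ) = d * (c j k : ℂ) := by
      exact_mod_cast congrArg (Rat.cast (K := ℂ)) (hm j k)
    rw [h1, hlam]
    field_simp
  let r' : HyperexpData n :=
    ⟨r.F0, r.A, r.q, p, lam, fun k => ∏ j, r.F j ^ (m j k)⟩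
  have hform : ω = RatForm.d r'.F0 + (RatFun.const n (1 / (r'.q : ℂ))) • RatForm.dlog r'.A +
      ∑ j, RatFun.const n (r'.lam j) • RatForm.dlog (r'.F j) := by
    rw [← RationalIntegration.sum_smul_dlog_eq r.lam r.F h.F_ne_zero r'.lam r'.F m hsum
      fun _ => rfl]
    exact h.form_eq
  -- Here `w k` is the integer `U` times the mean trace of `θ ^ (k + 1)`; multiplying `lam k` by `U
  -- * d` clears both denominators.
  refine ⟨θ, r', U * d, U, w, hθ, hp, ⟨h.F0_mem, h.A_mem, h.A_ne_zero, h.q_pos, ?_, fun k => ?_,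
    fun k => ?_, fun k => (mem_tracelessSubmodule.1 (hlamt k)).2, ?_, hform,
    fun V g hg => hg.hasLogDifferential h.q_pos hform⟩, Nat.mul_pos hU hd, hU, fun k => ?_⟩
  · refine IntermediateField.finiteDimensional_adjoin fun x hx => ?_
    obtain ⟨j, rfl⟩ := hx
    exact ((mem_tracelessSubmodule.1 (hlamt j)).1.isIntegral).tower_top
  · change (∏ j, r.F j ^ (m j k)) ∈ _
    refine prod_mem fun j _ => zpow_mem (RatFun.ratField_mono ?_ le_rfl (h.F_mem j)) _
    change IntermediateField.adjoin K (Set.range r.lam) ≤ r'.constField K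
    rw [IntermediateField.adjoin_le_iff]
    rintro _ ⟨j, rfl⟩
    rw [hsum]
    exact sum_mem fun k _ => mul_mem (intCast_mem _ _)
      (IntermediateField.subset_adjoin K _ ⟨k, rfl⟩)
  · change (∏ j, r.F j ^ (m j k)) ≠ 0
    exact Finset.prod_ne_zero_iff.2 fun j _ => zpow_ne_zero _ (h.F_ne_zero j)
  · refine linearIndependent_of_affine_powers (θ := θ) (p := p) (by omega)
      (u := fun _ => (d : ℚ)⁻¹) (w := fun k => -(meanTrace (θ ^ ((k : ℕ) + 1)) / d))
      (fun _ => inv_ne_zero (by exact_mod_cast hd.ne')) fun k => ?_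
    change lam k = _
    rw [hlam]
    push_cast
    ring
  · change ((U * d : ℕ) : ℂ) * lam k = _
    have h1 : ((w k : ℤ) : ℂ) = U * (meanTrace (θ ^ ((k : ℕ) + 1)) : ℂ) := by
      exact_mod_cast congrArg (Rat.cast (K := ℂ)) (hw k)
    rw [h1, hlam]
    push_cast
    field_simp

end HyperexpData

end

/-! ### Certificates for representations and the search for one. -/

section

open WordPoly

/-- A certificate for one term `F ^ λ`: a name of `λ`, a code of `F`, a name of a number `E`, pairs
`(D, U)` and `(w₁, w₂)`, a list `l` and a bound `B`. It asserts that, for a given `θ` and the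
position `k` of the term, `D λ = E = U θ ^ (k + 1) + w₂ - w₁` has the minimal polynomial
`intPoly (B :: l) B`. -/
abbrev TermCertificate : Type := ℕ × WordFrac × ℕ × (ℕ × ℕ) × (ℕ × ℕ) × List ℕ × ℕ

/-- A certificate for a representation: codes of `F₀` and `A`, the number `q`, a name of an
algebraic integer `θ` with its minimal polynomial, and the certificates of the terms. -/
abbrev Certificate : Type := WordFrac × WordFrac × ℕ × (ℕ × List ℕ × ℕ) × List TermCertificate

namespace AlgebraicNumberCoding

variable (ν : AlgebraicNumberCoding) (n : ℕ)

/-- The test that `f` is the code of a fraction with coefficients named in `S`. -/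
def isFrac (S : List ℕ) (f : WordFrac) : Bool :=
  uses S f.1 && uses S f.2 && !WordPoly.isZero ν n f.2

/-- The test of the number in the certificate of a term. -/
def checkTerm (θ k : ℕ) (t : TermCertificate) : Bool :=
  decide (1 ≤ t.2.2.2.1.1) && decide (1 ≤ t.2.2.2.1.2) &&
  ν.isZero (List.replicate t.2.2.2.1.1 [t.1] ++ [[ν.negName, t.2.2.1]]) &&
  ν.isZero (List.replicate t.2.2.2.1.2 (List.replicate (k + 1) θ) ++
    List.replicate t.2.2.2.2.1.2 [] ++ List.replicate t.2.2.2.2.1.1 [ν.negName] ++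
    [[ν.negName, t.2.2.1]]) &&
  ν.isMinpoly t.2.2.1 (t.2.2.2.2.2.2 :: t.2.2.2.2.2.1) t.2.2.2.2.2.2

/-- The coefficient of `dx_i` in `∑ λ dF / F`. -/
def termSum (i : ℕ) (l : List TermCertificate) : WordFrac :=
  l.foldl (fun s t => WordFrac.add n s
    (WordFrac.mul n ([([], [t.1])], one) (WordFrac.dlog ν n i t.2.1))) ([], one)

/-- The coefficient of `dx_i` in the logarithmic differential of the expression. -/
def certificateForm (i : ℕ) (z : Certificate) : WordFrac :=
  WordFrac.add n (WordFrac.pd ν n i z.1) (WordFrac.add n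
    (WordFrac.mul n (one, List.replicate z.2.2.1 ([], [])) (WordFrac.dlog ν n i z.2.1))
    (termSum ν n i z.2.2.2.2))

/-- The test that the code `g` and the fraction `f` define the same rational function. -/
def eqFrac (g : RatCode) (f : WordFrac) : Bool :=
  bif WordPoly.isZero ν n (ofPolyCode g.2) then WordPoly.isZero ν n f.1
  else WordPoly.isZero ν n (WordPoly.mul n (ofPolyCode g.1) f.2 ++
    smul ν.negName (WordPoly.mul n (ofPolyCode g.2) f.1))

/-- The test of the data of a certificate that determine the expression. -/
def checkData (a : ℕ) (z : Certificate) : Bool :=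
  isFrac ν n [ν.negName, a] z.1 && isFrac ν n [ν.negName, a] z.2.1 && !WordPoly.isZero ν n z.2.1.1 &&
  decide (1 ≤ z.2.2.1) &&
  z.2.2.2.2.all fun t => isFrac ν n (ν.negName :: a :: z.2.2.2.2.map fun t => t.1) t.2.1 &&
    !WordPoly.isZero ν n t.2.1.1

/-- The test of the numbers in a certificate. -/
def checkNumbers (z : Certificate) : Bool :=
  ν.isMinpoly z.2.2.2.1.1 z.2.2.2.1.2.1 z.2.2.2.1.2.2 &&
  decide (z.2.2.2.2.length + 1 ≤ z.2.2.2.1.2.1.length) &&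
  (List.range z.2.2.2.2.length).all fun k =>
    checkTerm ν z.2.2.2.1.1 k (z.2.2.2.2.getD k (0, ([], []), 0, (0, 0), (0, 0), [], 0))

/-- The test that `z` is a certificate for a representation of the form with code `c`, over the
field generated by the number named `a`. -/
def checkCertificate (a : ℕ) (c : FormCode) (z : Certificate) : Bool :=
  checkData ν n a z && checkNumbers ν z &&
  (List.range n).all fun i => eqFrac ν n (c.getD i ([], [])) (certificateForm ν n i z)

/-- The expression in a certificate. -/
def certificateCode (z : Certificate) : HyperexpCode :=
  (WordFrac.toRatCode ν z.1, WordFrac.toRatCode ν z.2.1, z.2.2.1,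
    z.2.2.2.2.map fun t => (t.1, WordFrac.toRatCode ν t.2.1))

section Computability

variable {α : Type*} [Primcodable α]

@[fun_prop] theorem computable_isFrac {m : α → ℕ} {S : α → List ℕ} {f : α → WordFrac}
    (hm : Computable m) (hS : Computable S) (hf : Computable f) :
    Computable fun x => isFrac ν (m x) (S x) (f x) := by
  unfold isFrac; fun_prop

@[fun_prop] theorem computable_checkTerm {θ k : α → ℕ} {t : α → TermCertificate}
    (hθ : Computable θ) (hk : Computable k) (ht : Computable t) :
    Computable fun x => checkTerm ν (θ x) (k x) (t x) := by
  unfold checkTerm; fun_prop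

@[fun_prop] theorem computable_termSum {m i : α → ℕ} {l : α → List TermCertificate}
    (hm : Computable m) (hi : Computable i) (hl : Computable l) :
    Computable fun x => termSum ν (m x) (i x) (l x) := by
  unfold termSum; fun_prop

@[fun_prop] theorem computable_certificateForm {m i : α → ℕ} {z : α → Certificate}
    (hm : Computable m) (hi : Computable i) (hz : Computable z) :
    Computable fun x => certificateForm ν (m x) (i x) (z x) := by
  unfold certificateForm; fun_prop

@[fun_prop] theorem computable_eqFrac {m : α → ℕ} {g : α → RatCode} {f : α → WordFrac}
    (hm : Computable m) (hg : Computable g) (hf : Computable f) :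
    Computable fun x => eqFrac ν (m x) (g x) (f x) := by
  unfold eqFrac; fun_prop

@[fun_prop] theorem computable_checkData {m a : α → ℕ} {z : α → Certificate}
    (hm : Computable m) (ha : Computable a) (hz : Computable z) :
    Computable fun x => checkData ν (m x) (a x) (z x) := by
  unfold checkData; fun_prop

@[fun_prop] theorem computable_checkNumbers {z : α → Certificate} (hz : Computable z) :
    Computable fun x => checkNumbers ν (z x) := by
  unfold checkNumbers; fun_prop

@[fun_prop] theorem computable_checkCertificate {m a : α → ℕ} {c : α → FormCode}
    {z : α → Certificate} (hm : Computable m) (ha : Computable a) (hc : Computable c)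
    (hz : Computable z) : Computable fun x => checkCertificate ν (m x) (a x) (c x) (z x) := by
  unfold checkCertificate; fun_prop

@[fun_prop] theorem computable_certificateCode {z : α → Certificate} (hz : Computable z) :
    Computable fun x => certificateCode ν (z x) := by
  unfold certificateCode; fun_prop

end Computability

/-- The search for a certificate. -/
def search (x : ℕ × ℕ × FormCode) : Part HyperexpCode :=
  Nat.rfindOpt fun k => (Encodable.decode (α := Certificate) k).bind fun z =>
    bif checkCertificate ν x.1 x.2.1 x.2.2 z then some (certificateCode ν z) else none

theorem partrec_search : Partrec ν.search := by
  refine Partrec.rfindOpt (f := fun (x : ℕ × ℕ × FormCode) (k : ℕ) =>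
    (Encodable.decode (α := Certificate) k).bind fun z =>
      bif checkCertificate ν x.1 x.2.1 x.2.2 z then some (certificateCode ν z) else none) ?_
  refine Computable.option_bind (Computable.decode.comp Computable.snd) ?_
  refine Computable.cond (by fun_prop) (Computable.option_some.comp ?_) (by fun_prop)
  fun_prop

/-- Any passing certificate makes the search halt, but it may stop at another one; only the test is
known of the certificate found. -/
theorem exists_mem_search {a : ℕ} {c : FormCode}
    (h : ∃ z, checkCertificate ν n a c z = true) :
    ∃ o ∈ ν.search (n, a, c), ∃ z, checkCertificate ν n a c z = true ∧ o = certificateCode ν z := by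
  obtain ⟨z, hz⟩ := h
  have hdom : (ν.search (n, a, c)).Dom := by
    refine Nat.rfindOpt_dom.2 ⟨Encodable.encode z, certificateCode ν z, ?_⟩
    rw [Encodable.encodek, Option.bind_some, hz, cond_true]; rfl
  refine ⟨_, Part.get_mem hdom, ?_⟩
  obtain ⟨k, hk⟩ := Nat.rfindOpt_spec (Part.get_mem hdom)
  obtain ⟨y, hy, hk⟩ := Option.bind_eq_some_iff.1 hk
  refine ⟨y, ?_⟩
  cases hc : checkCertificate ν n a c y with
  | false =>
    have hk' : (none : Option HyperexpCode) = some ((ν.search (n, a, c)).get hdom) := by rw [← hk]; simp only [hc, cond_false]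
    exact absurd hk' (by simp)
  | true =>
    have hk' : some (certificateCode ν y) = some ((ν.search (n, a, c)).get hdom) := by rw [← hk]; simp only [hc, cond_true]
    exact ⟨rfl, (Option.some.inj hk').symm⟩

end AlgebraicNumberCoding

end

/-! ### Soundness of the test of certificates. -/

section

open RationalIntegration

namespace AlgebraicNumberCoding

variable {ν : AlgebraicNumberCoding} {n : ℕ}

theorem isFrac_iff {S : List ℕ} {f : WordFrac} : isFrac ν n S f = true ↔
    (WordPoly.uses S f.1 = true ∧ WordPoly.uses S f.2 = true) ∧ WordFrac.Valid ν n f := by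
  rw [isFrac, Bool.and_eq_true, Bool.and_eq_true, Bool.not_eq_true', ← Bool.not_eq_true,
    WordPoly.isZero_iff]
  rfl

theorem valid_termSum {l : List TermCertificate}
    (h : ∀ t ∈ l, WordFrac.Valid ν n t.2.1 ∧ WordPoly.poly ν n t.2.1.1 ≠ 0) (i : Fin n) :
    WordFrac.Valid ν n (termSum ν n i l) ∧ WordFrac.val ν n (termSum ν n i l) =
      (l.map fun t => RatFun.const n (ν.val t.1) * RatForm.dlog (WordFrac.val ν n t.2.1) i).sum := by
  have key (l : List TermCertificate) (s : WordFrac) (hs : WordFrac.Valid ν n s)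
      (h : ∀ t ∈ l, WordFrac.Valid ν n t.2.1 ∧ WordPoly.poly ν n t.2.1.1 ≠ 0) :
      let x := l.foldl (fun s t => WordFrac.add n s
        (WordFrac.mul n ([([], [t.1])], WordPoly.one) (WordFrac.dlog ν n i t.2.1))) s
      WordFrac.Valid ν n x ∧ WordFrac.val ν n x = WordFrac.val ν n s + (l.map fun t =>
        RatFun.const n (ν.val t.1) * RatForm.dlog (WordFrac.val ν n t.2.1) i).sum := by
    induction l generalizing s with
    | nil => simpa using hs
    | cons t l ih =>
      have h1 := (h t List.mem_cons_self).1.dlog (h t List.mem_cons_self).2 i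
      have h2 : WordFrac.Valid ν n ([([], [t.1])], WordPoly.one) := by simp [WordFrac.Valid]
      have h3 := h2.mul h1.1
      have h4 := hs.add h3.1
      have h5 := ih _ h4.1 fun t ht => h t (List.mem_cons_of_mem _ ht)
      refine ⟨h5.1, h5.2.trans ?_⟩
      have h6 : WordFrac.val ν n ([([], [t.1])], WordPoly.one) = RatFun.const n (ν.val t.1) := by
        have : WordPoly.expo n [] = 0 := by ext; simp
        rw [WordFrac.val, WordPoly.poly_one, map_one, div_one, WordPoly.poly_cons,
          WordPoly.poly_nil, add_zero, this, ν.wordVal_cons, ν.wordVal_nil, mul_one]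
        rfl
      rw [h4.2, h3.2, h1.2, h6, List.map_cons, List.sum_cons, add_assoc]
  have h0 := key l ([], WordPoly.one) (by simp [WordFrac.Valid]) h
  refine ⟨h0.1, h0.2.trans ?_⟩
  rw [WordFrac.val, WordPoly.poly_nil, map_zero, zero_div, zero_add]

/-- What the test of the data of a certificate ensures. -/
structure IsCertificateData (ν : AlgebraicNumberCoding) (n a : ℕ) (z : Certificate) : Prop where
  F0_frac : isFrac ν n [ν.negName, a] z.1 = true
  A_frac : isFrac ν n [ν.negName, a] z.2.1 = true
  A_ne_zero : WordPoly.poly ν n z.2.1.1 ≠ 0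
  q_pos : 0 < z.2.2.1
  F_frac : ∀ t ∈ z.2.2.2.2,
    isFrac ν n (ν.negName :: a :: z.2.2.2.2.map fun t => t.1) t.2.1 = true
  F_ne_zero : ∀ t ∈ z.2.2.2.2, WordPoly.poly ν n t.2.1.1 ≠ 0

theorem checkData_iff {a : ℕ} {z : Certificate} :
    checkData ν n a z = true ↔ IsCertificateData ν n a z := by
  simp only [checkData, Bool.and_eq_true, Bool.not_eq_true', ← Bool.not_eq_true,
    WordPoly.isZero_iff, decide_eq_true_iff, List.all_eq_true]
  exact ⟨fun ⟨⟨⟨⟨h1, h2⟩, h3⟩, h4⟩, h5⟩ => ⟨h1, h2, h3, h4, fun t ht => (h5 t ht).1,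
    fun t ht => (h5 t ht).2⟩, fun h => ⟨⟨⟨⟨h.1, h.2⟩, h.3⟩, h.4⟩, fun t ht => ⟨h.5 t ht, h.6 t ht⟩⟩⟩

theorem IsCertificateData.valid_certificateForm {a : ℕ} {z : Certificate}
    (h : IsCertificateData ν n a z) (i : Fin n) :
    WordFrac.Valid ν n (certificateForm ν n i z) ∧
    WordFrac.val ν n (certificateForm ν n i z) = RatFun.pd i (WordFrac.val ν n z.1) +
      (RatFun.const n (1 / (z.2.2.1 : ℂ)) * RatForm.dlog (WordFrac.val ν n z.2.1) i +
      (z.2.2.2.2.map fun t =>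
        RatFun.const n (ν.val t.1) * RatForm.dlog (WordFrac.val ν n t.2.1) i).sum) := by
  have h1 := (isFrac_iff.1 h.F0_frac).2.pd i
  have h2 := (isFrac_iff.1 h.A_frac).2.dlog h.A_ne_zero i
  have h3 := valid_termSum (ν := ν) (l := z.2.2.2.2)
    (fun t ht => ⟨(isFrac_iff.1 (h.F_frac t ht)).2, h.F_ne_zero t ht⟩) i
  have hq : (z.2.2.1 : ℂ) ≠ 0 := by exact_mod_cast h.q_pos.ne'
  have he : WordPoly.expo n [] = 0 := by ext; simp
  have hp : WordPoly.poly ν n (List.replicate z.2.2.1 ([], [])) =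
      MvPolynomial.C (z.2.2.1 : ℂ) := by
    rw [WordPoly.poly_replicate, he, ν.wordVal_nil, one_mul]
    rfl
  have h4 : WordFrac.Valid ν n (WordPoly.one, List.replicate z.2.2.1 ([], [])) := by
    rw [WordFrac.Valid, hp]
    simpa using h.q_pos.ne'
  have h5 : WordFrac.val ν n (WordPoly.one, List.replicate z.2.2.1 ([], [])) =
      RatFun.const n (1 / (z.2.2.1 : ℂ)) := by
    rw [WordFrac.val, hp, WordPoly.poly_one, map_one, map_div₀, map_one]
    rfl
  have h6 := h4.mul h2.1
  have h7 := h6.1.add h3.1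
  have h8 := h1.1.add h7.1
  refine ⟨h8.1, h8.2.trans ?_⟩
  rw [h7.2, h6.2, h1.2, h2.2, h3.2, h5]

/-- A given code may have a zero denominator. It then denotes `0`, by the convention for division,
and cross multiplication would be wrong; hence the separate branch of the test. -/
theorem eqFrac_iff {g : RatCode} {f : WordFrac} (hf : WordFrac.Valid ν n f) :
    eqFrac ν n g f = true ↔ ν.ratFun n g = WordFrac.val ν n f := by
  have hf' := hf.ne_zero
  have hinj := IsFractionRing.injective (MvPolynomial (Fin n) ℂ) (RatFun n)
  rw [eqFrac]
  cases hg : WordPoly.isZero ν n (WordPoly.ofPolyCode g.2) with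
  | true =>
    rw [WordPoly.isZero_iff, WordPoly.poly_ofPolyCode] at hg
    rw [cond_true, WordPoly.isZero_iff, ratFun, hg, map_zero, div_zero, WordFrac.val,
      eq_comm (a := (0 : RatFun n)), div_eq_zero_iff, or_iff_left hf', map_eq_zero_iff _ hinj]
  | false =>
    rw [← Bool.not_eq_true, WordPoly.isZero_iff, WordPoly.poly_ofPolyCode] at hg
    have hg' := RatFun.algebraMap_ne_zero hg
    rw [cond_false, WordPoly.isZero_iff, ratFun, WordFrac.val, div_eq_div_iff hg' hf',
      ← map_mul, ← map_mul, hinj.eq_iff, WordPoly.poly_append, WordPoly.poly_smul,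
      WordPoly.poly_mul, WordPoly.poly_mul, WordPoly.poly_ofPolyCode, WordPoly.poly_ofPolyCode,
      ν.val_negName]
    simp only [map_neg, map_one]
    constructor <;> intro h <;> linear_combination h

/-- What the test of the number in the certificate of a term ensures. -/
theorem checkTerm_iff {θ k : ℕ} {t : TermCertificate} : checkTerm ν θ k t = true ↔
    0 < t.2.2.2.1.1 ∧ 0 < t.2.2.2.1.2 ∧ (t.2.2.2.1.1 : ℂ) * ν.val t.1 = ν.val t.2.2.1 ∧
    (t.2.2.2.1.2 : ℂ) * ν.val θ ^ (k + 1) + t.2.2.2.2.1.2 - t.2.2.2.2.1.1 = ν.val t.2.2.1 ∧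
    ν.isMinpoly t.2.2.1 (t.2.2.2.2.2.2 :: t.2.2.2.2.2.1) t.2.2.2.2.2.2 = true := by
  simp only [checkTerm, Bool.and_eq_true, decide_eq_true_iff, isZero_iff, sumVal_append,
    sumVal_replicate, sumVal_cons, sumVal_nil, wordVal_cons, wordVal_nil, wordVal_replicate,
    val_negName, and_assoc, Nat.succ_le_iff]
  refine and_congr_right fun _ => and_congr_right fun _ => and_congr ?_ (and_congr_left fun _ => ?_)
  · constructor <;> intro h <;> linear_combination h
  · constructor <;> intro h <;> linear_combination h

theorem checkNumbers_iff {z : Certificate} : checkNumbers ν z = true ↔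
    ν.isMinpoly z.2.2.2.1.1 z.2.2.2.1.2.1 z.2.2.2.1.2.2 = true ∧
    z.2.2.2.2.length < z.2.2.2.1.2.1.length ∧
    ∀ k (hk : k < z.2.2.2.2.length), checkTerm ν z.2.2.2.1.1 k z.2.2.2.2[k] = true := by
  simp only [checkNumbers, Bool.and_eq_true, decide_eq_true_iff, List.all_eq_true, List.mem_range,
    and_assoc, Nat.succ_le_iff]
  refine and_congr_right fun _ => and_congr_right fun _ => forall₂_congr fun k hk => ?_
  rw [List.getD_eq_getElem _ _ hk]

theorem checkCertificate_iff {a : ℕ} {c : FormCode} {z : Certificate} :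
    checkCertificate ν n a c z = true ↔ IsCertificateData ν n a z ∧ checkNumbers ν z = true ∧
      ∀ i : Fin n, ν.form n c i = WordFrac.val ν n (certificateForm ν n i z) := by
  rw [checkCertificate, Bool.and_eq_true, Bool.and_eq_true, checkData_iff, and_assoc]
  refine and_congr_right fun h => and_congr_right fun _ => ?_
  rw [List.all_eq_true]
  constructor
  · intro h' i
    exact (eqFrac_iff (h.valid_certificateForm i).1).1 (h' i (List.mem_range.2 i.2))
  · intro h' i hi
    exact (eqFrac_iff (h.valid_certificateForm ⟨i, List.mem_range.1 hi⟩).1).2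
      (h' ⟨i, List.mem_range.1 hi⟩)

/-- The expression `r` is kept abstract and known only through equations, so that the dependence of
its families on `p` does not interfere with the list of terms. -/
theorem isRepresentation_of_isCertificateData {a : ℕ} {c : FormCode} {z : Certificate}
    (hd : IsCertificateData ν n a z) (hnum : checkNumbers ν z = true)
    (hform : ∀ i : Fin n, ν.form n c i = WordFrac.val ν n (certificateForm ν n i z))
    {r : HyperexpData n} (hF0 : r.F0 = WordFrac.val ν n z.1) (hA : r.A = WordFrac.val ν n z.2.1)
    (hq : r.q = z.2.2.1) (hp : r.p = z.2.2.2.2.length)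
    (hlam : ∀ j : Fin r.p, r.lam j = ν.val (z.2.2.2.2[(j : ℕ)]'(hp ▸ j.2)).1)
    (hF : ∀ j : Fin r.p, r.F j = WordFrac.val ν n (z.2.2.2.2[(j : ℕ)]'(hp ▸ j.2)).2.1) :
    r.IsRepresentation (Subfield.closure {ν.val a}) (ν.form n c) := by
  obtain ⟨hθ, hlen, hterm⟩ := checkNumbers_iff.1 hnum
  set K := Subfield.closure {ν.val a} with hK
  have hS : ∀ b ∈ [ν.negName, a], ν.val b ∈ K := by
    intro b hb
    simp only [List.mem_cons, List.not_mem_nil, or_false] at hb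
    rcases hb with rfl | rfl
    · rw [ν.val_negName]; exact neg_mem (one_mem _)
    · exact Subfield.subset_closure rfl
  have hne {f : WordFrac} (h1 : WordPoly.poly ν n f.1 ≠ 0) (h2 : WordFrac.Valid ν n f) :
      WordFrac.val ν n f ≠ 0 := div_ne_zero (RatFun.algebraMap_ne_zero h1) h2.ne_zero
  have hmem (j : Fin r.p) : z.2.2.2.2[(j : ℕ)]'(hp ▸ j.2) ∈ z.2.2.2.2 := List.getElem_mem _
  have hform_eq : ν.form n c = RatForm.d r.F0 + (RatFun.const n (1 / (r.q : ℂ))) •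
      RatForm.dlog r.A + ∑ j, RatFun.const n (r.lam j) • RatForm.dlog (r.F j) := by
    funext i
    rw [hform i, (hd.valid_certificateForm i).2, hF0, hA, hq]
    simp only [Pi.add_apply, Pi.smul_apply, Finset.sum_apply, smul_eq_mul]
    rw [add_assoc]
    congr 2
    rw [← Fin.sum_univ_fun_getElem]
    refine (Fintype.sum_equiv (finCongr hp) _ _ fun j => ?_).symm
    rw [hlam, hF]
    rfl
  have hqr : 0 < r.q := hq ▸ hd.q_pos
  refine ⟨?_, ?_, ?_, hqr, ?_, fun j => ?_, fun j => ?_, fun j => ?_, ?_, hform_eq,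
    fun V g hg => hg.hasLogDifferential hqr hform_eq⟩
  · rw [hF0]
    obtain ⟨⟨h1, h2⟩, -⟩ := isFrac_iff.1 hd.F0_frac
    exact WordFrac.mem_ratField_of_uses hS h1 h2
  · rw [hA]
    obtain ⟨⟨h1, h2⟩, -⟩ := isFrac_iff.1 hd.A_frac
    exact WordFrac.mem_ratField_of_uses hS h1 h2
  · rw [hA]
    exact hne hd.A_ne_zero (isFrac_iff.1 hd.A_frac).2
  · refine IntermediateField.finiteDimensional_adjoin fun x hx => ?_
    obtain ⟨j, rfl⟩ := hx
    rw [hlam]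
    exact (ν.isAlgebraic_val _).isIntegral.tower_top
  · rw [hF]
    obtain ⟨⟨h1, h2⟩, -⟩ := isFrac_iff.1 (hd.F_frac _ (hmem j))
    refine WordFrac.mem_ratField_of_uses (fun b hb => ?_) h1 h2
    have hb := List.mem_append.1 (show b ∈ [ν.negName, a] ++ z.2.2.2.2.map fun t => t.1 from hb)
    rcases hb with hb | hb
    · exact (r.constField K).algebraMap_mem ⟨_, hS b hb⟩
    · obtain ⟨t, ht, rfl⟩ := List.mem_map.1 hb
      obtain ⟨k, hk, rfl⟩ := List.getElem_of_mem ht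
      exact IntermediateField.subset_adjoin K _ ⟨⟨k, hp ▸ hk⟩, hlam _⟩
  · rw [hF]
    exact hne (hd.F_ne_zero _ (hmem j)) (isFrac_iff.1 (hd.F_frac _ (hmem j))).2
  · obtain ⟨h1, -, h2, -, h3⟩ := checkTerm_iff.1 (hterm j (hp ▸ j.2))
    obtain ⟨h4, h5⟩ := ν.minpoly_eq_of_isMinpoly h3
    rw [hlam]
    exact (mem_tracelessSubmodule.1 (isTraceless_of_mul_eq h4 h5 h1 h2)).2
  · obtain ⟨h4, h5⟩ := ν.minpoly_eq_of_isMinpoly hθ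
    have h6 : (minpoly ℚ (ν.val z.2.2.2.1.1)).natDegree = z.2.2.2.1.2.1.length := by
      rw [minpoly.isIntegrallyClosed_eq_field_fractions' ℚ h4, (minpoly.monic h4).natDegree_map, h5,
        (monic_natDegree_intPoly _ _).2]
    set t : Fin r.p → TermCertificate := fun j => z.2.2.2.2[(j : ℕ)]'(hp ▸ j.2) with ht
    refine linearIndependent_of_affine_powers (θ := ν.val z.2.2.2.1.1) (by omega)
      (u := fun j => (t j).2.2.2.1.2 / (t j).2.2.2.1.1)
      (w := fun j => ((t j).2.2.2.2.1.2 - (t j).2.2.2.2.1.1) / (t j).2.2.2.1.1)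
      (fun j => ?_) fun j => ?_
    · obtain ⟨h1, h2, -⟩ := checkTerm_iff.1 (hterm j (hp ▸ j.2))
      exact div_ne_zero (by exact_mod_cast h2.ne') (by exact_mod_cast h1.ne')
    · obtain ⟨h1, -, h2, h3, -⟩ := checkTerm_iff.1 (hterm j (hp ▸ j.2))
      have h1' : ((t j).2.2.2.1.1 : ℂ) ≠ 0 := by exact_mod_cast h1.ne'
      rw [hlam]
      push_cast
      rw [← mul_right_inj' h1']
      refine (h2.trans h3.symm).trans ?_
      field_simp
      ring

theorem isRepresentation_of_checkCertificate {a : ℕ} {c : FormCode} {z : Certificate}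
    (h : checkCertificate ν n a c z = true) :
    (ν.hyperexp n (certificateCode ν z)).IsRepresentation (Subfield.closure {ν.val a})
      (ν.form n c) := by
  obtain ⟨hd, hnum, hform⟩ := checkCertificate_iff.1 h
  have key {l : List TermCertificate} (g : TermCertificate → ℕ × RatCode)
      (j : Fin (l.map g).length) : (l.map g).get j = g (l[(j : ℕ)]'(l.length_map g ▸ j.2)) := by
    simp
  exact isRepresentation_of_isCertificateData hd hnum hform (WordFrac.ratFun_toRatCode _)
    (WordFrac.ratFun_toRatCode _) rfl (List.length_map _)
    (fun j => congrArg (fun x : ℕ × RatCode => ν.val x.1) (key _ j))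
    fun j => (congrArg (fun x : ℕ × RatCode => ν.ratFun n x.2) (key _ j)).trans (WordFrac.ratFun_toRatCode _)

end AlgebraicNumberCoding

end

/-! ### Completeness: a passing certificate exists. -/

section

open RationalIntegration

theorem numberField_closure_singleton {z : ℂ} (hz : IsAlgebraic ℚ z) :
    NumberField (Subfield.closure {z}) := by
  have h1 : FiniteDimensional ℚ (IntermediateField.adjoin ℚ {z}) :=
    IntermediateField.adjoin.finiteDimensional hz.isIntegral
  have h2 : Subfield.closure {z} ≤ (IntermediateField.adjoin ℚ {z}).toSubfield :=
    Subfield.closure_le.2 fun x hx => IntermediateField.subset_adjoin ℚ _ hx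
  exact
    { to_charZero := inferInstance
      to_finiteDimensional := by
        refine FiniteDimensional.of_injective
          (Subfield.inclusion h2).toRatAlgHom.toLinearMap (Subfield.inclusion h2).injective }

namespace AlgebraicNumberCoding

variable {ν : AlgebraicNumberCoding} {n : ℕ}

/-- `D z` is an algebraic integer, because `θ` is one, and is traceless, because `z` is; its
integral minimal polynomial is the certificate. The test ignores `f`, so `y` can be chosen before
it. -/
theorem exists_checkTerm {θ k : ℕ} (hθ : IsIntegral ℤ (ν.val θ)) {D U : ℕ} {w : ℤ} {z : ℂ}
    (hz : z ∈ tracelessSubmodule) (hD : 0 < D) (hU : 0 < U)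
    (h : (D : ℂ) * z = U * ν.val θ ^ (k + 1) - w) {a : ℕ} (ha : ν.val a = z) :
    ∃ y, ∀ f : WordFrac, checkTerm ν θ k (a, f, y) = true := by
  have hint : IsIntegral ℤ ((D : ℂ) * z) := by
    rw [h]
    have h1 : IsIntegral ℤ (U : ℂ) := by simpa using isIntegral_algebraMap (R := ℤ) (x := (U : ℤ)) (A := ℂ)
    have h2 : IsIntegral ℤ (w : ℂ) := by simpa using isIntegral_algebraMap (R := ℤ) (x := w) (A := ℂ)
    exact (h1.mul (hθ.pow _)).sub h2
  obtain ⟨E, hE⟩ := ν.exists_val (hint.tower_top (A := ℚ)).isAlgebraic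
  rw [← hE] at hint
  obtain ⟨l, B, hl⟩ := ν.exists_isMinpoly hint
  obtain ⟨h1, h2⟩ := ν.minpoly_eq_of_isMinpoly hl
  have hDz : (D : ℂ) * z ∈ tracelessSubmodule := by
    have := tracelessSubmodule.smul_mem (D : ℚ) hz
    rw [Algebra.smul_def] at this
    simpa using this
  have h3 : (intPoly l B).nextCoeff = 0 := by
    have h4 := (mem_tracelessSubmodule.1 hDz).2
    rw [IsTraceless, ← hE, minpoly.isIntegrallyClosed_eq_field_fractions' ℚ h1,
      Polynomial.nextCoeff_map (algebraMap ℤ ℚ).injective_int, h2] at h4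
    simpa using h4
  cases l with
  | nil =>
    have h4 := minpoly.natDegree_pos h1
    rw [h2] at h4
    simp at h4
  | cons c l =>
    rw [nextCoeff_intPoly_cons, sub_eq_zero, Nat.cast_inj] at h3
    subst h3
    -- Tracelessness has forced the first entry to equal the bound, which is now `c`. The integer
    -- `w` enters as a difference of naturals, since formal sums can only repeat `1` and `-1`.
    refine ⟨(E, (D, U), (w.toNat, (-w).toNat), l, c), fun f =>
      checkTerm_iff.2 ⟨hD, hU, ?_, ?_, hl⟩⟩
    · rw [ha, hE]
    · have h5 : (w : ℂ) = (w.toNat : ℂ) - ((-w).toNat : ℂ) := by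
        exact_mod_cast congrArg (Int.cast (R := ℂ)) (Int.toNat_sub_toNat_neg w).symm
      change (U : ℂ) * ν.val θ ^ (k + 1) + ((-w).toNat : ℂ) - (w.toNat : ℂ) = ν.val E
      rw [hE, h, h5]
      ring

theorem exists_checkCertificate {a : ℕ} {c : FormCode}
    (hω : (ν.form n c).IsOver (Subfield.closure {ν.val a})) (hcl : (ν.form n c).Closed) :
    ∃ z, checkCertificate ν n a c z = true := by
  have := numberField_closure_singleton (ν.isAlgebraic_val a)
  obtain ⟨r₀, hr₀⟩ := exists_isRepresentation hω hcl
  obtain ⟨θ, r, D, U, w, hθ, hdeg, hr, hD, hU, hlam⟩ := hr₀.exists_powers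
  obtain ⟨m, rfl⟩ := ν.exists_val (hθ.tower_top (A := ℚ)).isAlgebraic
  obtain ⟨l, B, hl⟩ := ν.exists_isMinpoly hθ
  have hlen : l.length = r.p + 1 := by
    obtain ⟨h1, h2⟩ := ν.minpoly_eq_of_isMinpoly hl
    rw [← hdeg, minpoly.isIntegrallyClosed_eq_field_fractions' ℚ h1,
      (minpoly.monic h1).natDegree_map, h2, (monic_natDegree_intPoly _ _).2]
  have hK (S : List ℕ) (hS : a ∈ S) :
      Subfield.closure {ν.val a} ≤ Subfield.closure (ν.val '' {b | b ∈ S}) :=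
    Subfield.closure_mono (Set.singleton_subset_iff.2 ⟨a, hS, rfl⟩)
  have hcod {z : RatFun n} (hz : z ∈ RatFun.ratField (Subfield.closure {ν.val a}) Set.univ) :
      ∃ f, isFrac ν n [ν.negName, a] f = true ∧ WordFrac.val ν n f = z := by
    obtain ⟨f, h1, h2, h3, h4⟩ := WordFrac.codable_of_mem (ν := ν) (S := [ν.negName, a])
      List.mem_cons_self (RatFun.ratField_mono (hK _ (by simp)) le_rfl hz)
    exact ⟨f, isFrac_iff.2 ⟨⟨h2, h3⟩, h1⟩, h4⟩
  obtain ⟨f0, hf0, hf0'⟩ := hcod hr.F0_mem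
  obtain ⟨fA, hfA, hfA'⟩ := hcod hr.A_mem
  choose b hb using fun j => ν.exists_val (mem_tracelessSubmodule.1 (hr.lam_mem j)).1
  choose y hy using fun j => exists_checkTerm hθ (hr.lam_mem j) hD hU (hlam j) (hb j)
  set S : List ℕ := ν.negName :: a :: List.ofFn b with hS
  -- The words in `S` reach every constant of the `F_j`: the field generated by the values of `S`
  -- contains `K` and all `λ_j`.
  have hL : (r.constField (Subfield.closure {ν.val a})).toSubfield ≤
      Subfield.closure (ν.val '' {b | b ∈ S}) := by
    let L : IntermediateField (Subfield.closure {ν.val a}) ℂ :=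
      { Subfield.closure (ν.val '' {b | b ∈ S}) with
        algebraMap_mem' := fun x => hK S (by simp [hS]) x.2 }
    have h1 : r.constField (Subfield.closure {ν.val a}) ≤ L := by
      refine IntermediateField.adjoin_le_iff.2 ?_
      rintro _ ⟨j, rfl⟩
      exact Subfield.subset_closure ⟨b j, by simp [hS], hb j⟩
    exact h1
  have hcodF (j : Fin r.p) : ∃ f, isFrac ν n S f = true ∧ WordFrac.val ν n f = r.F j := by
    obtain ⟨f, h1, h2, h3, h4⟩ := WordFrac.codable_of_mem (ν := ν) (S := S)
      List.mem_cons_self (RatFun.ratField_mono hL le_rfl (hr.F_mem j))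
    exact ⟨f, isFrac_iff.2 ⟨⟨h2, h3⟩, h1⟩, h4⟩
  choose f hf hf' using hcodF
  have hne {g : WordFrac} {z : RatFun n} (h : WordFrac.val ν n g = z) (hz : z ≠ 0) :
      WordPoly.poly ν n g.1 ≠ 0 := by
    rintro h0
    rw [WordFrac.val, h0, map_zero, zero_div] at h
    exact hz h.symm
  set t : List TermCertificate := List.ofFn fun j => (b j, f j, y j) with ht
  have htS : (ν.negName :: a :: t.map fun t => t.1) = S := by
    rw [ht, List.map_ofFn]; rfl
  have hdata : IsCertificateData ν n a (f0, fA, r.q, (m, l, B), t) := by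
    refine ⟨hf0, hfA, hne hfA' hr.A_ne_zero, hr.q_pos, fun x hx => ?_, fun x hx => ?_⟩
    · obtain ⟨j, rfl⟩ := (List.mem_ofFn' _ _).1 hx
      change isFrac ν n (ν.negName :: a :: t.map fun t => t.1) (f j) = true
      rw [htS]
      exact hf j
    · obtain ⟨j, rfl⟩ := (List.mem_ofFn' _ _).1 hx
      exact hne (hf' j) (hr.F_ne_zero j)
  refine ⟨(f0, fA, r.q, (m, l, B), t), checkCertificate_iff.2 ⟨hdata, checkNumbers_iff.2
    ⟨hl, ?_, fun k hk => ?_⟩, fun i => ?_⟩⟩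
  · change t.length < l.length
    rw [ht, List.length_ofFn, hlen]
    exact Nat.lt_succ_self _
  · change checkTerm ν m k t[k] = true
    simp only [ht, List.getElem_ofFn]
    exact hy ⟨k, _⟩ _
  · rw [(hdata.valid_certificateForm i).2]
    change _ = RatFun.pd i (WordFrac.val ν n f0) + (RatFun.const n (1 / (r.q : ℂ)) *
      RatForm.dlog (WordFrac.val ν n fA) i + (t.map fun t =>
        RatFun.const n (ν.val t.1) * RatForm.dlog (WordFrac.val ν n t.2.1) i).sum)
    rw [hf0', hfA', ht, List.map_ofFn, List.sum_ofFn, hr.form_eq, ← add_assoc]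
    simp [hb, hf', RatForm.d]

end AlgebraicNumberCoding

end

end

theorem mainTheorem4 :
    (∀ (K : Subfield ℂ) [NumberField K] (n : ℕ) (U : Set (Fin n → ℂ)) (H : (Fin n → ℂ) → ℂ),
        IsHyperexponential K U H →
      ∃ (ω : RatForm n) (r : HyperexpData n), ω.IsOver K ∧ HasLogDifferential U H ω ∧
        r.IsRepresentation K ω ∧ r.Expresses U H) ∧
    (∀ (K : Subfield ℂ) [NumberField K] (n : ℕ) (ω : RatForm n), ω.IsOver K → ω.Closed →
      Acc (fun c' c => RationalIntegration.Step K c c') (RationalIntegration.start K ω) ∧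
      (∀ c, RationalIntegration.Reaches K ω c →
        (∃ r, c = .done r) ∨ ∃ c', RationalIntegration.Step K c c') ∧
      (∀ r, RationalIntegration.Reaches K ω (.done r) →
        r.IsRepresentation K ω ∧
        ∀ U H, HasLogDifferential U H ω → r.Expresses U H)) ∧
    (∀ ν : AlgebraicNumberCoding, ∃ f : ℕ × ℕ × FormCode →. HyperexpCode, Partrec f ∧
      ∀ (n a : ℕ) (c : FormCode),
        (ν.form n c).IsOver (Subfield.closure {ν.val a}) → (ν.form n c).Closed →
        ∃ o ∈ f (n, a, c),
          (ν.hyperexp n o).IsRepresentation (Subfield.closure {ν.val a}) (ν.form n c)) := by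
  refine ⟨fun K _ n U H h => exists_representation_of_isHyperexponential K n U H h,
    fun K _ n ω hω hcl => rationalIntegration_correct K n ω hω hcl, fun ν => ⟨ν.search,
      ν.partrec_search, fun n a c hω hcl => ?_⟩⟩
  obtain ⟨o, ho, z, hz, rfl⟩ :=
    ν.exists_mem_search n (AlgebraicNumberCoding.exists_checkCertificate hω hcl)
  exact ⟨_, ho, AlgebraicNumberCoding.isRepresentation_of_checkCertificate hz⟩
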